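/- **Conventions.** Let $G$ be a group and $A$ a finite alphabet with a formal inversion $a\mapsto a^{-1}$ and a map $\rho\colon A^*\to G$ (a monoid homomorphism) with $\rho(a^{-1})=\rho(a)^{-1}$ and $\rho(a)\ne 1$ for $a\in A$, whose image generates $G$. Let $\Gamma$ be the Cayley graph, with directed edges $e_{g,a}$ from $g$ to $g\rho(a)$ labeled $a$; $e_{g,a}$ and $e_{g\rho(a),a^{-1}}$ have the same underlying undirected edge. $G$ is *algorithmically stackable* over $A$ if there are a maximal tree $T$ in $\Gamma$, a function $\Phi$ from directed edges to directed edge paths of $\Gamma$, and a constant $k$ such that: (F1) $\Phi(e)$ has the same endpoints as $e$; (F2d) $\Phi(e)=e$ if $e$ lies in $T$; (F2r) the transitive closure of the relation "$e'<e$ iff $e'$ lies on $\Phi(e)$ and neither $e$ nor $e'$ lies in $T$" on directed edges is a well-founded strict partial order; (F3) every path $\Phi(e)$ has length at most $k$; and the set $\{(w,a,\mathrm{label}(\Phi(e_{\rho(w),a}))) : w\in A^*,\ a\in A\}\subseteq A^*\times A\times A^*$ is recursive. A *finite symmetric presentation* $\mathcal P=\langle A\mid R\rangle$ of $G$ is a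 presentation with $R$ a finite set of nonempty words closed under inversion, cyclic conjugation and passage to nonempty freely reduced forms. Let $X$ be its Cayley complex. For a combinatorial 2-complex $Y$ with base vertex $y$, the *coarse distance* $\tilde d_Y(y,p)$ is the path distance in $Y^{(1)}$ if $p$ is a vertex; it is $\frac12$ plus the smaller distance from $y$ to an endpoint of $e$ if $p$ is interior to an edge $e$; and it is $\max\{\tilde d_Y(y,q) : q\in\partial\sigma\setminus Y^{(0)}\}-\frac14$ if $p$ is interior to a 2-cell $\sigma$. These values lie in $\mathbb N[\frac14]=\{n/4 : n\in\mathbb N\}$. For a van Kampen diagram $\Delta$ over $\mathcal P$ with basepoint $*$, a *1-combing* of $(\Delta,\partial\Delta)$ is a continuous $\Psi\colon\partial\Delta\times[0,1]\to\Delta$ with $\Psi(p,0)=*$ and $\Psi(p,1)=p$ for all $p$, $\Psi(*,t)=*$ for all $t$, and $\Psi(p,t)\in\Delta^{(1)}$ for all $t$ whenever $p$ is a vertex. Let $\pi_\Delta\colon\Delta\to X$ be the cellular map preserving labels and orientations with $\pi_\Delta(*)=1$. A nondecreasing $f\colon\mathbb N[\frac14]\to\mathbb N[\frac14]$ is an *intrinsic*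 (respectively *extrinsic*) *tame filling function* for $G$ over $\mathcal P$ if every word $w\in A^*$ with $\rho(w)=1$ has a van Kampen diagram $\Delta$ over $\mathcal P$ and a 1-combing $\Psi$ of $(\Delta,\partial\Delta)$ such that for all $p\in\partial\Delta$ and $0\le s<t\le1$, $$\tilde d_\Delta(*,\Psi(p,s))\le f\big(\tilde d_\Delta(*,\Psi(p,t))\big)\quad\text{(respectively } \tilde d_X(1,\pi_\Delta\Psi(p,s))\le f\big(\tilde d_X(1,\pi_\Delta\Psi(p,t))\big)\text{).}$$ **Theorem.** If $G$ is algorithmically stackable over $A$, then there is a finite symmetric presentation $\mathcal P=\langle A\mid R\rangle$ of $G$ over which $G$ has a recursive (computable) intrinsic tame filling function and a recursive extrinsic tame filling function. -/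

import Mathlib

noncomputable section

open scoped unitInterval

universe u v w u' v' w'

/-! ## Combinatorial complexes of dimension at most two -/

/-- A 1-dimensional CW complex, given by its vertices and its directed edges.  Every undirected
edge is a pair `{e, inv e}` of directed edges.  Loops and parallel edges are allowed. -/
structure OneComplex where
  V : Type u
  E : Type v
  src : E → V
  inv : E → E
  inv_inv : ∀ e, inv (inv e) = e
  inv_ne : ∀ e, inv e ≠ e

namespace OneComplex

variable (Y : OneComplex.{u, v})

/-- The terminal vertex of a directed edge. -/
def tgt (e : Y.E) : Y.V := Y.src (Y.inv e)

/-- `Y.IsPath p l q`: the list `l` of directed edges is a directed edge path from `p` to `q`. -/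
def IsPath (p : Y.V) : List Y.E → Y.V → Prop
  | [], q => p = q
  | e :: l, q => Y.src e = p ∧ IsPath (Y.tgt e) l q

/-- The simple graph recording which pairs of distinct vertices are joined by an edge. -/
def graph : SimpleGraph Y.V :=
  SimpleGraph.fromRel fun p q => ∃ e, Y.src e = p ∧ Y.tgt e = q

/-- The path metric of the 1-complex, on vertices. -/
def vdist (p q : Y.V) : ℕ := Y.graph.dist p q

/-- A maximal tree, as a set of directed edges: it is closed under reversing edges, and
any two vertices are joined by exactly one path without backtracking in it. -/
structure IsMaximalTree (T : Set Y.E) : Prop where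
  inv_mem : ∀ e ∈ T, Y.inv e ∈ T
  existsUnique_path : ∀ p q : Y.V, ∃! l : List Y.E,
    Y.IsPath p l q ∧ (∀ e ∈ l, e ∈ T) ∧ l.IsChain (fun e e' => e' ≠ Y.inv e)

theorem tgt_getElem_of_isPath {p q : Y.V} {l : List Y.E} (h : Y.IsPath p l q) (k : ℕ)
    (hk : k + 1 < l.length) : Y.tgt l[k] = Y.src l[k + 1] := by
  induction l generalizing p k with
  | nil => simp at hk
  | cons e l ih =>
    obtain ⟨-, h2⟩ := h
    cases k with
    | zero =>
      cases l with
      | nil => simp at hk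
      | cons e' l => simpa using h2.1.symm
    | succ k => simpa using ih h2 k (by simpa using hk)

theorem src_head_of_isPath {p q : Y.V} {l : List Y.E} (h : Y.IsPath p l q)
    (hl : 0 < l.length) : Y.src l[0] = p := by
  cases l with
  | nil => simp at hl
  | cons e l => exact h.1

theorem tgt_last_of_isPath {p q : Y.V} {l : List Y.E} (h : Y.IsPath p l q)
    (hl : l.length - 1 < l.length) : Y.tgt l[l.length - 1] = q := by
  induction l generalizing p with
  | nil => simp at hl
  | cons e l ih =>
    obtain ⟨-, h2⟩ := h
    cases l with
    | nil => exact h2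
    | cons e' l => simpa using ih h2 (by simp)

end OneComplex

/-- A combinatorial 2-complex: each 2-cell is a polygon attached along a nonempty closed
edge path. -/
structure TwoComplex extends OneComplex.{u, v} where
  F : Type w
  bdry : F → List E
  bdry_ne_nil : ∀ f, bdry f ≠ []
  bdry_closed : ∀ f, ∃ p, toOneComplex.IsPath p (bdry f) p

namespace TwoComplex

variable (Y : TwoComplex.{u, v, w})

/-- The closed unit disk. -/
abbrev Disk : Type := Metric.closedBall (0 : ℂ) 1

/-- The point with parameter `t` on the `k`-th of the `n` arcs into which the unit circle
is divided. -/
def circlePt (n k : ℕ) (t : ℝ) : Disk :=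
  ⟨Complex.exp (((2 * Real.pi * ((k + t) / n) : ℝ) : ℂ) * Complex.I), by
    rw [mem_closedBall_zero_iff, Complex.norm_exp_ofReal_mul_I]⟩

/-- The disjoint union of all vertices, of a closed interval for each directed edge and of
a closed disk for each 2-cell. -/
abbrev Pre : Type max u v w :=
  (Σ _ : Y.V, PUnit.{1}) ⊕ ((Σ _ : Y.E, I) ⊕ (Σ _ : Y.F, Disk))

/-- The gluing of cells: the start of a directed edge is its initial vertex, a directed edge is
identified with the reverse of its inverse edge, and the boundary circle of the 2-cell `f` is
attached along the closed path `bdry f`, the `k`-th arc being mapped to the `k`-th edge. -/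
inductive Glue : Y.Pre → Y.Pre → Prop
  | edge_zero (e : Y.E) : Glue (Sum.inr (Sum.inl ⟨e, 0⟩)) (Sum.inl ⟨Y.src e, PUnit.unit⟩)
  | edge_inv (e : Y.E) (t : I) :
      Glue (Sum.inr (Sum.inl ⟨Y.inv e, t⟩)) (Sum.inr (Sum.inl ⟨e, unitInterval.symm t⟩))
  | face_bdry (f : Y.F) (k : Fin (Y.bdry f).length) (t : I) :
      Glue (Sum.inr (Sum.inr ⟨f, circlePt (Y.bdry f).length k t⟩))
        (Sum.inr (Sum.inl ⟨(Y.bdry f)[k], t⟩))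

/-- The topological space (CW complex) underlying a combinatorial 2-complex. -/
def Realization : Type max u v w := Quot Y.Glue

instance : TopologicalSpace Y.Realization :=
  inferInstanceAs (TopologicalSpace (Quot Y.Glue))

/-- A vertex as a point of the complex. -/
def vertexPt (p : Y.V) : Y.Realization := Quot.mk _ (Sum.inl ⟨p, PUnit.unit⟩)

/-- The point with parameter `t` on a directed edge. -/
def edgePt (e : Y.E) (t : I) : Y.Realization := Quot.mk _ (Sum.inr (Sum.inl ⟨e, t⟩))

/-- The image of a point of the closed disk of a 2-cell. -/
def facePt (f : Y.F) (z : Disk) : Y.Realization := Quot.mk _ (Sum.inr (Sum.inr ⟨f, z⟩))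

/-- The 1-skeleton, as a subspace. -/
def oneSkeleton : Set Y.Realization :=
  Set.range Y.vertexPt ∪ {x | ∃ e t, x = Y.edgePt e t}

/-! ### Functions that are constant on open cells -/

section CellLift

variable {Y} {α : Type*} (cv : Y.V → α) (ce : Y.E → α) (cf : Y.F → α)

/-- The value at the point `t` of a directed edge. -/
def edgeValue (e : Y.E) (t : I) : α :=
  open Classical in
  if t = 0 then cv (Y.src e) else if t = 1 then cv (Y.tgt e) else ce e

/-- The value at a point of the closed disk of a 2-cell. -/
def faceValue (f : Y.F) (z : Disk) : α :=
  open Classical in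
  if h : ∃ x : Fin (Y.bdry f).length × I, z = circlePt (Y.bdry f).length x.1 x.2 then
    edgeValue cv ce (Y.bdry f)[h.choose.1] h.choose.2
  else cf f

/-- The value at a point of the disjoint union of closed cells. -/
def preValue : Y.Pre → α
  | Sum.inl x => cv x.1
  | Sum.inr (Sum.inl x) => edgeValue cv ce x.1 x.2
  | Sum.inr (Sum.inr x) => faceValue cv ce cf x.1 x.2

theorem tgt_bdry (f : Y.F) (k k' : ℕ) (hk : k < (Y.bdry f).length)
    (hk' : k' < (Y.bdry f).length) (h : k' = k + 1 ∨ (k' = 0 ∧ k + 1 = (Y.bdry f).length)) :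
    Y.tgt (Y.bdry f)[k] = Y.src (Y.bdry f)[k'] := by
  obtain ⟨p, hp⟩ := Y.bdry_closed f
  rcases h with rfl | ⟨rfl, h⟩
  · exact Y.tgt_getElem_of_isPath hp k hk'
  · obtain rfl : k = (Y.bdry f).length - 1 := by omega
    rw [Y.tgt_last_of_isPath hp hk, Y.src_head_of_isPath hp hk']

theorem circlePt_eq {n k k' : ℕ} {t t' : ℝ} (hn : 0 < n)
    (h : circlePt n k t = circlePt n k' t') :
    ∃ m : ℤ, (k : ℝ) + t = k' + t' + m * n := by
  have h1 := congrArg Subtype.val h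
  simp only [circlePt] at h1
  rw [Complex.exp_eq_exp_iff_exists_int] at h1
  obtain ⟨m, hm⟩ := h1
  refine ⟨m, ?_⟩
  have hn' : (n : ℝ) ≠ 0 := by positivity
  have h2 : (((2 * Real.pi * ((k + t) / n) : ℝ) : ℂ))
      = ((2 * Real.pi * ((k' + t') / n) + m * (2 * Real.pi) : ℝ) : ℂ) := by
    have : (((2 * Real.pi * ((k + t) / n) : ℝ) : ℂ)) * Complex.I
      = ((2 * Real.pi * ((k' + t') / n) + m * (2 * Real.pi) : ℝ) : ℂ) * Complex.I := by
      rw [hm]; push_cast; ring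
    exact mul_right_cancel₀ Complex.I_ne_zero this
  have h3 := Complex.ofReal_injective h2
  have h4 : 2 * Real.pi * ((k + t) / n) = 2 * Real.pi * ((k' + t') / n + m) := by
    rw [h3]; ring
  have h5 := mul_left_cancel₀ (by positivity : (2 * Real.pi) ≠ 0) h4
  field_simp at h5
  linarith

/-- Two parametrizations of the same point on the boundary of a 2-cell have the same value. -/
theorem edgeValue_bdry (f : Y.F) (k k' : Fin (Y.bdry f).length) (t t' : I)
    (h : circlePt (Y.bdry f).length k t = circlePt (Y.bdry f).length k' t') :
    edgeValue cv ce (Y.bdry f)[k] t = edgeValue cv ce (Y.bdry f)[k'] t' := by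
  obtain ⟨k, hk⟩ := k
  obtain ⟨k', hk'⟩ := k'
  simp only [Fin.getElem_fin] at h ⊢
  obtain ⟨n, hn⟩ : ∃ n, (Y.bdry f).length = n := ⟨_, rfl⟩
  rw [hn] at h
  have key : ∀ (k k' : ℕ) (hk : k < (Y.bdry f).length) (hk' : k' < (Y.bdry f).length) (t t' : I),
      (t : ℝ) = 1 → (t' : ℝ) = 0 →
      (k' = k + 1 ∨ (k' = 0 ∧ k + 1 = (Y.bdry f).length)) →
      edgeValue cv ce (Y.bdry f)[k] t = edgeValue cv ce (Y.bdry f)[k'] t' := by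
    intro k k' hk hk' t t' ht ht' hkk
    obtain rfl : t = 1 := Subtype.ext ht
    obtain rfl : t' = 0 := Subtype.ext ht'
    simp [edgeValue, tgt_bdry f k k' hk hk' hkk]
  obtain ⟨m, hm⟩ := circlePt_eq (by omega) h
  have ht0 := t.2.1
  have ht1 := t.2.2
  have ht0' := t'.2.1
  have ht1' := t'.2.2
  have hkn : (k : ℝ) + 1 ≤ n := by exact_mod_cast (by omega : k + 1 ≤ n)
  have hkn' : (k' : ℝ) + 1 ≤ n := by exact_mod_cast (by omega : k' + 1 ≤ n)
  have hk0 : (0 : ℝ) ≤ k := by positivity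
  have hk0' : (0 : ℝ) ≤ k' := by positivity
  have hn0 : (0 : ℝ) < n := by linarith
  have hm1 : m < 2 := by
    by_contra! hc
    have : (2 : ℝ) ≤ m := by exact_mod_cast hc
    nlinarith
  have hm2 : -2 < m := by
    by_contra! hc
    have : (m : ℝ) ≤ -2 := by exact_mod_cast hc
    nlinarith
  obtain rfl | rfl | rfl : m = 0 ∨ m = 1 ∨ m = -1 := by omega
  · have hm : (k : ℝ) + t = k' + t' := by simpa using hm
    rcases lt_trichotomy k k' with hlt | rfl | hlt
    · have : (k : ℝ) + 1 ≤ k' := by exact_mod_cast hlt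
      have e1 : (t : ℝ) = 1 := by linarith
      have e2 : (t' : ℝ) = 0 := by linarith
      refine key k k' hk hk' t t' e1 e2 (Or.inl ?_)
      have : (k' : ℝ) = k + 1 := by linarith
      exact_mod_cast this
    · obtain rfl : t = t' := Subtype.ext (by linarith)
      rfl
    · have : (k' : ℝ) + 1 ≤ k := by exact_mod_cast hlt
      have e1 : (t' : ℝ) = 1 := by linarith
      have e2 : (t : ℝ) = 0 := by linarith
      refine (key k' k hk' hk t' t e1 e2 (Or.inl ?_)).symm
      have : (k : ℝ) = k' + 1 := by linarith
      exact_mod_cast this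
  · have hm : (k : ℝ) + t = k' + t' + n := by simpa using hm
    have e1 : (t : ℝ) = 1 := by linarith
    have e2 : (t' : ℝ) = 0 := by linarith
    refine key k k' hk hk' t t' e1 e2 (Or.inr ⟨?_, ?_⟩)
    · have : (k' : ℝ) = 0 := by linarith
      exact_mod_cast this
    · have : (k : ℝ) + 1 = n := by linarith
      rw [hn]
      exact_mod_cast this
  · have hm : (k : ℝ) + t = k' + t' - n := by
      rw [hm]; push_cast; ring
    have e1 : (t' : ℝ) = 1 := by linarith
    have e2 : (t : ℝ) = 0 := by linarith
    refine (key k' k hk' hk t' t e1 e2 (Or.inr ⟨?_, ?_⟩)).symm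
    · have : (k : ℝ) = 0 := by linarith
      exact_mod_cast this
    · have : (k' : ℝ) + 1 = n := by linarith
      rw [hn]
      exact_mod_cast this

theorem preValue_glue (hce : ∀ e, ce (Y.inv e) = ce e) (x y : Y.Pre) (h : Y.Glue x y) :
    preValue cv ce cf x = preValue cv ce cf y := by
  cases h with
  | edge_zero e => simp [preValue, edgeValue]
  | edge_inv e t =>
    have h1 : unitInterval.symm t = 1 ↔ t = 0 := by
      rw [← unitInterval.symm_zero, unitInterval.symm_inj]
    have h0 : unitInterval.symm t = 0 ↔ t = 1 := by
      rw [← unitInterval.symm_one, unitInterval.symm_inj]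
    by_cases ht0 : t = 0
    · subst ht0
      simp [preValue, edgeValue, OneComplex.tgt]
    · by_cases ht1 : t = 1
      · subst ht1
        simp [preValue, edgeValue, OneComplex.tgt, Y.inv_inv]
      · simp [preValue, edgeValue, h0, h1, ht0, ht1, hce]
  | face_bdry f k t =>
    have hex : ∃ x : Fin (Y.bdry f).length × I,
        circlePt (Y.bdry f).length k t = circlePt (Y.bdry f).length x.1 x.2 := ⟨(k, t), rfl⟩
    simp only [preValue, faceValue]
    rw [dif_pos hex]
    exact (edgeValue_bdry cv ce f k _ t _ hex.choose_spec).symm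

/-- The function on the realization taking the value `cv p` at the vertex `p`, the value `ce e`
on the interior of the edge `e`, and the value `cf f` on the interior of the 2-cell `f`. -/
def cellLift (hce : ∀ e, ce (Y.inv e) = ce e) : Y.Realization → α :=
  Quot.lift (preValue cv ce cf) (preValue_glue cv ce cf hce)

@[simp] theorem cellLift_vertexPt (hce : ∀ e, ce (Y.inv e) = ce e) (p : Y.V) :
    cellLift cv ce cf hce (Y.vertexPt p) = cv p := rfl

theorem cellLift_edgePt (hce : ∀ e, ce (Y.inv e) = ce e) (e : Y.E) (t : I)
    (h0 : t ≠ 0) (h1 : t ≠ 1) : cellLift cv ce cf hce (Y.edgePt e t) = ce e := by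
  change edgeValue cv ce e t = ce e
  simp [edgeValue, h0, h1]

theorem cellLift_facePt (hce : ∀ e, ce (Y.inv e) = ce e) (f : Y.F) (z : Disk)
    (hz : ‖(z : ℂ)‖ < 1) : cellLift cv ce cf hce (Y.facePt f z) = cf f := by
  change faceValue cv ce cf f z = cf f
  rw [faceValue, dif_neg]
  rintro ⟨x, rfl⟩
  simp [circlePt, Complex.norm_exp] at hz

end CellLift

/-! ### Coarse distance -/

/-- Four times the coarse distance from the vertex `y` to an interior point of an edge:
`4 * (min of the distances to the endpoints + 1/2)`. -/
def edgeDist4 (y : Y.V) (e : Y.E) : ℕ :=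
  4 * min (Y.vdist y (Y.src e)) (Y.vdist y (Y.tgt e)) + 2

/-- Four times the coarse distance from the vertex `y` to an interior point of a 2-cell:
`4 * (max of the coarse distances to the non-vertex points of the boundary - 1/4)`.  The maximum
is at least `2`, so the subtraction does not truncate. -/
def faceDist4 (y : Y.V) (f : Y.F) : ℕ :=
  ((Y.bdry f).map (Y.edgeDist4 y)).foldr max 0 - 1

theorem edgeDist4_inv (y : Y.V) (e : Y.E) : Y.edgeDist4 y (Y.inv e) = Y.edgeDist4 y e := by
  simp [edgeDist4, OneComplex.tgt, Y.inv_inv, min_comm]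

/-- Four times the coarse distance from the vertex `y` to a point of the complex.  Coarse
distances lie in `ℕ[1/4] = {n / 4 | n ∈ ℕ}`, which is identified with `ℕ` throughout via
`n / 4 ↔ n`. -/
def coarseDist4 (y : Y.V) : Y.Realization → ℕ :=
  cellLift (fun p => 4 * Y.vdist y p) (Y.edgeDist4 y) (Y.faceDist4 y) (Y.edgeDist4_inv y)

/-! ### 1-combings and tameness -/

/-- `ψ` is a 1-combing of the pair `(Y, Z)` at the vertex `y`, where `Z` is (the underlying space
of) a subcomplex of the 1-skeleton. -/
structure IsOneCombing (Z : Set Y.Realization) (y : Y.V) (ψ : Z × I → Y.Realization) :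
    Prop where
  continuous : Continuous ψ
  start : ∀ p : Z, ψ (p, 0) = Y.vertexPt y
  finish : ∀ p : Z, ψ (p, 1) = p
  base : ∀ (h : Y.vertexPt y ∈ Z) (t : I), ψ (⟨Y.vertexPt y, h⟩, t) = Y.vertexPt y
  vertex : ∀ (q : Y.V) (h : Y.vertexPt q ∈ Z) (t : I), ψ (⟨Y.vertexPt q, h⟩, t) ∈ Y.oneSkeleton

/-- `ψ` is `f`-tame with respect to the basepoint `y`; here `f : ℕ → ℕ` stands for the function
`n / 4 ↦ f n / 4` from `ℕ[1/4]` to itself. -/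
def IsTame (y : Y.V) (f : ℕ → ℕ) {Z : Type*} (ψ : Z × I → Y.Realization) : Prop :=
  ∀ (p : Z) (s t : I), s < t → Y.coarseDist4 y (ψ (p, s)) ≤ f (Y.coarseDist4 y (ψ (p, t)))

/-! ### Cellular maps -/

/-- A combinatorial map: cells are mapped to cells of the same dimension, compatibly with
orientations and boundaries. -/
structure Hom (Y : TwoComplex.{u, v, w}) (Y' : TwoComplex.{u', v', w'}) where
  vmap : Y.V → Y'.V
  emap : Y.E → Y'.E
  fmap : Y.F → Y'.F
  src_emap : ∀ e, Y'.src (emap e) = vmap (Y.src e)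
  inv_emap : ∀ e, Y'.inv (emap e) = emap (Y.inv e)
  bdry_fmap : ∀ f, Y'.bdry (fmap f) = (Y.bdry f).map emap

namespace Hom

variable {Y : TwoComplex.{u, v, w}} {Y' : TwoComplex.{u', v', w'}} (π : Hom Y Y')

/-- The effect of a combinatorial map on the disjoint union of closed cells. -/
def preMap : Y.Pre → Y'.Pre
  | Sum.inl x => Sum.inl ⟨π.vmap x.1, PUnit.unit⟩
  | Sum.inr (Sum.inl x) => Sum.inr (Sum.inl ⟨π.emap x.1, x.2⟩)
  | Sum.inr (Sum.inr x) => Sum.inr (Sum.inr ⟨π.fmap x.1, x.2⟩)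

theorem preMap_glue (x y : Y.Pre) (h : Y.Glue x y) : Y'.Glue (π.preMap x) (π.preMap y) := by
  cases h with
  | edge_zero e =>
    have := Glue.edge_zero (Y := Y') (π.emap e)
    rwa [π.src_emap] at this
  | edge_inv e t =>
    have := Glue.edge_inv (Y := Y') (π.emap e) t
    rwa [π.inv_emap] at this
  | face_bdry f k t =>
    have hl : (Y'.bdry (π.fmap f)).length = (Y.bdry f).length := by
      rw [π.bdry_fmap, List.length_map]
    have := Glue.face_bdry (Y := Y') (π.fmap f) (Fin.cast hl.symm k) t
    have he : (Y'.bdry (π.fmap f))[(Fin.cast hl.symm k : Fin _)] = π.emap (Y.bdry f)[k] := by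
      simp [π.bdry_fmap]
    have hc : circlePt (Y'.bdry (π.fmap f)).length (Fin.cast hl.symm k : Fin _) t =
        circlePt (Y.bdry f).length k t := by
      simp only [Fin.val_cast, hl]
    rw [he, hc] at this
    exact this

/-- The map of topological spaces underlying a combinatorial map. -/
def map : Y.Realization → Y'.Realization := Quot.map π.preMap π.preMap_glue

end Hom

end TwoComplex

/-! ## Groups with generators -/

/-- A symmetric generating family of the group `G`: an alphabet `A` with a formal inversion,
and a map `A → G` compatible with inversion, whose image generates `G` and avoids the
identity.  A generating subset of `G` closed under inversion is the special case of an
injective map. -/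
structure GenSystem (G : Type u) (A : Type v) [Group G] [InvolutiveInv A] where
  ρ : A → G
  map_inv : ∀ a, ρ a⁻¹ = (ρ a)⁻¹
  ne_one : ∀ a, ρ a ≠ 1
  generates : Subgroup.closure (Set.range ρ) = ⊤

/-- The formal inverse of a word. -/
def wordInv {A : Type v} [InvolutiveInv A] (x : List A) : List A := (x.map (·⁻¹)).reverse

/-- Removal of a subword `a a⁻¹`. -/
inductive FreeStep {A : Type v} [InvolutiveInv A] : List A → List A → Prop
  | cancel (x y : List A) (a : A) : FreeStep (x ++ a :: a⁻¹ :: y) (x ++ y)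

/-- The element of the free group on the letters that is spelled by a word. -/
def wordToFree {A : Type v} (x : List A) : FreeGroup A := (x.map FreeGroup.of).prod

namespace GenSystem

variable {G : Type u} {A : Type v} [Group G] [InvolutiveInv A] (S : GenSystem G A)

/-- The group element represented by a word. -/
def eval (x : List A) : G := (x.map S.ρ).prod

/-- The Cayley graph; the directed edge `(g, a)` goes from `g` to `g * ρ a` and is labeled `a`. -/
def cayleyGraph : OneComplex.{u, max u v} where
  V := G
  E := G × A
  src e := e.1
  inv e := (e.1 * S.ρ e.2, e.2⁻¹)
  inv_inv e := by simp [S.map_inv]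
  inv_ne e h := by
    have := congrArg Prod.fst h
    simp [S.ne_one] at this

/-- The path in the Cayley graph that starts at `g` and is labeled by a given word. -/
def pathFrom (g : G) : List A → List (G × A)
  | [] => []
  | a :: x => (g, a) :: pathFrom (g * S.ρ a) x

theorem isPath_pathFrom (g : G) (x : List A) :
    S.cayleyGraph.IsPath g (S.pathFrom g x) (g * S.eval x) := by
  induction x generalizing g with
  | nil => exact (mul_one g).symm
  | cons a x ih =>
    refine ⟨rfl, ?_⟩
    have := ih (g * S.ρ a)
    simpa [eval, OneComplex.tgt, cayleyGraph, mul_assoc] using this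

/-! ### Stackable groups -/

/-- The relation `e' < e` of a flow function `Φ` with tree `T`: the directed edge `e'` lies on
the directed path `Φ e`, and neither underlying undirected edge lies in `T`. -/
def flowRel (T : Set S.cayleyGraph.E) (Φ : S.cayleyGraph.E → List S.cayleyGraph.E)
    (e' e : S.cayleyGraph.E) : Prop :=
  e' ∈ Φ e ∧ e ∉ T ∧ e' ∉ T

/-- `Φ` is a bounded flow function with respect to the maximal tree `T` of the Cayley graph.
Directed paths are given by their lists of directed edges. -/
structure IsBoundedFlow (T : Set S.cayleyGraph.E)
    (Φ : S.cayleyGraph.E → List S.cayleyGraph.E) : Prop where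
  tree : S.cayleyGraph.IsMaximalTree T
  endpoints : ∀ e, S.cayleyGraph.IsPath (S.cayleyGraph.src e) (Φ e) (S.cayleyGraph.tgt e)
  degenerate : ∀ e ∈ T, Φ e = [e]
  wellFounded : WellFounded (Relation.TransGen (S.flowRel T Φ))
  bounded : ∃ k : ℕ, ∀ e, (Φ e).length ≤ k

/-- The group is algorithmically stackable over the given generators: there is a bounded flow
function `Φ` for which the set of triples `(x, a, label of Φ(e_{x,a}))`, with `x` a word and
`a` a letter, is recursive; here `e_{x,a}` is the edge labeled `a` that starts at the group
element represented by `x`. -/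
def IsAlgorithmicallyStackable [Primcodable A] : Prop :=
  ∃ (T : Set S.cayleyGraph.E) (Φ : S.cayleyGraph.E → List S.cayleyGraph.E),
    S.IsBoundedFlow T Φ ∧
    ComputablePred fun q : List A × A × List A =>
      q.2.2 = (Φ (S.eval q.1, q.2.1)).map Prod.snd

/-! ### Finite symmetric presentations -/

/-- A finite symmetric presentation of `G` over the given generators.  The relators are nonempty
words; they are closed under formal inversion, under cyclic conjugation, and under passing to the
freely reduced form when that is not the empty word.  Together with the relations saying that
`a⁻¹` is the inverse of `a`, they define `G`. -/
structure SymmPresentation where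
  R : Set (List A)
  finite : R.Finite
  ne_nil : ∀ r ∈ R, r ≠ []
  inv_mem : ∀ r ∈ R, wordInv r ∈ R
  rotate_mem : ∀ r ∈ R, ∀ n : ℕ, r.rotate n ∈ R
  reduced_mem : ∀ r ∈ R, ∀ r' : List A, Relation.ReflTransGen FreeStep r r' →
    (∀ r'', ¬ FreeStep r' r'') → r' ≠ [] → r' ∈ R
  presents : Subgroup.normalClosure
      (wordToFree '' R ∪ Set.range fun a : A => FreeGroup.of a * FreeGroup.of a⁻¹) =
    (FreeGroup.lift S.ρ).ker

variable {S}

theorem SymmPresentation.eval_eq_one (P : S.SymmPresentation) {r : List A} (hr : r ∈ P.R) :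
    S.eval r = 1 := by
  have h : wordToFree r ∈ (FreeGroup.lift S.ρ).ker := by
    rw [← P.presents]
    exact Subgroup.subset_normalClosure (Or.inl ⟨r, hr, rfl⟩)
  rw [MonoidHom.mem_ker, wordToFree, map_list_prod, List.map_map] at h
  simpa [eval, Function.comp_def] using h

/-- The Cayley complex of the presentation: the Cayley graph with, for each vertex `g` and each
relator `r`, a 2-cell attached along the closed path labeled `r` that starts at `g`. -/
def SymmPresentation.cayleyComplex (P : S.SymmPresentation) :
    TwoComplex.{u, max u v, max u v} where
  toOneComplex := S.cayleyGraph
  F := G × P.R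
  bdry f := S.pathFrom f.1 f.2
  bdry_ne_nil f := by
    obtain ⟨g, r, hr⟩ := f
    cases r with
    | nil => exact absurd rfl (P.ne_nil _ hr)
    | cons a x => exact List.cons_ne_nil _ _
  bdry_closed f := ⟨f.1, by
    simpa [P.eval_eq_one f.2.2] using S.isPath_pathFrom f.1 f.2⟩

end GenSystem

/-! ## Van Kampen diagrams -/

/-- A van Kampen diagram with boundary word `x` over the relators `R` (a set of words closed under
inversion and cyclic conjugation).

A finite contractible planar 2-complex is the same thing as a cell structure on the oriented
2-sphere with one open 2-cell (the outer face) removed.  This is recorded combinatorially: the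
closed path `outer` starts at the basepoint and runs around the diagram counterclockwise, that
is, with the outer face on its right; the closed path `bdry f` runs around the 2-cell `f` with
`f` on its right; every directed edge has exactly one face on its right; the directed
edges issuing from a vertex form a single cycle under rotation about that vertex; the complex is
connected; and the Euler characteristic of the surface obtained by adding the outer face is 2.
The one-point diagram (no edges, empty boundary word) is included. -/
structure VanKampenDiagram {A : Type v} [InvolutiveInv A] (R : Set (List A)) (x : List A)
    extends TwoComplex.{0, 0, 0} where
  finite_V : Finite V
  finite_E : Finite E
  finite_F : Finite F
  label : E → A
  label_inv : ∀ e, label (inv e) = (label e)⁻¹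
  label_bdry : ∀ f, (bdry f).map label ∈ R
  base : V
  outer : List E
  outer_closed : toOneComplex.IsPath base outer base
  label_outer : outer.map label = x
  connected : ∀ p : V, ∃ l : List E, toOneComplex.IsPath base l p
  /-- Every directed edge occurs exactly once on the boundary circuits of all the faces,
  `none` being the outer face. -/
  face_unique : Function.Bijective
    fun z : (Σ o : Option F, Fin (o.elim outer bdry).length) => (z.1.elim outer bdry)[z.2]
  /-- Two directed edges with the same initial vertex differ by a rotation about that vertex.
  One step of the rotation replaces `d` by the edge that follows `inv d` on the boundary
  circuit of the face containing `inv d`. -/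
  link_connected : ∀ e e' : E, src e = src e' →
    Relation.ReflTransGen
      (fun d d' => ∃ (o : Option F) (i j : Fin (o.elim outer bdry).length),
        (o.elim outer bdry)[i] = inv d ∧ (o.elim outer bdry)[j] = d' ∧
        (j : ℕ) = (i + 1) % (o.elim outer bdry).length) e e'
  /-- `#V - #E / 2 + (#F + 1) = 2`, where `#E` counts directed edges. -/
  euler : 2 * Nat.card V + 2 * (Nat.card F + 1) = Nat.card E + 4

/-- The boundary of a van Kampen diagram, as a subspace: the vertices and edges on the boundary
circuit. -/
def VanKampenDiagram.boundary {A : Type v} [InvolutiveInv A] {R : Set (List A)} {x : List A}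
    (D : VanKampenDiagram R x) : Set D.Realization :=
  {D.vertexPt D.base} ∪ {p | ∃ e ∈ D.outer, ∃ t, p = D.edgePt e t}

namespace GenSystem.SymmPresentation

variable {G : Type u} {A : Type v} [Group G] [InvolutiveInv A] {S : GenSystem G A}
  (P : S.SymmPresentation)

/-- `π` is the canonical cellular map from a van Kampen diagram to the Cayley complex: it maps the
basepoint to the identity and preserves labels and orientations of edges and of the boundaries
of 2-cells.  (There is exactly one such map.) -/
structure IsCanonicalMap {x : List A} (D : VanKampenDiagram P.R x)
    (π : TwoComplex.Hom D.toTwoComplex P.cayleyComplex) : Prop where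
  base : π.vmap D.base = (1 : G)
  label : ∀ e, (π.emap e : G × A).2 = D.label e

/-- The function `n / 4 ↦ f n / 4` on `ℕ[1/4]` is an intrinsic tame filling function. -/
def IsIntrinsicTameFilling (f : ℕ → ℕ) : Prop :=
  Monotone f ∧ ∀ x : List A, S.eval x = 1 →
    ∃ (D : VanKampenDiagram P.R x) (ψ : D.boundary × I → D.Realization),
      D.IsOneCombing D.boundary D.base ψ ∧ D.IsTame D.base f ψ

/-- The function `n / 4 ↦ f n / 4` on `ℕ[1/4]` is an extrinsic tame filling function. -/
def IsExtrinsicTameFilling (f : ℕ → ℕ) : Prop :=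
  Monotone f ∧ ∀ x : List A, S.eval x = 1 →
    ∃ (D : VanKampenDiagram P.R x) (ψ : D.boundary × I → D.Realization)
      (π : TwoComplex.Hom D.toTwoComplex P.cayleyComplex),
      D.IsOneCombing D.boundary D.base ψ ∧ P.IsCanonicalMap D π ∧
      P.cayleyComplex.IsTame (1 : G) f (π.map ∘ ψ)

end GenSystem.SymmPresentation

end

noncomputable section

open scoped unitInterval

universe u v w u' v' w'

/-! Every closed path at the identity of the Cayley graph is built from the empty path by two moves:
inserting a backtrack along a tree edge that leads away from the root, and replacing a subpath Φ(e)
by e, where e lies outside the tree (`closed_path_induction`). Undoing these moves terminates,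
because Φ trades a non-tree edge for finitely many smaller ones, and a nonempty closed path in a
tree backtracks. Each move acts on van Kampen diagrams: a pendant edge is attached, or a chord drawn
in the outer face cuts off a 2-cell with boundary label Φ(e)e⁻¹. The relators are all nonempty words
of length at most k + 1 that represent 1; the same induction shows that they present G
(`normalClosure_relators`).

A diagram is carried along with a contraction to its basepoint (`TameDiagram`), whose restriction to
the boundary is the 1-combing. After a move the new diagram deformation retracts onto the old one
(`pendantExpansion`, `chordExpansion`). The new contraction follows the old track of the retracted
point and then pushes into the new cells, so tameness has to be checked only once a track is inside
the new cells (`contraction_cases`, `tame_contraction`). There the whole track is bounded by a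
number M(e) attached to the new edge e. Apply Φ to all edges repeatedly until e has become a path in
the tree; M(e) is twice the number of rounds plus four times the largest depth of a vertex on that
tree path (`flowBound`), in quarter units. From e to an edge of Φ(e) it drops by at least 2, which
pays for the half unit by which the new 2-cell can exceed the old tracks (`flowBound_add_two_le`,
`chord_coarse_le`).

It remains to bound M(e) by a recursive function f of the distance of e from 1. An edge near 1 is
the last edge of a path from 1 with a short label. Iterating the flow on labels is computable
because Φ has a recursive graph, and the path has reached the tree exactly when the iteration
becomes stationary, so membership in T need not be decided. A maximum over the finitely many short
words gives f (`exists_computable_flowBound_le`).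

The inequality carried through the induction compares the distance in the diagram at time s with the
distance of the image in the Cayley complex at time t. As π does not increase coarse distance, one f
serves both intrinsically and extrinsically. -/

theorem List.foldr_max_le_iff {l : List ℕ} {b : ℕ} : l.foldr max 0 ≤ b ↔ ∀ x ∈ l, x ≤ b := by
  induction l with
  | nil => simp
  | cons a l ih => simp [ih]

theorem List.le_foldr_max {l : List ℕ} {x : ℕ} (h : x ∈ l) : x ≤ l.foldr max 0 :=
  List.foldr_max_le_iff.1 le_rfl x h

/-! ### Edge paths and the path metric -/

namespace OneComplex

variable {Y : OneComplex.{u, v}}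

@[simp] theorem isPath_nil {p q : Y.V} : Y.IsPath p [] q ↔ p = q := Iff.rfl

@[simp] theorem isPath_cons {p q : Y.V} {e : Y.E} {l : List Y.E} :
    Y.IsPath p (e :: l) q ↔ Y.src e = p ∧ Y.IsPath (Y.tgt e) l q := Iff.rfl

@[simp] theorem tgt_inv (e : Y.E) : Y.tgt (Y.inv e) = Y.src e := by simp [tgt, Y.inv_inv]

@[simp] theorem src_inv (e : Y.E) : Y.src (Y.inv e) = Y.tgt e := rfl

theorem isPath_append {p q : Y.V} {l l' : List Y.E} :
    Y.IsPath p (l ++ l') q ↔ ∃ r, Y.IsPath p l r ∧ Y.IsPath r l' q := by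
  induction l generalizing p with
  | nil => simp
  | cons e l ih => simp [ih, and_assoc]

theorem IsPath.append {p q r : Y.V} {l l' : List Y.E} (h : Y.IsPath p l q)
    (h' : Y.IsPath q l' r) : Y.IsPath p (l ++ l') r :=
  isPath_append.2 ⟨q, h, h'⟩

theorem IsPath.unique {p q r : Y.V} {l : List Y.E} (h : Y.IsPath p l q) (h' : Y.IsPath p l r) :
    q = r := by
  induction l generalizing p with
  | nil => exact h.symm.trans h'
  | cons e l ih => exact ih h.2 h'.2

theorem IsPath.exists_walk {p q : Y.V} {l : List Y.E} (h : Y.IsPath p l q) :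
    ∃ w : Y.graph.Walk p q, w.length ≤ l.length := by
  induction l generalizing p with
  | nil => cases h; exact ⟨.nil, le_rfl⟩
  | cons e l ih =>
    obtain ⟨rfl, h⟩ := h
    obtain ⟨w, hw⟩ := ih h
    -- A loop is not an edge of the simple graph and is dropped, hence only an inequality of
    -- lengths.
    by_cases he : Y.src e = Y.tgt e
    · rw [he]
      exact ⟨w, hw.trans (by simp)⟩
    · have hadj : Y.graph.Adj (Y.src e) (Y.tgt e) :=
        (SimpleGraph.fromRel_adj _ _ _).2 ⟨he, Or.inl ⟨e, rfl, rfl⟩⟩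
      exact ⟨.cons hadj w, by simpa using hw⟩

theorem IsPath.vdist_le {p q : Y.V} {l : List Y.E} (h : Y.IsPath p l q) :
    Y.vdist p q ≤ l.length := by
  obtain ⟨w, hw⟩ := h.exists_walk
  exact (SimpleGraph.dist_le w).trans hw

theorem exists_isPath_of_walk {p q : Y.V} (w : Y.graph.Walk p q) :
    ∃ l, Y.IsPath p l q ∧ l.length = w.length := by
  induction w with
  | nil => exact ⟨[], rfl, rfl⟩
  | cons h w ih =>
    obtain ⟨l, hl, hlen⟩ := ih
    obtain ⟨-, ⟨e, rfl, rfl⟩ | ⟨e, rfl, rfl⟩⟩ := (SimpleGraph.fromRel_adj _ _ _).1 h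
    · exact ⟨e :: l, ⟨rfl, hl⟩, by simp [hlen]⟩
    · exact ⟨Y.inv e :: l, ⟨rfl, by simpa using hl⟩, by simp [hlen]⟩

/-- Reachability is assumed because `SimpleGraph.dist` takes the value 0 between unreachable
vertices. -/
theorem exists_isPath_length_eq_vdist {p q : Y.V} (h : ∃ l, Y.IsPath p l q) :
    ∃ l, Y.IsPath p l q ∧ l.length = Y.vdist p q := by
  obtain ⟨l, hl⟩ := h
  obtain ⟨w, -⟩ := hl.exists_walk
  obtain ⟨w', hw'⟩ := SimpleGraph.Reachable.exists_walk_length_eq_dist ⟨w⟩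
  obtain ⟨l', h1, h2⟩ := exists_isPath_of_walk w'
  exact ⟨l', h1, h2.trans hw'⟩

theorem vdist_tgt_le {y : Y.V} {e : Y.E} (h : ∃ l, Y.IsPath y l (Y.src e)) :
    Y.vdist y (Y.tgt e) ≤ Y.vdist y (Y.src e) + 1 := by
  obtain ⟨l, hl, hlen⟩ := exists_isPath_length_eq_vdist h
  have := (hl.append (l' := [e]) ⟨rfl, rfl⟩).vdist_le
  simpa [hlen] using this

end OneComplex

/-! ### Points of a complex, coarse distance, and combinatorial maps -/

namespace TwoComplex

variable {Y : TwoComplex.{u, v, w}}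

theorem edgePt_zero (e : Y.E) : Y.edgePt e 0 = Y.vertexPt (Y.src e) :=
  Quot.sound (Glue.edge_zero e)

theorem edgePt_inv (e : Y.E) (t : I) :
    Y.edgePt (Y.inv e) t = Y.edgePt e (unitInterval.symm t) :=
  Quot.sound (Glue.edge_inv e t)

theorem edgePt_one (e : Y.E) : Y.edgePt e 1 = Y.vertexPt (Y.tgt e) := by
  rw [OneComplex.tgt, ← edgePt_zero, edgePt_inv, unitInterval.symm_zero]

theorem facePt_circlePt (f : Y.F) (k : ℕ) (hk : k < (Y.bdry f).length) (t : I) :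
    Y.facePt f (circlePt (Y.bdry f).length k t) = Y.edgePt (Y.bdry f)[k] t :=
  Quot.sound (Glue.face_bdry f ⟨k, hk⟩ t)

theorem continuous_quotMk : Continuous (fun x : Y.Pre => (Quot.mk _ x : Y.Realization)) :=
  continuous_quot_mk

theorem continuous_edgePt (e : Y.E) : Continuous (Y.edgePt e) :=
  continuous_quotMk.comp (continuous_inr.comp (continuous_inl.comp continuous_sigmaMk))

theorem continuous_facePt (f : Y.F) : Continuous (Y.facePt f) :=
  continuous_quotMk.comp (continuous_inr.comp (continuous_inr.comp continuous_sigmaMk))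

theorem exists_eq_circlePt {n : ℕ} (hn : 0 < n) (z : Disk) (hz : ‖(z : ℂ)‖ = 1) :
    ∃ k < n, ∃ t : I, z = circlePt n k t := by
  set x : ℝ := Int.fract (Complex.arg z / (2 * Real.pi)) with hx
  have hx0 : 0 ≤ x := Int.fract_nonneg _
  have hx1 : x < 1 := Int.fract_lt_one _
  have hn' : (0 : ℝ) < n := by exact_mod_cast hn
  have hnx : 0 ≤ n * x := by positivity
  refine ⟨⌊n * x⌋₊, ?_, ⟨n * x - ⌊n * x⌋₊, ?_, ?_⟩, ?_⟩
  · rw [Nat.floor_lt hnx]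
    nlinarith
  · linarith [Nat.floor_le hnx]
  · linarith [Nat.lt_floor_add_one (n * x)]
  · apply Subtype.ext
    simp only [circlePt]
    have h1 : (⌊n * x⌋₊ + (n * x - ⌊n * x⌋₊)) / n = x := by field_simp; ring
    rw [h1]
    have h2 : 2 * Real.pi * x
        = Complex.arg z - ⌊Complex.arg z / (2 * Real.pi)⌋ * (2 * Real.pi) := by
      rw [hx, Int.fract]
      field_simp
    rw [h2]
    have h3 := Complex.norm_mul_exp_arg_mul_I z
    rw [hz, Complex.ofReal_one, one_mul] at h3
    rw [← h3, Complex.exp_eq_exp_iff_exists_int]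
    refine ⟨⌊Complex.arg z / (2 * Real.pi)⌋, ?_⟩
    rw [h3]
    push_cast
    ring

/-- Boundary parameters of a closed cell are moved to cells of lower dimension, so that functions
constant on open cells can be evaluated. -/
theorem realization_cases (x : Y.Realization) :
    (∃ p, x = Y.vertexPt p) ∨ (∃ e t, t ≠ 0 ∧ t ≠ 1 ∧ x = Y.edgePt e t) ∨
      ∃ (f : Y.F) (z : Disk), ‖(z : ℂ)‖ < 1 ∧ x = Y.facePt f z := by
  have key : ∀ e t, (∃ p, Y.edgePt e t = Y.vertexPt p) ∨
      (∃ e' t', t' ≠ 0 ∧ t' ≠ 1 ∧ Y.edgePt e t = Y.edgePt e' t') := by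
    intro e t
    by_cases h0 : t = 0
    · exact Or.inl ⟨_, h0 ▸ edgePt_zero e⟩
    by_cases h1 : t = 1
    · exact Or.inl ⟨_, h1 ▸ edgePt_one e⟩
    exact Or.inr ⟨e, t, h0, h1, rfl⟩
  obtain ⟨⟨p, -⟩ | ⟨e, t⟩ | ⟨f, z⟩⟩ := x
  · exact Or.inl ⟨p, rfl⟩
  · rcases key e t with h | h
    · exact Or.inl h
    · exact Or.inr (Or.inl h)
  · by_cases hz : ‖(z : ℂ)‖ < 1
    · exact Or.inr (Or.inr ⟨f, z, hz, rfl⟩)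
    · have hz1 : ‖(z : ℂ)‖ = 1 :=
        le_antisymm (mem_closedBall_zero_iff.1 z.2) (not_lt.1 hz)
      obtain ⟨k, hk, t, rfl⟩ :=
        exists_eq_circlePt (List.length_pos_iff.2 (Y.bdry_ne_nil f)) z hz1
      have h := facePt_circlePt f k hk t
      change (∃ p, Y.facePt f _ = _) ∨ (∃ e t, _ ∧ _ ∧ Y.facePt f _ = _) ∨ _
      rw [h]
      rcases key (Y.bdry f)[k] t with h | h
      · exact Or.inl h
      · exact Or.inr (Or.inl h)

@[simp] theorem coarseDist4_vertexPt (y p : Y.V) :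
    Y.coarseDist4 y (Y.vertexPt p) = 4 * Y.vdist y p := rfl

theorem coarseDist4_edgePt (y : Y.V) (e : Y.E) {t : I} (h0 : t ≠ 0) (h1 : t ≠ 1) :
    Y.coarseDist4 y (Y.edgePt e t) = Y.edgeDist4 y e :=
  cellLift_edgePt _ _ _ _ e t h0 h1

theorem coarseDist4_facePt (y : Y.V) (f : Y.F) {z : Disk} (hz : ‖(z : ℂ)‖ < 1) :
    Y.coarseDist4 y (Y.facePt f z) = Y.faceDist4 y f :=
  cellLift_facePt _ _ _ _ f z hz

theorem coarseDist4_edgePt_le {y : Y.V} {e : Y.E} {b : ℕ} (h0 : 4 * Y.vdist y (Y.src e) ≤ b)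
    (h1 : 4 * Y.vdist y (Y.tgt e) ≤ b) (h2 : Y.edgeDist4 y e ≤ b) (t : I) :
    Y.coarseDist4 y (Y.edgePt e t) ≤ b := by
  by_cases ht0 : t = 0
  · subst ht0
    rwa [edgePt_zero]
  by_cases ht1 : t = 1
  · subst ht1
    rwa [edgePt_one]
  rwa [coarseDist4_edgePt y e ht0 ht1]

/-- The value inside is the maximum over the boundary edges, minus one; a point of the circle lies
on a boundary edge. -/
theorem coarseDist4_facePt_le {y : Y.V} {f : Y.F} {b : ℕ}
    (h : ∀ e ∈ Y.bdry f, 4 * Y.vdist y (Y.src e) ≤ b ∧ 4 * Y.vdist y (Y.tgt e) ≤ b ∧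
      Y.edgeDist4 y e ≤ b) (z : Disk) :
    Y.coarseDist4 y (Y.facePt f z) ≤ b := by
  by_cases hz : ‖(z : ℂ)‖ < 1
  · rw [coarseDist4_facePt y f hz, faceDist4]
    refine (Nat.sub_le _ _).trans (List.foldr_max_le_iff.2 ?_)
    simp only [List.mem_map, forall_exists_index, and_imp, forall_apply_eq_imp_iff₂]
    exact fun e he => (h e he).2.2
  · have hz1 : ‖(z : ℂ)‖ = 1 :=
      le_antisymm (mem_closedBall_zero_iff.1 z.2) (not_lt.1 hz)
    obtain ⟨k, hk, t, rfl⟩ :=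
      exists_eq_circlePt (List.length_pos_iff.2 (Y.bdry_ne_nil f)) z hz1
    rw [facePt_circlePt f k hk t]
    obtain ⟨h0, h1, h2⟩ := h _ (List.getElem_mem hk)
    exact coarseDist4_edgePt_le h0 h1 h2 t

namespace Hom

variable {Y' : TwoComplex.{u', v', w'}} (j : Hom Y Y')

theorem tgt_emap (e : Y.E) : Y'.tgt (j.emap e) = j.vmap (Y.tgt e) := by
  rw [OneComplex.tgt, j.inv_emap, j.src_emap, OneComplex.tgt]

theorem isPath_map {p q : Y.V} {l : List Y.E} (h : Y.IsPath p l q) :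
    Y'.IsPath (j.vmap p) (l.map j.emap) (j.vmap q) := by
  induction l generalizing p with
  | nil => exact congrArg _ h
  | cons e l ih =>
    refine ⟨?_, ?_⟩
    · rw [j.src_emap, h.1]
    · rw [j.tgt_emap]
      exact ih h.2

@[simp] theorem map_vertexPt (p : Y.V) : j.map (Y.vertexPt p) = Y'.vertexPt (j.vmap p) := rfl

@[simp] theorem map_edgePt (e : Y.E) (t : I) :
    j.map (Y.edgePt e t) = Y'.edgePt (j.emap e) t := rfl

@[simp] theorem map_facePt (f : Y.F) (z : Disk) :
    j.map (Y.facePt f z) = Y'.facePt (j.fmap f) z := rfl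

theorem continuous_map : Continuous j.map := by
  refine continuous_quot_lift _ ?_
  refine continuous_sum_dom.2 ⟨?_, continuous_sum_dom.2 ⟨?_, ?_⟩⟩
  · exact continuous_sigma fun p => (continuous_const (y := Y'.vertexPt (j.vmap p)))
  · exact continuous_sigma fun e => continuous_edgePt (j.emap e)
  · exact continuous_sigma fun f => continuous_facePt (j.fmap f)

section

variable {j} {y : Y.V} (hy : ∀ p, ∃ l, Y.IsPath y l p)
include hy

/-- The image of a shortest path is a path. Connectedness from `y` matters: an unreachable vertex
has distance 0 by default, while its image may be reachable at positive distance. -/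
theorem vdist_vmap_le (p : Y.V) : Y'.vdist (j.vmap y) (j.vmap p) ≤ Y.vdist y p := by
  obtain ⟨l, hl, hlen⟩ := OneComplex.exists_isPath_length_eq_vdist (hy p)
  simpa [hlen] using (j.isPath_map hl).vdist_le

theorem edgeDist4_emap_le (e : Y.E) : Y'.edgeDist4 (j.vmap y) (j.emap e) ≤ Y.edgeDist4 y e := by
  have h1 := vdist_vmap_le (j := j) hy (Y.src e)
  have h2 := vdist_vmap_le (j := j) hy (Y.tgt e)
  simp only [edgeDist4, j.src_emap, j.tgt_emap]
  omega

/-- A combinatorial map does not increase the coarse distance from the basepoint. -/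
theorem coarseDist4_map_le (x : Y.Realization) :
    Y'.coarseDist4 (j.vmap y) (j.map x) ≤ Y.coarseDist4 y x := by
  obtain ⟨p, rfl⟩ | ⟨e, t, h0, h1, rfl⟩ | ⟨f, z, hz, rfl⟩ := realization_cases x
  · simpa using vdist_vmap_le (j := j) hy p
  · rw [map_edgePt, coarseDist4_edgePt _ _ h0 h1, coarseDist4_edgePt _ _ h0 h1]
    exact edgeDist4_emap_le hy e
  · rw [map_facePt, coarseDist4_facePt _ _ hz, coarseDist4_facePt _ _ hz, faceDist4, faceDist4]
    refine Nat.sub_le_sub_right (List.foldr_max_le_iff.2 ?_) 1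
    rw [j.bdry_fmap, List.map_map]
    simp only [List.mem_map, forall_exists_index, and_imp, forall_apply_eq_imp_iff₂]
    intro e he
    exact (edgeDist4_emap_le hy e).trans (List.le_foldr_max (List.mem_map_of_mem he))

end

end Hom

end TwoComplex

/-! ### Deformation retractions and the contractions they induce -/

namespace TwoComplex

/-- A contraction of (the space underlying) a 2-complex to one of its vertices. -/
abbrev Contraction (Y : TwoComplex.{u, v, w}) (y : Y.V) :=
  ContinuousMap.Homotopy (ContinuousMap.const Y.Realization (Y.vertexPt y))
    (ContinuousMap.id Y.Realization)

variable {Y : TwoComplex.{u, v, w}} {Y' : TwoComplex.{u', v', w'}}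

/-- A deformation retraction of `Y'` onto `Y`, embedded by `j`, each of whose tracks stays
outside the set `new` at most as long as it does not move. -/
structure Expansion (j : Hom Y Y') where
  r : C(Y'.Realization, Y.Realization)
  H : ContinuousMap.Homotopy ((⟨j.map, j.continuous_map⟩ : C(_, _)).comp r)
    (ContinuousMap.id Y'.Realization)
  new : Set Y'.Realization
  const_of_not_new : ∀ q t, H (t, q) ∉ new → ∀ s ≤ t, H (s, q) = H (t, q)
  vertex_mem : ∀ p t, H (t, Y'.vertexPt p) ∈ Y'.oneSkeleton
  r_map : ∀ x, r (j.map x) = x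
  map_not_new : ∀ x, j.map x ∉ new

namespace Expansion

variable {j : Hom Y Y'} (X : Expansion j) {y : Y.V} (Ψ : Y.Contraction y)

theorem H_zero (q : Y'.Realization) : X.H (0, q) = j.map (X.r q) := by simp

/-- At time 1 the track is at an old point, so `const_of_not_new` forces it to have been there all
along. -/
theorem H_map (x : Y.Realization) (t : I) : X.H (t, j.map x) = j.map x := by
  have h1 : X.H (1, j.map x) = j.map x := by simp
  rw [X.const_of_not_new (j.map x) 1 (by rw [h1]; exact X.map_not_new x) t unitInterval.le_one',
    h1]

/-- The first half of the contraction of `Y'`. -/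
def push : ContinuousMap.Homotopy (ContinuousMap.const Y'.Realization (Y'.vertexPt (j.vmap y)))
    ((⟨j.map, j.continuous_map⟩ : C(_, _)).comp X.r) where
  toFun z := j.map (Ψ (z.1, X.r z.2))
  continuous_toFun := j.continuous_map.comp (by fun_prop)
  map_zero_left q := by simp
  map_one_left q := by simp

/-- The contraction of `Y'` that follows the deformation retraction onto `Y`, and then a
contraction of `Y`. -/
def contraction : Y'.Contraction (j.vmap y) := (X.push Ψ).trans X.H

theorem contraction_of_le {t : I} (ht : (t : ℝ) ≤ 1 / 2) (q : Y'.Realization) :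
    X.contraction Ψ (t, q) =
      j.map (Ψ (⟨2 * t, (unitInterval.mul_pos_mem_iff zero_lt_two).2 ⟨t.2.1, ht⟩⟩, X.r q)) := by
  rw [contraction, ContinuousMap.Homotopy.trans_apply, dif_pos ht]
  rfl

theorem contraction_of_not_le {t : I} (ht : ¬ (t : ℝ) ≤ 1 / 2) (q : Y'.Realization) :
    X.contraction Ψ (t, q) =
      X.H (⟨2 * t - 1, unitInterval.two_mul_sub_one_mem_iff.2 ⟨(not_le.1 ht).le, t.2.2⟩⟩, q) := by
  rw [contraction, ContinuousMap.Homotopy.trans_apply, dif_neg ht]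

/-- In the second half, a point outside `new` has not yet moved under `H`, so it is still at `r q`,
the end of the old track. Thus either both times can be read off one old track in the same order, or
the later point lies in a new cell. This is the source of tameness. -/
theorem contraction_cases (q : Y'.Realization) {s t : I} (hst : s ≤ t) :
    (∃ s' t', s' ≤ t' ∧ X.contraction Ψ (s, q) = j.map (Ψ (s', X.r q)) ∧
      X.contraction Ψ (t, q) = j.map (Ψ (t', X.r q))) ∨ X.contraction Ψ (t, q) ∈ X.new := by
  have hst' : (s : ℝ) ≤ t := hst
  by_cases ht : (t : ℝ) ≤ 1 / 2
  · have hs : (s : ℝ) ≤ 1 / 2 := hst'.trans ht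
    rw [X.contraction_of_le Ψ ht, X.contraction_of_le Ψ hs]
    exact Or.inl ⟨_, _, Subtype.mk_le_mk.2 (by linarith), rfl, rfl⟩
  · by_cases hnew : X.contraction Ψ (t, q) ∈ X.new
    · exact Or.inr hnew
    left
    rw [X.contraction_of_not_le Ψ ht] at hnew ⊢
    have hc := X.const_of_not_new q _ hnew
    have h1 : ∀ z, Ψ (1, z) = z := fun z => by simp
    rw [← hc 0 unitInterval.nonneg', H_zero]
    by_cases hs : (s : ℝ) ≤ 1 / 2
    · rw [X.contraction_of_le Ψ hs]
      exact ⟨_, 1, unitInterval.le_one', rfl, by rw [h1]⟩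
    · rw [X.contraction_of_not_le Ψ hs, hc _ (Subtype.mk_le_mk.2 (by linarith)),
        ← hc 0 unitInterval.nonneg', H_zero]
      exact ⟨1, 1, le_rfl, by rw [h1], by rw [h1]⟩

/-- The weaker form of `contraction_cases` that suffices for bounds uniform in time, where the order
of times plays no role. -/
theorem contraction_track (q : Y'.Realization) (t : I) :
    (∃ s, X.contraction Ψ (t, q) = j.map (Ψ (s, X.r q))) ∨
      ∃ s, X.contraction Ψ (t, q) = X.H (s, q) := by
  by_cases ht : (t : ℝ) ≤ 1 / 2
  · exact Or.inl ⟨_, X.contraction_of_le Ψ ht q⟩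
  · exact Or.inr ⟨_, X.contraction_of_not_le Ψ ht q⟩

theorem contraction_map (x : Y.Realization) (t : I) :
    ∃ s, X.contraction Ψ (t, j.map x) = j.map (Ψ (s, x)) := by
  obtain ⟨s, hs⟩ | ⟨s, hs⟩ := X.contraction_track Ψ (j.map x) t
  · exact ⟨s, by rw [hs, X.r_map]⟩
  · exact ⟨1, by rw [hs, H_map]; simp⟩

end Expansion

end TwoComplex

/-! ### Maps and homotopies defined cell by cell -/

namespace TwoComplex

section Lift

variable {Y : TwoComplex.{u, v, w}} {Z : Type*} [TopologicalSpace Z]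

/-- A continuous map defined cell by cell. -/
def liftMap (kv : Y.V → Z) (ke : Y.E → C(I, Z)) (kf : Y.F → C(Disk, Z))
    (h0 : ∀ e, ke e 0 = kv (Y.src e))
    (hinv : ∀ e t, ke (Y.inv e) t = ke e (unitInterval.symm t))
    (hf : ∀ f k (hk : k < (Y.bdry f).length) (t : I),
      kf f (circlePt (Y.bdry f).length k t) = ke (Y.bdry f)[k] t) :
    C(Y.Realization, Z) where
  toFun := Quot.lift (fun x : Y.Pre =>
      Sum.elim (fun x => kv x.1) (Sum.elim (fun x => ke x.1 x.2) (fun x => kf x.1 x.2)) x) <| by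
    rintro _ _ (e | ⟨e, t⟩ | ⟨f, k, t⟩)
    · exact h0 e
    · exact hinv e t
    · exact hf f k k.2 t
  continuous_toFun := by
    refine continuous_quot_lift _ ?_
    refine continuous_sum_dom.2 ⟨?_, continuous_sum_dom.2 ⟨?_, ?_⟩⟩
    · exact continuous_sigma fun p => (continuous_const (y := kv p))
    · exact continuous_sigma fun e => (ke e).continuous
    · exact continuous_sigma fun f => (kf f).continuous

/-- A homotopy defined cell by cell. -/
def liftHomotopy (kv : Y.V → C(I, Z)) (ke : Y.E → C(I × I, Z)) (kf : Y.F → C(Disk × I, Z))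
    (h0 : ∀ e s, ke e (0, s) = kv (Y.src e) s)
    (hinv : ∀ e t s, ke (Y.inv e) (t, s) = ke e (unitInterval.symm t, s))
    (hf : ∀ f k (hk : k < (Y.bdry f).length) (t s : I),
      kf f (circlePt (Y.bdry f).length k t, s) = ke (Y.bdry f)[k] (t, s)) :
    C(Y.Realization × I, Z) :=
  (liftMap kv (fun e => (ke e).curry) (fun f => (kf f).curry)
    (fun e => ContinuousMap.ext (h0 e)) (fun e t => ContinuousMap.ext (hinv e t))
    (fun f k hk t => ContinuousMap.ext (hf f k hk t))).uncurry

/-- Every point of the realization lies in some closed cell. -/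
theorem realization_ind {motive : Y.Realization → Prop} (hv : ∀ p, motive (Y.vertexPt p))
    (he : ∀ e t, motive (Y.edgePt e t)) (hf : ∀ f z, motive (Y.facePt f z)) (x) : motive x := by
  obtain ⟨⟨p, -⟩ | ⟨e, t⟩ | ⟨f, z⟩⟩ := x
  exacts [hv p, he e t, hf f z]

theorem vertexPt_mem_oneSkeleton (p : Y.V) : Y.vertexPt p ∈ Y.oneSkeleton := Or.inl ⟨p, rfl⟩

theorem edgePt_mem_oneSkeleton (e : Y.E) (t : I) : Y.edgePt e t ∈ Y.oneSkeleton :=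
  Or.inr ⟨e, t, rfl⟩

end Lift

end TwoComplex

/-- Addition of an edge from `p` to `q` to a 1-complex, whose vertex set may be enlarged.  The new
directed edges are `Sum.inr true`, from `p` to `q`, and its inverse `Sum.inr false`. -/
abbrev OneComplex.addEdge (Y : OneComplex.{u, v}) {V' : Type u} (i : Y.V → V') (p q : V') :
    OneComplex.{u, v} where
  V := V'
  E := Y.E ⊕ Bool
  src := Sum.elim (fun e => i (Y.src e)) (fun b => bif b then p else q)
  inv := Sum.map Y.inv not
  inv_inv := by rintro (e | b) <;> simp [Y.inv_inv]
  inv_ne := by rintro (e | b) <;> simp [Y.inv_ne]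

theorem OneComplex.isPath_addEdge {Y : OneComplex.{u, v}} {V' : Type u} {i : Y.V → V'}
    (p q : V') {a b : Y.V} {l : List Y.E} (h : Y.IsPath a l b) :
    (Y.addEdge i p q).IsPath (i a) (l.map Sum.inl) (i b) := by
  induction l generalizing a with
  | nil => exact congrArg i h
  | cons e l ih => exact ⟨congrArg i h.1, ih h.2⟩

namespace TwoComplex

/-! ### Pendant edges -/

section Pendant

variable (Y : TwoComplex.{u, v, w}) (p : Y.V)

/-- Addition of an edge from the vertex `p` to a new vertex. -/
abbrev addPendant : TwoComplex.{u, v, w} where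
  toOneComplex := Y.toOneComplex.addEdge some (some p) none
  F := Y.F
  bdry f := (Y.bdry f).map Sum.inl
  bdry_ne_nil f := mt List.map_eq_nil_iff.1 (Y.bdry_ne_nil f)
  bdry_closed f := by
    obtain ⟨q, hq⟩ := Y.bdry_closed f
    exact ⟨some q, OneComplex.isPath_addEdge _ _ hq⟩

/-- The inclusion of a 2-complex in the complex obtained by adding a pendant edge. -/
def pendantHom : Hom Y (Y.addPendant p) where
  vmap := some
  emap := Sum.inl
  fmap f := f
  src_emap _ := rfl
  inv_emap _ := rfl
  bdry_fmap _ := rfl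

/-- The retraction that collapses a pendant edge, on edges. -/
def pendantEdgeRetraction : Y.E ⊕ Bool → C(I, Y.Realization)
  | Sum.inl e => ⟨Y.edgePt e, continuous_edgePt e⟩
  | Sum.inr _ => .const _ (Y.vertexPt p)

/-- The retraction that collapses a pendant edge. -/
def pendantRetraction : C((Y.addPendant p).Realization, Y.Realization) :=
  liftMap (fun q : Option Y.V => Y.vertexPt (q.getD p)) (Y.pendantEdgeRetraction p)
    (fun f : Y.F => (⟨Y.facePt f, continuous_facePt f⟩ : C(Disk, Y.Realization)))
    (by
      rintro (e | b)
      · exact edgePt_zero e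
      · cases b <;> rfl)
    (by
      rintro (e | b) t
      · exact edgePt_inv e t
      · cases b <;> rfl)
    (by
      intro f k hk t
      have hk' : k < (Y.bdry f).length := by rwa [List.length_map] at hk
      have := facePt_circlePt (Y := Y) f k hk' t
      simp only [List.getElem_map, List.length_map]
      exact this)

/-- The collapse of a pendant edge, on vertices. -/
def pendantVertexHomotopy : Option Y.V → C(I, (Y.addPendant p).Realization)
  | none => ⟨(Y.addPendant p).edgePt (Sum.inr true), continuous_edgePt _⟩
  | some x => .const _ ((Y.addPendant p).vertexPt (some x))

/-- The collapse of a pendant edge, on edges. -/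
def pendantEdgeHomotopy : Y.E ⊕ Bool → C(I × I, (Y.addPendant p).Realization)
  | Sum.inl e => ⟨fun z => (Y.addPendant p).edgePt (Sum.inl e) z.1,
      (continuous_edgePt _).comp continuous_fst⟩
  | Sum.inr true => ⟨fun z => (Y.addPendant p).edgePt (Sum.inr true) (z.1 * z.2),
      (continuous_edgePt _).comp (by fun_prop)⟩
  | Sum.inr false =>
      ⟨fun z => (Y.addPendant p).edgePt (Sum.inr true) (unitInterval.symm z.1 * z.2),
        (continuous_edgePt _).comp (by fun_prop)⟩

/-- The collapse of a pendant edge. -/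
def pendantHomotopy : C((Y.addPendant p).Realization × I, (Y.addPendant p).Realization) :=
  liftHomotopy (Y.pendantVertexHomotopy p) (Y.pendantEdgeHomotopy p)
    (fun f => ⟨fun z => (Y.addPendant p).facePt f z.1, (continuous_facePt _).comp continuous_fst⟩)
    (by
      rintro (e | _ | _) s
      · exact edgePt_zero (Y := Y.addPendant p) (Sum.inl e)
      · change (Y.addPendant p).edgePt (Sum.inr true) (unitInterval.symm 0 * s) =
          (Y.addPendant p).edgePt (Sum.inr true) s
        simp
      · change (Y.addPendant p).edgePt (Sum.inr true) (0 * s) = (Y.addPendant p).vertexPt (some p)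
        rw [zero_mul]
        exact edgePt_zero (Y := Y.addPendant p) (Sum.inr true))
    (by
      rintro (e | _ | _) t s
      · exact edgePt_inv (Y := Y.addPendant p) (Sum.inl e) t
      · change (Y.addPendant p).edgePt (Sum.inr true) (t * s) =
          (Y.addPendant p).edgePt (Sum.inr true) (unitInterval.symm (unitInterval.symm t) * s)
        rw [unitInterval.symm_symm]
      · rfl)
    (fun f k hk t s => by
      refine (facePt_circlePt (Y := Y.addPendant p) f k hk t).trans ?_
      rw [List.getElem_map]
      rfl)

/-- The open cells created by adding a pendant edge. -/
def pendantNew : Set (Y.addPendant p).Realization :=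
  {x | cellLift (Y := Y.addPendant p) (fun q : Option Y.V => q = none)
    (fun e : Y.E ⊕ Bool => e.isRight = true) (fun _ => False) (by rintro (e | b) <;> rfl) x}

theorem edgePt_mem_pendantNew {b : Bool} {t : I} (h0 : t ≠ 0) (h1 : t ≠ 1) :
    (Y.addPendant p).edgePt (Sum.inr b) t ∈ Y.pendantNew p := by
  rw [pendantNew, Set.mem_ofPred_eq, cellLift_edgePt _ _ _ _ _ _ h0 h1]
  rfl

theorem vertexPt_mem_pendantNew :
    (Y.addPendant p).vertexPt (none : Option Y.V) ∈ Y.pendantNew p :=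
  rfl

/-- The open edge and its free end are both new, so `x * t` must be 0. Either `x = 0` and the track
rests at the attaching vertex, or `t = 0` and then `s = 0`. -/
theorem pendantHomotopy_const {x t : I}
    (h : (Y.addPendant p).edgePt (Sum.inr true) (x * t) ∉ Y.pendantNew p) {s : I} (hst : s ≤ t) :
    (Y.addPendant p).edgePt (Sum.inr true) (x * s) =
      (Y.addPendant p).edgePt (Sum.inr true) (x * t) := by
  by_cases h0 : x * t = 0
  · rcases mul_eq_zero.1 h0 with rfl | rfl
    · simp
    · rw [le_antisymm hst unitInterval.nonneg']
  · by_cases h1 : x * t = 1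
    · rw [h1, edgePt_one] at h
      exact absurd (Y.vertexPt_mem_pendantNew p) h
    · exact absurd (Y.edgePt_mem_pendantNew p h0 h1) h

/-- The deformation retraction that collapses a pendant edge. -/
def pendantExpansion : Expansion (Y.pendantHom p) where
  r := Y.pendantRetraction p
  H :=
    { toContinuousMap := (Y.pendantHomotopy p).comp ContinuousMap.prodSwap
      map_zero_left := realization_ind
        (by
          rintro (_ | q)
          · exact edgePt_zero (Y := Y.addPendant p) (Sum.inr true)
          · rfl)
        (by
          rintro (e | _ | _) t
          · rfl
          · change (Y.addPendant p).edgePt (Sum.inr true) (unitInterval.symm t * 0) = _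
            rw [mul_zero]
            exact edgePt_zero (Y := Y.addPendant p) (Sum.inr true)
          · change (Y.addPendant p).edgePt (Sum.inr true) (t * 0) = _
            rw [mul_zero]
            exact edgePt_zero (Y := Y.addPendant p) (Sum.inr true))
        (fun f z => rfl)
      map_one_left := realization_ind
        (by
          rintro (_ | q)
          · exact edgePt_one (Y := Y.addPendant p) (Sum.inr true)
          · rfl)
        (by
          rintro (e | _ | _) t
          · rfl
          · change (Y.addPendant p).edgePt (Sum.inr true) (unitInterval.symm t * 1) = _
            rw [mul_one]
            exact (edgePt_inv (Y := Y.addPendant p) (Sum.inr true) t).symm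
          · change (Y.addPendant p).edgePt (Sum.inr true) (t * 1) = _
            rw [mul_one]
            rfl)
        (fun f z => rfl) }
  new := Y.pendantNew p
  const_of_not_new := by
    refine realization_ind ?_ ?_ ?_
    · rintro (_ | q) t h s hst
      · change (Y.addPendant p).edgePt (Sum.inr true) s =
          (Y.addPendant p).edgePt (Sum.inr true) t
        have := Y.pendantHomotopy_const p (x := 1) (t := t) (by rw [one_mul]; exact h) hst
        simpa only [one_mul] using this
      · rfl
    · rintro (e | _ | _) t
      · exact fun _ _ _ _ => rfl
      · exact fun _ h _ hst => Y.pendantHomotopy_const p h hst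
      · exact fun _ h _ hst => Y.pendantHomotopy_const p h hst
    · exact fun _ _ _ _ _ _ => rfl
  vertex_mem q t := by
    rcases (q : Option Y.V) with _ | q
    · exact edgePt_mem_oneSkeleton (Y := Y.addPendant p) (Sum.inr true) t
    · exact vertexPt_mem_oneSkeleton (Y := Y.addPendant p) (some q)
  r_map := realization_ind (fun _ => rfl) (fun _ _ => rfl) (fun _ _ => rfl)
  map_not_new x := by
    rw [pendantNew, Set.mem_ofPred_eq]
    obtain ⟨q, rfl⟩ | ⟨e, t, h0, h1, rfl⟩ | ⟨f, z, hz, rfl⟩ := realization_cases x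
    · simp [pendantHom]
    · rw [Hom.map_edgePt, cellLift_edgePt _ _ _ _ _ _ h0 h1]
      simp [pendantHom]
    · rw [Hom.map_facePt, cellLift_facePt _ _ _ _ _ _ hz]
      simp

end Pendant

end TwoComplex

namespace TwoComplex

/-! ### Retraction of a disk onto an arc of its boundary -/

theorem circlePt_eq_zero_add (n k : ℕ) (t : ℝ) : circlePt n k t = circlePt n 0 (k + t) := by
  simp [circlePt]

theorem circlePt_self (n : ℕ) (hn : 0 < n) : circlePt n 0 n = circlePt n 0 0 := by
  have : (n : ℝ) ≠ 0 := by positivity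
  apply Subtype.ext
  simp [circlePt, div_self this]

theorem norm_circlePt (n k : ℕ) (t : ℝ) : ‖(circlePt n k t : ℂ)‖ = 1 :=
  Complex.norm_exp_ofReal_mul_I _

theorem continuous_circlePt (n k : ℕ) : Continuous (circlePt n k) := by
  unfold circlePt
  fun_prop

/-- The first `m` of the `m + 1` arcs form a closed embedded interval, and the Tietze extension
theorem extends its parameter to the disk. -/
theorem exists_retraction_arc {m : ℕ} (hm : 0 < m) :
    ∃ g : C(Disk, ℝ), (∀ z, 0 ≤ g z ∧ g z ≤ m) ∧
      ∀ x : ℝ, 0 ≤ x → x ≤ m → g (circlePt (m + 1) 0 x) = x := by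
  have hm' : (0 : ℝ) < m := by exact_mod_cast hm
  have hc : Topology.IsClosedEmbedding fun x : I => circlePt (m + 1) 0 (m * x) := by
    refine Continuous.isClosedEmbedding ((continuous_circlePt _ _).comp (by fun_prop)) ?_
    intro x y hxy
    obtain ⟨k, hk⟩ := circlePt_eq (by omega) hxy
    have hx := mul_le_mul_of_nonneg_left x.2.2 hm'.le
    have hy := mul_le_mul_of_nonneg_left y.2.2 hm'.le
    have hx0 := mul_nonneg hm'.le x.2.1
    have hy0 := mul_nonneg hm'.le y.2.1
    push_cast at hk
    -- The two parameters differ by at most `m`, which is less than a full turn `m + 1`, so there is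
    -- no wrapping.
    have hk1 : k < 1 := by
      by_contra! h
      have : (1 : ℝ) ≤ k := by exact_mod_cast h
      nlinarith
    have hk2 : -1 < k := by
      by_contra! h
      have : (k : ℝ) ≤ -1 := by exact_mod_cast h
      nlinarith
    obtain rfl : k = 0 := by omega
    apply Subtype.ext
    have : (m : ℝ) * x = m * y := by simpa using hk
    exact mul_left_cancel₀ hm'.ne' this
  have : TietzeExtension.{0, 0} I := inferInstance
  obtain ⟨g, hg⟩ := (ContinuousMap.id I).exists_extension hc
  refine ⟨⟨fun z => m * g z, by fun_prop⟩, fun z => ⟨mul_nonneg hm'.le (g z).2.1, ?_⟩, ?_⟩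
  · simpa using mul_le_mul_of_nonneg_left (g z).2.2 hm'.le
  · intro x h0 h1
    have hx := DFunLike.congr_fun hg ⟨x / m, div_nonneg h0 hm'.le, div_le_one_of_le₀ h1 hm'.le⟩
    simp only [ContinuousMap.comp_apply, ContinuousMap.coe_mk, ContinuousMap.id_apply,
      mul_div_cancel₀ x hm'.ne'] at hx
    simp only [ContinuousMap.coe_mk, hx]
    field_simp

/-- A coordinate on the disk that restricts to the parameter of the first `m` of the `m + 1`
arcs of the boundary circle. -/
def arcCoord {m : ℕ} (hm : 0 < m) : C(Disk, ℝ) := (exists_retraction_arc hm).choose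

theorem arcCoord_nonneg {m : ℕ} (hm : 0 < m) (z : Disk) : 0 ≤ arcCoord hm z :=
  ((exists_retraction_arc hm).choose_spec.1 z).1

theorem arcCoord_le {m : ℕ} (hm : 0 < m) (z : Disk) : arcCoord hm z ≤ m :=
  ((exists_retraction_arc hm).choose_spec.1 z).2

theorem arcCoord_circlePt {m : ℕ} (hm : 0 < m) {x : ℝ} (h0 : 0 ≤ x) (h1 : x ≤ m) :
    arcCoord hm (circlePt (m + 1) 0 x) = x :=
  (exists_retraction_arc hm).choose_spec.2 x h0 h1

/-- The straight-line homotopy from a retraction of the disk onto an arc to the identity. -/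
def arcHomotopy {m : ℕ} (hm : 0 < m) : C(Disk × I, Disk) where
  toFun z := ⟨(1 - (z.2 : ℝ)) • (circlePt (m + 1) 0 (arcCoord hm z.1) : ℂ)
      + (z.2 : ℝ) • (z.1 : ℂ),
    convex_closedBall (0 : ℂ) 1 (circlePt (m + 1) 0 (arcCoord hm z.1)).2 z.1.2
      (sub_nonneg.2 z.2.2.2) z.2.2.1 (by ring)⟩
  continuous_toFun := by
    refine Continuous.subtype_mk ?_ _
    have := (continuous_circlePt (m + 1) 0).comp
      ((arcCoord hm).continuous.comp (continuous_fst (X := Disk) (Y := I)))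
    have h2 : Continuous fun z : Disk × I => (z.2 : ℝ) :=
      continuous_subtype_val.comp continuous_snd
    have h1 : Continuous fun z : Disk × I => (z.1 : ℂ) :=
      continuous_subtype_val.comp continuous_fst
    exact ((continuous_const.sub h2).smul (continuous_subtype_val.comp this)).add (h2.smul h1)

theorem arcHomotopy_zero {m : ℕ} (hm : 0 < m) (z : Disk) :
    arcHomotopy hm (z, 0) = circlePt (m + 1) 0 (arcCoord hm z) := by
  apply Subtype.ext
  simp [arcHomotopy]

theorem arcHomotopy_one {m : ℕ} (hm : 0 < m) (z : Disk) : arcHomotopy hm (z, 1) = z := by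
  apply Subtype.ext
  simp [arcHomotopy]

theorem arcHomotopy_of_fixed {m : ℕ} (hm : 0 < m) {z : Disk}
    (hz : circlePt (m + 1) 0 (arcCoord hm z) = z) (s : I) : arcHomotopy hm (z, s) = z := by
  apply Subtype.ext
  simp only [arcHomotopy, ContinuousMap.coe_mk, hz]
  rw [← add_smul, sub_add_cancel, one_smul]

theorem arc_fixed {m : ℕ} (hm : 0 < m) {x : ℝ} (h0 : 0 ≤ x) (h1 : x ≤ m) :
    circlePt (m + 1) 0 (arcCoord hm (circlePt (m + 1) 0 x)) = circlePt (m + 1) 0 x := by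
  rw [arcCoord_circlePt hm h0 h1]

theorem arcHomotopy_circlePt {m : ℕ} (hm : 0 < m) {x : ℝ} (h0 : 0 ≤ x) (h1 : x ≤ m) (s : I) :
    arcHomotopy hm (circlePt (m + 1) 0 x, s) = circlePt (m + 1) 0 x :=
  arcHomotopy_of_fixed hm (arc_fixed hm h0 h1) s

/-- Strict convexity: a proper convex combination of two distinct points of the disk is interior. A
moving point therefore enters the open 2-cell at once and stays in it until time 1. -/
theorem norm_arcHomotopy_lt {m : ℕ} (hm : 0 < m) {z : Disk}
    (hz : circlePt (m + 1) 0 (arcCoord hm z) ≠ z) {s : I} (h0 : s ≠ 0) (h1 : s ≠ 1) :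
    ‖(arcHomotopy hm (z, s) : ℂ)‖ < 1 := by
  refine norm_combo_lt_of_ne (norm_circlePt _ _ _).le (mem_closedBall_zero_iff.1 z.2)
    (fun h => hz (Subtype.ext h)) ?_ ?_ (by ring)
  · exact sub_pos.2 (unitInterval.lt_one_iff_ne_one.2 h1)
  · exact unitInterval.pos_iff_ne_zero.2 h0

/-! ### Edge paths as continuous paths -/

section PathMap

variable {Y : TwoComplex.{u, v, w}}

/-- An edge path starting at `p`, parametrized with unit speed. -/
def pathMap (p : Y.V) : List Y.E → ℝ → Y.Realization
  | [], _ => Y.vertexPt p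
  | e :: l, x => if x ≤ 1 then Y.edgePt e (Set.projIcc 0 1 zero_le_one x)
      else pathMap (Y.tgt e) l (x - 1)

theorem pathMap_of_nonpos {p q : Y.V} {l : List Y.E} (h : Y.IsPath p l q) {x : ℝ} (hx : x ≤ 0) :
    pathMap p l x = Y.vertexPt p := by
  cases l with
  | nil => rfl
  | cons e l =>
    rw [pathMap, if_pos (by linarith), Set.projIcc_of_le_left _ hx, ← h.1]
    exact edgePt_zero e

theorem continuous_pathMap {p q : Y.V} {l : List Y.E} (h : Y.IsPath p l q) :
    Continuous (pathMap p l) := by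
  induction l generalizing p with
  | nil => exact continuous_const
  | cons e l ih =>
    refine Continuous.if_le ?_ ((ih h.2).comp (by fun_prop)) continuous_id continuous_const ?_
    · exact (continuous_edgePt e).comp continuous_projIcc
    · rintro x rfl
      rw [Set.projIcc_right, pathMap_of_nonpos h.2 (by norm_num)]
      exact edgePt_one e

theorem pathMap_add {p q : Y.V} {l : List Y.E} (h : Y.IsPath p l q) {k : ℕ} (hk : k < l.length)
    (t : I) : pathMap p l (k + t) = Y.edgePt l[k] t := by
  induction l generalizing p k with
  | nil => simp at hk
  | cons e l ih =>
    have ht1 := t.2.2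
    have ht0 := t.2.1
    cases k with
    | zero =>
      have : ((0 : ℕ) : ℝ) + t = t := by simp
      rw [pathMap, this, if_pos ht1, Set.projIcc_val]
      rfl
    | succ k =>
      have hk' : k < l.length := by simpa using hk
      -- `pathMap` assigns the parameter 1 to the first edge, so the start of the second edge has to
      -- be treated separately.
      by_cases hx : ((k + 1 : ℕ) : ℝ) + t ≤ 1
      · have hk0 : k = 0 := by
          by_contra h0
          have : (1 : ℝ) ≤ k := by exact_mod_cast Nat.one_le_iff_ne_zero.2 h0
          push_cast at hx
          linarith
        subst hk0
        obtain rfl : t = 0 := by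
          push_cast at hx
          have ht : (t : ℝ) = 0 := by linarith
          exact Subtype.ext ht
        have h1 : ((0 + 1 : ℕ) : ℝ) + ((0 : I) : ℝ) = 1 := by simp
        have h2 := ih h.2 hk'
        simp only [Nat.cast_zero, Set.Icc.coe_zero, add_zero] at h2
        rw [pathMap, if_pos hx, h1, Set.projIcc_right, List.getElem_cons_succ, ← h2,
          pathMap_of_nonpos h.2 le_rfl]
        exact edgePt_one e
      · rw [pathMap, if_neg hx, List.getElem_cons_succ, ← ih h.2 hk']
        congr 1
        push_cast
        ring

theorem exists_nat_add {m : ℕ} (hm : 0 < m) {x : ℝ} (h0 : 0 ≤ x) (h1 : x ≤ m) :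
    ∃ k < m, ∃ t : I, x = k + t := by
  -- The right end must be written as `(m - 1) + 1`, because its floor `m` is out of range.
  by_cases hx : x = m
  · refine ⟨m - 1, by omega, 1, ?_⟩
    rw [hx, Nat.cast_sub hm]
    simp
  · refine ⟨⌊x⌋₊, (Nat.floor_lt h0).2 (lt_of_le_of_ne h1 hx),
      ⟨x - ⌊x⌋₊, by linarith [Nat.floor_le h0], by linarith [Nat.lt_floor_add_one x]⟩, ?_⟩
    simp

theorem exists_pathMap_eq {p q : Y.V} {l : List Y.E} (h : Y.IsPath p l q) (hl : 0 < l.length)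
    {x : ℝ} (h0 : 0 ≤ x) (h1 : x ≤ l.length) :
    ∃ e ∈ l, ∃ t, pathMap p l x = Y.edgePt e t := by
  obtain ⟨k, hk, t, rfl⟩ := exists_nat_add hl h0 h1
  exact ⟨_, List.getElem_mem hk, t, pathMap_add h hk t⟩

theorem pathMap_length {p q : Y.V} {l : List Y.E} (h : Y.IsPath p l q) :
    pathMap p l l.length = Y.vertexPt q := by
  rcases l.length.eq_zero_or_pos with hl | hl
  · obtain rfl := List.length_eq_zero_iff.1 hl
    rw [← show p = q from h]
    rfl
  · have h1 := pathMap_add h (k := l.length - 1) (by omega) 1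
    have h2 : ((l.length - 1 : ℕ) : ℝ) + ((1 : I) : ℝ) = l.length := by
      rw [Nat.cast_sub hl]
      simp
    rw [h2] at h1
    rw [h1, edgePt_one, Y.tgt_last_of_isPath h]

end PathMap

end TwoComplex

namespace TwoComplex

/-! ### Chords -/

section Chord

variable (Y : TwoComplex.{u, v, w}) {p q : Y.V} {l : List Y.E}

/-- Addition of an edge from the start to the end of an edge path, together with a 2-cell
bounded by the path and the inverse of the new edge. -/
abbrev addChord (h : Y.IsPath p l q) : TwoComplex.{u, v, w} where
  toOneComplex := Y.toOneComplex.addEdge id p q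
  F := Option Y.F
  bdry f := f.elim (l.map Sum.inl ++ [Sum.inr false]) fun f => (Y.bdry f).map Sum.inl
  bdry_ne_nil f := by
    cases f
    · simp
    · exact mt List.map_eq_nil_iff.1 (Y.bdry_ne_nil _)
  bdry_closed f := by
    rcases f with _ | f
    · exact ⟨p, (OneComplex.isPath_addEdge p q h).append ⟨rfl, rfl⟩⟩
    · obtain ⟨r, hr⟩ := Y.bdry_closed f
      exact ⟨r, OneComplex.isPath_addEdge p q hr⟩

variable {Y} (h : Y.IsPath p l q)

/-- The inclusion of a 2-complex in the complex obtained by adding a chord. -/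
def chordHom : Hom Y (Y.addChord h) where
  vmap := id
  emap := Sum.inl
  fmap := some
  src_emap _ := rfl
  inv_emap _ := rfl
  bdry_fmap _ := rfl

theorem facePt_none_of_lt {k : ℕ} (hk : k < l.length) (t : I) :
    (Y.addChord h).facePt none (circlePt (l.length + 1) 0 (k + t)) =
      (Y.addChord h).edgePt (Sum.inl l[k]) t := by
  have := facePt_circlePt (Y := Y.addChord h) none k (by simp; omega) t
  simp only [Option.elim_none, List.length_append, List.length_map, List.length_cons,
    List.length_nil, zero_add] at this
  rw [← circlePt_eq_zero_add, this, List.getElem_append_left (by simpa using hk),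
    List.getElem_map]

theorem facePt_none_length (t : I) :
    (Y.addChord h).facePt none (circlePt (l.length + 1) l.length t) =
      (Y.addChord h).edgePt (Sum.inr false) t := by
  have := facePt_circlePt (Y := Y.addChord h) none l.length (by simp) t
  simp only [Option.elim_none, List.length_append, List.length_map, List.length_cons,
    List.length_nil, zero_add] at this
  rw [this, List.getElem_append_right (by simp)]
  simp

/-- Identifies the arc onto which the new 2-cell retracts with a path of the old complex, as needed
at time 0 of the homotopy. -/
theorem facePt_none_arc (hl : 0 < l.length) {x : ℝ} (h0 : 0 ≤ x) (h1 : x ≤ l.length) :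
    (Y.addChord h).facePt none (circlePt (l.length + 1) 0 x) =
      (chordHom h).map (pathMap p l x) := by
  obtain ⟨k, hk, t, rfl⟩ := exists_nat_add hl h0 h1
  rw [facePt_none_of_lt h hk, pathMap_add h hk]
  rfl

theorem circlePt_length_zero (m : ℕ) :
    circlePt (m + 1) m ((0 : I) : ℝ) = circlePt (m + 1) 0 m := by
  rw [circlePt_eq_zero_add]
  simp

theorem circlePt_length_one (m : ℕ) :
    circlePt (m + 1) m ((1 : I) : ℝ) = circlePt (m + 1) 0 0 := by
  rw [circlePt_eq_zero_add, ← circlePt_self _ (Nat.succ_pos m)]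
  simp

variable (hl : 0 < l.length)

/-- The retraction along a chord, on edges. -/
def chordEdgeRetraction : Y.E ⊕ Bool → C(I, Y.Realization)
  | Sum.inl e => ⟨Y.edgePt e, continuous_edgePt e⟩
  | Sum.inr b => ⟨fun t => pathMap p l (arcCoord hl (circlePt (l.length + 1) l.length
      (bif b then unitInterval.symm t else t : I))), by
        refine (continuous_pathMap h).comp ((arcCoord hl).continuous.comp
          ((continuous_circlePt _ _).comp (continuous_subtype_val.comp ?_)))
        cases b
        · exact continuous_id
        · exact unitInterval.continuous_symm⟩

/-- The retraction along a chord, on 2-cells. -/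
def chordFaceRetraction : Option Y.F → C(Disk, Y.Realization)
  | some f => ⟨Y.facePt f, continuous_facePt f⟩
  | none => ⟨fun z => pathMap p l (arcCoord hl z),
      (continuous_pathMap h).comp (arcCoord hl).continuous⟩

/-- The retraction along a chord. -/
def chordRetraction : C((Y.addChord h).Realization, Y.Realization) :=
  liftMap Y.vertexPt (chordEdgeRetraction h hl) (chordFaceRetraction h hl)
    (by
      rintro (e | _ | _)
      · exact edgePt_zero e
      · change pathMap p l (arcCoord hl (circlePt (l.length + 1) l.length ((0 : I) : ℝ))) = _
        -- The last arc of the circle starts where the arc of `l` ends, and ends where that arc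
        -- begins; the coordinate there is `l.length`, respectively 0.
        rw [circlePt_length_zero, arcCoord_circlePt hl (by positivity) le_rfl, pathMap_length h]
        rfl
      · change pathMap p l (arcCoord hl (circlePt (l.length + 1) l.length
          ((unitInterval.symm 0 : I) : ℝ))) = _
        rw [unitInterval.symm_zero, circlePt_length_one,
          arcCoord_circlePt hl le_rfl (by positivity), pathMap_of_nonpos h le_rfl]
        rfl)
    (by
      rintro (e | _ | _) t
      · exact edgePt_inv e t
      · change pathMap p l (arcCoord hl (circlePt (l.length + 1) l.length
          ((unitInterval.symm t : I) : ℝ))) = _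
        rfl
      · change pathMap p l (arcCoord hl (circlePt (l.length + 1) l.length (t : ℝ))) =
          pathMap p l (arcCoord hl (circlePt (l.length + 1) l.length
            ((unitInterval.symm (unitInterval.symm t) : I) : ℝ)))
        rw [unitInterval.symm_symm])
    (by
      rintro (_ | f) k hk t
      · simp only [Option.elim_none, List.length_append, List.length_map, List.length_cons,
          List.length_nil, zero_add] at hk ⊢
        rcases Nat.lt_or_ge k l.length with hk' | hk'
        · rw [List.getElem_append_left (by simpa using hk'), List.getElem_map,
            circlePt_eq_zero_add]
          have hkl : (k : ℝ) + 1 ≤ l.length := by exact_mod_cast hk'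
          have ht1 := t.2.2
          have ht0 := t.2.1
          change pathMap p l (arcCoord hl (circlePt (l.length + 1) 0 (k + t))) =
            Y.edgePt l[k] t
          rw [arcCoord_circlePt hl (by positivity) (by linarith), pathMap_add h hk']
        · obtain rfl : k = l.length := by omega
          rw [List.getElem_append_right (by simp)]
          simp only [List.length_map, Nat.sub_self, List.getElem_cons_zero]
          rfl
      · have hk' : k < (Y.bdry f).length := by simpa using hk
        have := facePt_circlePt f k hk' t
        simp only [Option.elim_some, List.getElem_map, List.length_map]
        exact this)

/-- The retraction homotopy along a chord, on edges. -/
def chordEdgeHomotopy : Y.E ⊕ Bool → C(I × I, (Y.addChord h).Realization)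
  | Sum.inl e => ⟨fun z => (Y.addChord h).edgePt (Sum.inl e) z.1,
      (continuous_edgePt _).comp continuous_fst⟩
  | Sum.inr b => ⟨fun z => (Y.addChord h).facePt none (arcHomotopy hl
      (circlePt (l.length + 1) l.length (bif b then unitInterval.symm z.1 else z.1 : I), z.2)), by
        refine (continuous_facePt _).comp ((arcHomotopy hl).continuous.comp
          (((continuous_circlePt _ _).comp (continuous_subtype_val.comp ?_)).prodMk
            continuous_snd))
        cases b
        · exact continuous_fst
        · exact unitInterval.continuous_symm.comp continuous_fst⟩

/-- The retraction homotopy along a chord, on 2-cells. -/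
def chordFaceHomotopy : Option Y.F → C(Disk × I, (Y.addChord h).Realization)
  | some f => ⟨fun z => (Y.addChord h).facePt (some f) z.1,
      (continuous_facePt _).comp continuous_fst⟩
  | none => ⟨fun z => (Y.addChord h).facePt none (arcHomotopy hl z),
      (continuous_facePt _).comp (arcHomotopy hl).continuous⟩

/-- The retraction homotopy along a chord. -/
def chordHomotopy : C((Y.addChord h).Realization × I, (Y.addChord h).Realization) :=
  liftHomotopy (fun r => .const _ ((Y.addChord h).vertexPt r)) (chordEdgeHomotopy h hl)
    (chordFaceHomotopy h hl)
    (by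
      rintro (e | _ | _) s
      · exact edgePt_zero (Y := Y.addChord h) (Sum.inl e)
      · change (Y.addChord h).facePt none (arcHomotopy hl
          (circlePt (l.length + 1) l.length ((0 : I) : ℝ), s)) = (Y.addChord h).vertexPt q
        rw [circlePt_length_zero, arcHomotopy_circlePt hl (by positivity) le_rfl,
          ← circlePt_length_zero, facePt_none_length]
        exact edgePt_zero (Y := Y.addChord h) (Sum.inr false)
      · change (Y.addChord h).facePt none (arcHomotopy hl
          (circlePt (l.length + 1) l.length ((unitInterval.symm 0 : I) : ℝ), s)) =
            (Y.addChord h).vertexPt p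
        rw [unitInterval.symm_zero, circlePt_length_one,
          arcHomotopy_circlePt hl le_rfl (by positivity), ← circlePt_length_one,
          facePt_none_length]
        exact edgePt_one (Y := Y.addChord h) (Sum.inr false))
    (by
      rintro (e | _ | _) t s
      · exact edgePt_inv (Y := Y.addChord h) (Sum.inl e) t
      · rfl
      · change (Y.addChord h).facePt none (arcHomotopy hl
            (circlePt (l.length + 1) l.length (t : ℝ), s)) =
          (Y.addChord h).facePt none (arcHomotopy hl (circlePt (l.length + 1) l.length
            ((unitInterval.symm (unitInterval.symm t) : I) : ℝ), s))
        rw [unitInterval.symm_symm])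
    (by
      rintro (_ | f) k hk t s
      · simp only [Option.elim_none, List.length_append, List.length_map, List.length_cons,
          List.length_nil, zero_add] at hk ⊢
        rcases Nat.lt_or_ge k l.length with hk' | hk'
        · rw [List.getElem_append_left (by simpa using hk'), List.getElem_map,
            circlePt_eq_zero_add]
          have hkl : (k : ℝ) + 1 ≤ l.length := by exact_mod_cast hk'
          have ht1 := t.2.2
          have ht0 := t.2.1
          change (Y.addChord h).facePt none (arcHomotopy hl
            (circlePt (l.length + 1) 0 (k + t), s)) = (Y.addChord h).edgePt (Sum.inl l[k]) t
          rw [arcHomotopy_circlePt hl (by positivity) (by linarith), facePt_none_of_lt h hk']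
        · obtain rfl : k = l.length := by omega
          rw [List.getElem_append_right (by simp)]
          simp only [List.length_map, Nat.sub_self, List.getElem_cons_zero]
          rfl
      · refine (facePt_circlePt (Y := Y.addChord h) (some f) k hk t).trans ?_
        simp only [Option.elim_some, List.getElem_map]
        rfl)

/-- The open cells created by adding a chord. -/
def chordNew : Set (Y.addChord h).Realization :=
  {x | cellLift (Y := Y.addChord h) (fun _ => False)
    (fun e : Y.E ⊕ Bool => e.isRight = true) (fun f : Option Y.F => f = none)
    (by rintro (e | b) <;> rfl) x}

theorem edgePt_mem_chordNew {b : Bool} {t : I} (h0 : t ≠ 0) (h1 : t ≠ 1) :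
    (Y.addChord h).edgePt (Sum.inr b) t ∈ chordNew h := by
  rw [chordNew, Set.mem_ofPred_eq, cellLift_edgePt _ _ _ _ _ _ h0 h1]
  rfl

theorem facePt_mem_chordNew {z : Disk} (hz : ‖(z : ℂ)‖ < 1) :
    (Y.addChord h).facePt none z ∈ chordNew h := by
  rw [chordNew, Set.mem_ofPred_eq, cellLift_facePt _ _ _ _ _ _ hz]

/-- Points of the arc of `l` do not move. Any other point lies in the open 2-cell at intermediate
times, by strict convexity, and at time 1 it is in the open 2-cell or the open new edge. So outside
the new cells such a point can only be at time 0. -/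
theorem chordHomotopy_const {z : Disk} {t : I}
    (ht : (Y.addChord h).facePt none (arcHomotopy hl (z, t)) ∉ chordNew h) {s : I} (hst : s ≤ t) :
    (Y.addChord h).facePt none (arcHomotopy hl (z, s)) =
      (Y.addChord h).facePt none (arcHomotopy hl (z, t)) := by
  by_cases hz : circlePt (l.length + 1) 0 (arcCoord hl z) = z
  · rw [arcHomotopy_of_fixed hl hz, arcHomotopy_of_fixed hl hz]
  by_cases h0 : t = 0
  · rw [le_antisymm hst (h0 ▸ unitInterval.nonneg')]
  by_cases h1 : t = 1
  · exfalso
    subst h1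
    rw [arcHomotopy_one] at ht
    by_cases hz1 : ‖(z : ℂ)‖ < 1
    · exact ht (facePt_mem_chordNew h hz1)
    obtain ⟨k, hk, x, rfl⟩ := exists_eq_circlePt (Nat.succ_pos l.length) z
      (le_antisymm (mem_closedBall_zero_iff.1 z.2) (not_lt.1 hz1))
    rcases Nat.lt_or_ge k l.length with hk' | hk'
    · have hkl : (k : ℝ) + 1 ≤ l.length := by exact_mod_cast hk'
      have hx1 := x.2.2
      have hx0 := x.2.1
      rw [Nat.succ_eq_add_one, circlePt_eq_zero_add _ k] at hz
      exact hz (arc_fixed hl (by positivity) (by linarith))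
    · obtain rfl : k = l.length := by omega
      rw [Nat.succ_eq_add_one] at hz ht
      rw [facePt_none_length] at ht
      -- Both ends of the last arc also lie on the arc of `l`, hence are fixed.
      by_cases hx0 : x = 0
      · rw [hx0, circlePt_length_zero] at hz
        exact hz (arc_fixed hl (by positivity) le_rfl)
      by_cases hx1 : x = 1
      · rw [hx1, circlePt_length_one] at hz
        exact hz (arc_fixed hl le_rfl (by positivity))
      exact ht (edgePt_mem_chordNew h hx0 hx1)
  · exact absurd (facePt_mem_chordNew h (norm_arcHomotopy_lt hl hz h0 h1)) ht

theorem chordHomotopy_zero (z : Disk) :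
    (Y.addChord h).facePt none (arcHomotopy hl (z, 0)) =
      (chordHom h).map (pathMap p l (arcCoord hl z)) := by
  rw [arcHomotopy_zero, facePt_none_arc h hl (arcCoord_nonneg hl z) (arcCoord_le hl z)]

/-- The deformation retraction along a chord. -/
def chordExpansion : Expansion (chordHom h) where
  r := chordRetraction h hl
  H :=
    { toContinuousMap := (chordHomotopy h hl).comp ContinuousMap.prodSwap
      map_zero_left := realization_ind (fun _ => rfl)
        (by
          rintro (e | b) t
          · rfl
          · exact chordHomotopy_zero h hl _)
        (by
          rintro (_ | f) z
          · exact chordHomotopy_zero h hl _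
          · rfl)
      map_one_left := realization_ind (fun _ => rfl)
        (by
          rintro (e | _ | _) t
          · rfl
          · change (Y.addChord h).facePt none (arcHomotopy hl
              (circlePt (l.length + 1) l.length (t : ℝ), 1)) = _
            rw [arcHomotopy_one, facePt_none_length]
            rfl
          · change (Y.addChord h).facePt none (arcHomotopy hl
              (circlePt (l.length + 1) l.length ((unitInterval.symm t : I) : ℝ), 1)) = _
            rw [arcHomotopy_one, facePt_none_length]
            exact (edgePt_inv (Y := Y.addChord h) (Sum.inr false) t).symm)
        (by
          rintro (_ | f) z
          · exact congrArg ((Y.addChord h).facePt none) (arcHomotopy_one hl z)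
          · rfl) }
  new := chordNew h
  const_of_not_new := by
    refine realization_ind (fun _ _ _ _ _ => rfl) ?_ ?_
    · rintro (e | b) t
      · exact fun _ _ _ _ => rfl
      · exact fun _ ht _ hst => chordHomotopy_const h hl ht hst
    · rintro (_ | f) z
      · exact fun _ ht _ hst => chordHomotopy_const h hl ht hst
      · exact fun _ _ _ _ => rfl
  vertex_mem r t := vertexPt_mem_oneSkeleton (Y := Y.addChord h) r
  r_map := realization_ind (fun _ => rfl) (fun _ _ => rfl) (fun _ _ => rfl)
  map_not_new x := by
    rw [chordNew, Set.mem_ofPred_eq]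
    obtain ⟨q, rfl⟩ | ⟨e, t, h0, h1, rfl⟩ | ⟨f, z, hz, rfl⟩ := realization_cases x
    · simp [chordHom]
    · rw [Hom.map_edgePt, cellLift_edgePt _ _ _ _ _ _ h0 h1]
      simp [chordHom]
    · rw [Hom.map_facePt, cellLift_facePt _ _ _ _ _ _ hz]
      simp [chordHom]

end Chord

end TwoComplex

/-! ### Cyclic adjacency in lists -/

namespace List

variable {α β : Type*}

/-- The element `y` immediately follows `x` somewhere in the list. -/
def Adj (l : List α) (x y : α) : Prop := ∃ i, l[i]? = some x ∧ l[i + 1]? = some y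

theorem not_adj_nil {x y : α} : ¬ Adj [] x y := by simp [Adj]

theorem adj_cons {a : α} {l : List α} {x y : α} :
    Adj (a :: l) x y ↔ (a = x ∧ l.head? = some y) ∨ Adj l x y := by
  constructor
  · rintro ⟨_ | i, h1, h2⟩
    · exact Or.inl ⟨by simpa using h1, by simpa [List.head?_eq_getElem?] using h2⟩
    · exact Or.inr ⟨i, by simpa using h1, by simpa using h2⟩
  · rintro (⟨rfl, h⟩ | ⟨i, h1, h2⟩)
    · exact ⟨0, by simp, by simpa [List.head?_eq_getElem?] using h⟩
    · exact ⟨i + 1, by simpa using h1, by simpa using h2⟩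

theorem adj_append {l l' : List α} {x y : α} :
    Adj (l ++ l') x y ↔
      Adj l x y ∨ Adj l' x y ∨ (l.getLast? = some x ∧ l'.head? = some y) := by
  induction l with
  | nil => simp [not_adj_nil]
  | cons a l ih =>
    rw [cons_append, adj_cons, adj_cons, ih]
    cases l with
    | nil => simp [not_adj_nil]; tauto
    | cons b l => simp [List.getLast?_cons_cons]; tauto

/-- The element `y` immediately follows `x` somewhere in the list, viewed as a cyclic list. -/
def CycNext (l : List α) (x y : α) : Prop :=
  Adj l x y ∨ (l.getLast? = some x ∧ l.head? = some y)

/-- Cyclic order does not depend on the starting point, so the outer circuit may be cut wherever new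
edges are inserted. -/
theorem cycNext_append_comm {l l' : List α} {x y : α} (h : CycNext (l ++ l') x y) :
    CycNext (l' ++ l) x y := by
  rcases l.eq_nil_or_concat with rfl | ⟨l, a, rfl⟩
  · simpa using h
  rcases l'.eq_nil_or_concat with rfl | ⟨l', a', rfl⟩
  · simpa using h
  have h1 : (l ++ [a]) ≠ [] := by simp
  have h2 : (l' ++ [a']) ≠ [] := by simp
  simp only [concat_eq_append] at h ⊢
  simp only [CycNext, adj_append (l := l ++ [a]), adj_append (l := l' ++ [a']),
    head?_append_of_ne_nil _ h1, head?_append_of_ne_nil _ h2,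
    getLast?_append_of_ne_nil _ h1, getLast?_append_of_ne_nil _ h2] at h ⊢
  tauto

/-- Translates the index arithmetic of `link_connected` into a relation that is compatible with `++`
and `map`. -/
theorem cycNext_iff_exists_fin {l : List α} {x y : α} :
    (∃ i j : Fin l.length, l[i] = x ∧ l[j] = y ∧ (j : ℕ) = (i + 1) % l.length) ↔
      CycNext l x y := by
  constructor
  · rintro ⟨⟨i, hi⟩, ⟨j, hj⟩, rfl, rfl, hij⟩
    simp only [Fin.getElem_fin] at hij ⊢
    by_cases h : i + 1 < l.length
    · rw [Nat.mod_eq_of_lt h] at hij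
      subst hij
      exact Or.inl ⟨i, by simp [hi], by simp [h]⟩
    · have h1 : i + 1 = l.length := by omega
      rw [h1, Nat.mod_self] at hij
      subst hij
      obtain rfl : i = l.length - 1 := by omega
      refine Or.inr ⟨?_, ?_⟩
      · rw [getLast?_eq_getElem?, getElem?_eq_getElem]
      · rw [head?_eq_getElem?, getElem?_eq_getElem]
  · rintro (⟨i, h1, h2⟩ | ⟨h1, h2⟩)
    · obtain ⟨hi, rfl⟩ := getElem?_eq_some_iff.1 h1
      obtain ⟨hj, rfl⟩ := getElem?_eq_some_iff.1 h2
      exact ⟨⟨i, hi⟩, ⟨i + 1, hj⟩, rfl, rfl, (Nat.mod_eq_of_lt hj).symm⟩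
    · rw [getLast?_eq_getElem?] at h1
      rw [head?_eq_getElem?] at h2
      obtain ⟨hi, rfl⟩ := getElem?_eq_some_iff.1 h1
      obtain ⟨hj, rfl⟩ := getElem?_eq_some_iff.1 h2
      refine ⟨⟨_, hi⟩, ⟨0, hj⟩, rfl, rfl, ?_⟩
      simp [Nat.sub_add_cancel hj]

theorem Adj.map {l : List α} {x y : α} (f : α → β) (h : Adj l x y) : Adj (l.map f) (f x) (f y) := by
  obtain ⟨i, h1, h2⟩ := h
  exact ⟨i, by simp [h1], by simp [h2]⟩

theorem CycNext.map {l : List α} {x y : α} (f : α → β) (h : CycNext l x y) :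
    CycNext (l.map f) (f x) (f y) := by
  rcases h with h | ⟨h1, h2⟩
  · exact Or.inl (h.map f)
  · exact Or.inr ⟨by simp [h1], by simp [h2]⟩

/-- Splits `face_unique` into a condition on each circuit and a condition on each edge. -/
theorem bijective_sigma_getElem_iff {ι : Type*} {c : ι → List α} :
    Function.Bijective (fun z : (Σ o, Fin (c o).length) => (c z.1)[z.2]) ↔
      (∀ o, (c o).Nodup) ∧ ∀ e, ∃! o, e ∈ c o := by
  constructor
  · rintro ⟨hi, hs⟩
    refine ⟨fun o => ?_, fun e => ?_⟩
    · rw [nodup_iff_injective_getElem]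
      intro i j hij
      have := @hi ⟨o, i⟩ ⟨o, j⟩ hij
      simpa using this
    · obtain ⟨⟨o, i⟩, rfl⟩ := hs e
      refine ⟨o, getElem_mem _, fun o' ho' => ?_⟩
      obtain ⟨j, hj, hj'⟩ := mem_iff_getElem.1 ho'
      have := @hi ⟨o', ⟨j, hj⟩⟩ ⟨o, i⟩ hj'
      exact congrArg Sigma.fst this
  · rintro ⟨hn, hu⟩
    constructor
    · rintro ⟨o, i⟩ ⟨o', i'⟩ h
      obtain rfl : o = o' := by
        refine (hu ((c o)[i])).unique (getElem_mem _) ?_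
        simp only at h
        rw [h]
        exact getElem_mem _
      obtain rfl : i = i' := nodup_iff_injective_getElem.1 (hn o) h
      rfl
    · intro e
      obtain ⟨o, ho, -⟩ := hu e
      obtain ⟨j, hj, hj'⟩ := mem_iff_getElem.1 ho
      exact ⟨⟨o, ⟨j, hj⟩⟩, hj'⟩

end List

/-! ### Boundary circuits and rotation about a vertex -/

namespace VanKampenDiagram

variable {A : Type v} [InvolutiveInv A] {R : Set (List A)} {x : List A}

theorem nodup_circuit (D : VanKampenDiagram R x) (o : Option D.F) :
    (o.elim D.outer D.bdry).Nodup :=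
  (List.bijective_sigma_getElem_iff.1 D.face_unique).1 o

theorem existsUnique_circuit (D : VanKampenDiagram R x) (e : D.E) :
    ∃! o : Option D.F, e ∈ o.elim D.outer D.bdry :=
  (List.bijective_sigma_getElem_iff.1 D.face_unique).2 e

/-- Rotation about the initial vertex of an edge. -/
def _root_.TwoComplex.Turn (Y : TwoComplex.{u, v, w}) (outer : List Y.E) (d d' : Y.E) : Prop :=
  ∃ o : Option Y.F, (o.elim outer Y.bdry).CycNext (Y.inv d) d'

theorem reflTransGen_turn (D : VanKampenDiagram R x) {e e' : D.E} (h : D.src e = D.src e') :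
    Relation.ReflTransGen (D.Turn D.outer) e e' :=
  Relation.ReflTransGen.mono (fun _ _ ⟨o, h⟩ => ⟨o, List.cycNext_iff_exists_fin.1 h⟩) _ _
    (D.link_connected e e' h)

/-- Lifting of rotations along a map that refines single steps. -/
theorem reflTransGen_turn_map (D : VanKampenDiagram R x) {E' : Type*} {r : E' → E' → Prop}
    {i : D.E → E'} (hr : ∀ d d', D.Turn D.outer d d' → Relation.ReflTransGen r (i d) (i d'))
    {e e' : D.E} (h : D.src e = D.src e') : Relation.ReflTransGen r (i e) (i e') :=
  Relation.ReflTransGen.lift' i hr _ _ (D.reflTransGen_turn h)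

theorem isPath_of_outer_eq (D : VanKampenDiagram R x) {l₁ l₂ : List D.E} {p : D.V}
    (hout : D.outer = l₁ ++ l₂) (hp : D.IsPath D.base l₁ p) : D.IsPath p l₂ D.base := by
  have h := D.outer_closed
  rw [hout, OneComplex.isPath_append] at h
  obtain ⟨r, h1, h2⟩ := h
  rwa [hp.unique h1]

theorem src_eq_of_head? {Y : OneComplex.{u, v}} {p q : Y.V} {l : List Y.E} {e : Y.E}
    (h : Y.IsPath p l q) (he : l.head? = some e) : Y.src e = p := by
  cases l with
  | nil => simp at he
  | cons a l =>
    obtain rfl : a = e := by simpa using he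
    exact h.1

theorem tgt_eq_of_getLast? {Y : OneComplex.{u, v}} {p q : Y.V} {l : List Y.E} {e : Y.E}
    (h : Y.IsPath p l q) (he : l.getLast? = some e) : Y.tgt e = q := by
  rcases l.eq_nil_or_concat with rfl | ⟨l, a, rfl⟩
  · simp at he
  · obtain rfl : a = e := by simpa using he
    rw [List.concat_eq_append, OneComplex.isPath_append] at h
    obtain ⟨r, -, -, h2⟩ := h
    exact h2

end VanKampenDiagram

/-! ### Planarity of diagrams after adding a pendant edge or a chord -/

namespace VanKampenDiagram

variable {A : Type v} [InvolutiveInv A] {R : Set (List A)} {x x' : List A}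

/-- The outer circuit after adding a pendant edge. -/
def pendantOuter {E : Type*} (l₁ l₂ : List E) : List (E ⊕ Bool) :=
  l₁.map Sum.inl ++ Sum.inr true :: Sum.inr false :: l₂.map Sum.inl

/-- The outer circuit after adding a chord. -/
def chordOuter {E : Type*} (l₁ l₂ : List E) : List (E ⊕ Bool) :=
  l₁.map Sum.inl ++ Sum.inr true :: l₂.map Sum.inl

theorem inl_mem_pendantOuter {E : Type*} {l₁ l₂ : List E} {d : E} :
    Sum.inl d ∈ pendantOuter l₁ l₂ ↔ d ∈ l₁ ++ l₂ := by
  simp [pendantOuter]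

theorem inl_mem_chordOuter {E : Type*} {l₁ l₂ : List E} {d : E} :
    Sum.inl d ∈ chordOuter l₁ l₂ ↔ d ∈ l₁ ++ l₂ := by
  simp [chordOuter]

theorem inr_mem_chordOuter {E : Type*} {l₁ l₂ : List E} {b : Bool} :
    Sum.inr b ∈ chordOuter l₁ l₂ ↔ b = true := by
  simp [chordOuter]

/-- Up to rotation, the new circuit is the old one, cut between `l₁` and `l₂`, followed by the two
new directed edges. -/
theorem cycNext_pendantOuter {E : Type*} {l₁ l₂ : List E} {d d' : E ⊕ Bool}
    (h : ((l₂ ++ l₁).map Sum.inl ++ [Sum.inr true, Sum.inr false]).CycNext d d') :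
    (pendantOuter l₁ l₂).CycNext d d' := by
  rw [List.map_append, List.append_assoc] at h
  simpa [pendantOuter] using List.cycNext_append_comm h

theorem cycNext_chordOuter {E : Type*} {l₁ l₂ : List E} {d d' : E ⊕ Bool}
    (h : ((l₂ ++ l₁).map Sum.inl ++ [Sum.inr true]).CycNext d d') :
    (chordOuter l₁ l₂).CycNext d d' := by
  rw [List.map_append, List.append_assoc] at h
  simpa [chordOuter] using List.cycNext_append_comm h

section Pendant

variable (D : VanKampenDiagram R x) {l₁ l₂ : List D.E} {p : D.V}

theorem pendant_face_unique (hout : D.outer = l₁ ++ l₂) :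
    Function.Bijective fun z : (Σ o : Option D.F, Fin (o.elim (pendantOuter l₁ l₂)
      (D.addPendant p).bdry).length) => (z.1.elim (pendantOuter l₁ l₂)
      (D.addPendant p).bdry)[z.2] := by
  refine List.bijective_sigma_getElem_iff.2 ⟨?_, ?_⟩
  · rintro (_ | f)
    · have h : (l₁ ++ l₂).Nodup := hout ▸ D.nodup_circuit none
      have h' := h.map (f := (Sum.inl : D.E → D.E ⊕ Bool)) Sum.inl_injective
      have hp : ((Sum.inr true :: Sum.inr false :: l₂.map Sum.inl ++ l₁.map Sum.inl :
          List (D.E ⊕ Bool))).Nodup := by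
        rw [List.map_append] at h'
        simpa using List.nodup_append_comm.1 h'
      exact List.nodup_append_comm.1 hp
    · exact (D.nodup_circuit (some f)).map Sum.inl_injective
  · rintro (e | b)
    · obtain ⟨o, ho, hu⟩ := D.existsUnique_circuit e
      have key : ∀ o : Option D.F, (Sum.inl e : D.E ⊕ Bool) ∈ o.elim (pendantOuter l₁ l₂)
          (D.addPendant p).bdry ↔ e ∈ o.elim D.outer D.bdry := by
        rintro (_ | f)
        · simp [pendantOuter, hout]
        · simp
      exact ⟨o, (key o).2 ho, fun o' ho' => hu o' ((key o').1 ho')⟩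
    · refine ⟨none, by cases b <;> simp [pendantOuter], ?_⟩
      rintro (_ | f) ho
      · rfl
      · simp at ho

/-- The new edge is placed in the corner at `p` between the last and the first edge of the circuit
`l₂ ++ l₁`. The rotation across this corner becomes two rotations, and all others persist. `hE`
ensures that this corner exists as soon as there are old edges, so that old and new edges at `p` are
linked. -/
theorem pendant_reflTransGen (hout : D.outer = l₁ ++ l₂) (hp : D.IsPath D.base l₁ p)
    (hE : D.outer = [] → IsEmpty D.E) (e e' : D.E ⊕ Bool)
    (he : (D.addPendant p).src e = (D.addPendant p).src e') :
    Relation.ReflTransGen ((D.addPendant p).Turn (pendantOuter l₁ l₂)) e e' := by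
  have hpath : D.IsPath p (l₂ ++ l₁) p := (D.isPath_of_outer_eq hout hp).append hp
  have hin : ∀ d, (l₂ ++ l₁).getLast? = some (D.inv d) →
      (D.addPendant p).Turn (pendantOuter l₁ l₂) (Sum.inl d) (Sum.inr true) := by
    intro d hd
    refine ⟨none, cycNext_pendantOuter (Or.inl (List.adj_append.2 (Or.inr (Or.inr ⟨?_, rfl⟩))))⟩
    rw [List.getLast?_map, hd]
    rfl
  have hnext : ∀ d, (l₂ ++ l₁).head? = some d →
      (D.addPendant p).Turn (pendantOuter l₁ l₂) (Sum.inr true) (Sum.inl d) := by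
    intro d hd
    refine ⟨none, cycNext_pendantOuter (Or.inr ⟨?_, ?_⟩)⟩
    · simp
    · rw [List.head?_append, List.head?_map, hd]
      rfl
  have hstep : ∀ d d', D.Turn D.outer d d' →
      Relation.ReflTransGen ((D.addPendant p).Turn (pendantOuter l₁ l₂))
        (Sum.inl d) (Sum.inl d') := by
    rintro d d' ⟨_ | f, h⟩
    · rw [Option.elim_none, hout] at h
      -- Consecutive edges of `l₂ ++ l₁` remain consecutive; the wrap-around pair is the corner that
      -- receives the new edge.
      rcases List.cycNext_append_comm h with h | ⟨h1, h2⟩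
      · exact .single ⟨none, cycNext_pendantOuter
          (Or.inl (List.adj_append.2 (Or.inl (h.map Sum.inl))))⟩
      · exact .tail (.single (hin d h1)) (hnext d' h2)
    · exact .single ⟨some f, h.map Sum.inl⟩
  have hne : ∀ d : D.E, l₂ ++ l₁ ≠ [] := by
    intro d h
    have : D.outer = [] := by
      rw [List.append_eq_nil_iff] at h
      rw [hout, h.1, h.2]
      rfl
    exact (hE this).false d
  rcases e with d | b <;> rcases e' with d' | b'
  · exact D.reflTransGen_turn_map hstep (Option.some_injective _ he)
  · cases b'
    · exact absurd he (Option.some_ne_none _)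
    have hd : D.src d = p := Option.some_injective _ he
    obtain ⟨z, hz⟩ : ∃ z, (l₂ ++ l₁).getLast? = some z := by
      rw [← Option.ne_none_iff_exists', Ne, List.getLast?_eq_none_iff]
      exact hne d
    refine .tail (D.reflTransGen_turn_map hstep (e' := D.inv z) ?_) (hin _ ?_)
    · rw [hd, OneComplex.src_inv, tgt_eq_of_getLast? hpath hz]
    · rw [D.inv_inv, hz]
  · cases b
    · exact absurd he.symm (Option.some_ne_none _)
    have hd : p = D.src d' := Option.some_injective _ he
    obtain ⟨z, hz⟩ : ∃ z, (l₂ ++ l₁).head? = some z := by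
      rw [← Option.ne_none_iff_exists', Ne, List.head?_eq_none_iff]
      exact hne d'
    refine .head (hnext z hz) (D.reflTransGen_turn_map hstep ?_)
    rw [← hd, src_eq_of_head? hpath hz]
  · cases b <;> cases b'
    · exact .refl
    · exact absurd he.symm (Option.some_ne_none _)
    · exact absurd he (Option.some_ne_none _)
    · exact .refl

/-- Addition of a pendant edge labeled `a` to a van Kampen diagram. -/
def addPendant (hout : D.outer = l₁ ++ l₂) (hp : D.IsPath D.base l₁ p)
    (hE : D.outer = [] → IsEmpty D.E) (a : A)
    (hx : x' = l₁.map D.label ++ a :: a⁻¹ :: l₂.map D.label) : VanKampenDiagram R x' where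
  toTwoComplex := D.toTwoComplex.addPendant p
  finite_V := have := D.finite_V; inferInstanceAs (Finite (Option D.V))
  finite_E := have := D.finite_E; inferInstanceAs (Finite (D.E ⊕ Bool))
  finite_F := D.finite_F
  label := Sum.elim D.label fun b => bif b then a else a⁻¹
  label_inv := by
    rintro (e | _ | _)
    · exact D.label_inv e
    · exact (inv_inv a).symm
    · rfl
  label_bdry f := by
    simpa [Function.comp_def] using D.label_bdry f
  base := some D.base
  outer := pendantOuter l₁ l₂
  outer_closed := (OneComplex.isPath_addEdge (some p) none hp).append
    ⟨rfl, rfl, OneComplex.isPath_addEdge (some p) none (D.isPath_of_outer_eq hout hp)⟩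
  label_outer := by
    simp [pendantOuter, hx]
  connected := by
    rintro (_ | q)
    · have h : (D.addEdge some (some p) none).IsPath (some p) [Sum.inr true] none := ⟨rfl, rfl⟩
      exact ⟨_, (OneComplex.isPath_addEdge (some p) none hp).append h⟩
    · obtain ⟨l, hl⟩ := D.connected q
      exact ⟨_, OneComplex.isPath_addEdge (some p) none hl⟩
  face_unique := D.pendant_face_unique hout
  link_connected e e' he :=
    Relation.ReflTransGen.mono (fun _ _ ⟨o, h⟩ => ⟨o, List.cycNext_iff_exists_fin.2 h⟩) _ _
      (D.pendant_reflTransGen hout hp hE e e' he)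
  euler := by
    have := D.finite_V
    have := D.finite_E
    have h := D.euler
    simp only [Finite.card_option, Nat.card_sum, Nat.card_eq_fintype_card (α := Bool),
      Fintype.card_bool]
    omega

end Pendant

section Chord

variable (D : VanKampenDiagram R x) {l₁ l l₂ : List D.E} {p q : D.V} (hl : D.IsPath p l q)

/-- The edges of `l` move from the outer circuit to the new 2-cell. Of the two new directed edges,
one lies on the outer circuit and its inverse on the new 2-cell. -/
theorem chord_face_unique (hout : D.outer = l₁ ++ (l ++ l₂)) :
    Function.Bijective fun z : (Σ o : Option (Option D.F), Fin (o.elim (chordOuter l₁ l₂)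
      (D.addChord hl).bdry).length) => (z.1.elim (chordOuter l₁ l₂)
      (D.addChord hl).bdry)[z.2] := by
  have h : (l ++ (l₂ ++ l₁)).Nodup := by
    rw [← List.append_assoc, List.nodup_append_comm, ← hout]
    exact D.nodup_circuit none
  obtain ⟨hnl, hnm, hdis⟩ := List.nodup_append'.1 h
  refine List.bijective_sigma_getElem_iff.2 ⟨?_, ?_⟩
  · rintro (_ | _ | f)
    · have h' := hnm.map (f := (Sum.inl : D.E → D.E ⊕ Bool)) Sum.inl_injective
      have hp : ((Sum.inr true :: l₂.map Sum.inl ++ l₁.map Sum.inl :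
          List (D.E ⊕ Bool))).Nodup := by
        rw [List.map_append] at h'
        simpa using h'
      exact List.nodup_append_comm.1 hp
    · have h' := hnl.map (f := (Sum.inl : D.E → D.E ⊕ Bool)) Sum.inl_injective
      exact h'.append (List.nodup_singleton _) (by simp)
    · exact (D.nodup_circuit (some f)).map Sum.inl_injective
  · rintro (e | _ | _)
    · obtain ⟨o, ho, hu⟩ := D.existsUnique_circuit e
      -- `Option.join` sends both the outer face and the new 2-cell to the old outer face, out of
      -- which they were cut.
      have key : ∀ o : Option (Option D.F), (Sum.inl e : D.E ⊕ Bool) ∈ o.elim (chordOuter l₁ l₂)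
          (D.addChord hl).bdry → e ∈ o.join.elim D.outer D.bdry := by
        rintro (_ | _ | f)
        · simp [chordOuter, hout]; tauto
        · simp [hout]; tauto
        · simp
      rcases o with _ | f
      · simp only [Option.elim_none, hout, List.mem_append] at ho
        have key' : ∀ o, (Sum.inl e : D.E ⊕ Bool) ∈ o.elim (chordOuter l₁ l₂)
            (D.addChord hl).bdry → o = none ∨ o = some none := by
          intro o ho
          rcases o with _ | _ | f
          · exact Or.inl rfl
          · exact Or.inr rfl
          · exact absurd (hu _ (key _ ho)) (Option.some_ne_none _)
        by_cases hel : e ∈ l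
        · have hem : e ∉ l₂ ++ l₁ := hdis hel
          refine ⟨some none, by simp [hel], fun o' ho' => (key' o' ho').resolve_left ?_⟩
          rintro rfl
          simp only [Option.elim_none, chordOuter, List.mem_append, List.mem_cons, reduceCtorEq,
            false_or, List.mem_map, Sum.inl.injEq, exists_eq_right] at ho' hem
          tauto
        · refine ⟨none, ?_, fun o' ho' => (key' o' ho').resolve_right ?_⟩
          · simp [chordOuter]
            tauto
          · rintro rfl
            simp [hel] at ho'
      · refine ⟨some (some f), by simpa using ho, fun o' ho' => ?_⟩
        have := hu _ (key o' ho')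
        rcases o' with _ | _ | f'
        · exact absurd this.symm (Option.some_ne_none _)
        · exact absurd this.symm (Option.some_ne_none _)
        · exact congrArg some this
    · refine ⟨some none, by simp, ?_⟩
      rintro (_ | _ | f) ho
      · simp [chordOuter] at ho
      · rfl
      · simp at ho
    · refine ⟨none, by simp [chordOuter], ?_⟩
      rintro (_ | _ | f) ho
      · rfl
      · simp at ho
      · simp at ho

/-- The chord subdivides one corner of the outer face at `p` and one at `q`; the two halves of each
belong to the new 2-cell and to the new outer face. `p ≠ q` makes both `l` and `l₂ ++ l₁` nonempty,
so these corners exist, and keeps the two ends of the chord apart. -/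
theorem chord_reflTransGen (hpq : p ≠ q) (hout : D.outer = l₁ ++ (l ++ l₂))
    (hp : D.IsPath D.base l₁ p) (e e' : D.E ⊕ Bool)
    (he : (D.addChord hl).src e = (D.addChord hl).src e') :
    Relation.ReflTransGen ((D.addChord hl).Turn (chordOuter l₁ l₂)) e e' := by
  have hpath : D.IsPath q (l₂ ++ l₁) p := by
    have h := D.isPath_of_outer_eq hout hp
    rw [OneComplex.isPath_append] at h
    obtain ⟨r, h1, h2⟩ := h
    rw [h1.unique hl] at h2
    exact h2.append hp
  have hlne : l ≠ [] := by
    rintro rfl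
    exact hpq hl
  have hmne : l₂ ++ l₁ ≠ [] := by
    intro h
    rw [h] at hpath
    exact hpq hpath.symm
  have hin : ∀ d, (l₂ ++ l₁).getLast? = some (D.inv d) →
      (D.addChord hl).Turn (chordOuter l₁ l₂) (Sum.inl d) (Sum.inr true) := by
    intro d hd
    refine ⟨none, cycNext_chordOuter (Or.inl (List.adj_append.2 (Or.inr (Or.inr ⟨?_, rfl⟩))))⟩
    rw [List.getLast?_map, hd]
    rfl
  have hnext : ∀ d, (l₂ ++ l₁).head? = some d →
      (D.addChord hl).Turn (chordOuter l₁ l₂) (Sum.inr false) (Sum.inl d) := by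
    intro d hd
    refine ⟨none, cycNext_chordOuter (Or.inr ⟨?_, ?_⟩)⟩
    · simp
    · rw [List.head?_append, List.head?_map, hd]
      rfl
  have hin' : ∀ d, l.getLast? = some (D.inv d) →
      (D.addChord hl).Turn (chordOuter l₁ l₂) (Sum.inl d) (Sum.inr false) := by
    intro d hd
    refine ⟨some none, Or.inl (List.adj_append.2 (Or.inr (Or.inr ⟨?_, rfl⟩)))⟩
    rw [List.getLast?_map, hd]
    rfl
  have hnext' : ∀ d, l.head? = some d →
      (D.addChord hl).Turn (chordOuter l₁ l₂) (Sum.inr true) (Sum.inl d) := by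
    intro d hd
    refine ⟨some none, Or.inr ⟨?_, ?_⟩⟩
    · simp
    · change (l.map Sum.inl ++ [Sum.inr false]).head? = _
      rw [List.head?_append, List.head?_map, hd]
      rfl
  have hstep : ∀ d d', D.Turn D.outer d d' →
      Relation.ReflTransGen ((D.addChord hl).Turn (chordOuter l₁ l₂))
        (Sum.inl d) (Sum.inl d') := by
    rintro d d' ⟨_ | f, h⟩
    · rw [Option.elim_none, hout] at h
      have h := List.cycNext_append_comm h
      rw [List.append_assoc] at h
      -- In the circuit `l ++ (l₂ ++ l₁)` the passage from `l` to `l₂ ++ l₁` is the corner at `q`,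
      -- and the wrap-around is the corner at `p`.
      rcases h with h | ⟨h1, h2⟩
      · rcases List.adj_append.1 h with h | h | ⟨h1, h2⟩
        · exact .single ⟨some none, Or.inl (List.adj_append.2 (Or.inl (h.map Sum.inl)))⟩
        · exact .single ⟨none, cycNext_chordOuter
            (Or.inl (List.adj_append.2 (Or.inl (h.map Sum.inl))))⟩
        · exact .tail (.single (hin' d h1)) (hnext d' h2)
      · rw [List.getLast?_append_of_ne_nil _ hmne] at h1
        rw [List.head?_append_of_ne_nil _ hlne] at h2
        exact .tail (.single (hin d h1)) (hnext' d' h2)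
    · exact .single ⟨some (some f), h.map Sum.inl⟩
  have hlast : ∀ m : List D.E, m ≠ [] → ∃ z, m.getLast? = some z := by
    intro m hm
    rw [← Option.ne_none_iff_exists', Ne, List.getLast?_eq_none_iff]
    exact hm
  have hhead : ∀ m : List D.E, m ≠ [] → ∃ z, m.head? = some z := by
    intro m hm
    rw [← Option.ne_none_iff_exists', Ne, List.head?_eq_none_iff]
    exact hm
  rcases e with d | b <;> rcases e' with d' | b'
  · exact D.reflTransGen_turn_map hstep he
  · cases b'
    · obtain ⟨z, hz⟩ := hlast l hlne
      have hd : D.src d = q := he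
      refine .tail (D.reflTransGen_turn_map hstep (e' := D.inv z) ?_) (hin' _ ?_)
      · rw [hd, OneComplex.src_inv, tgt_eq_of_getLast? hl hz]
      · rw [D.inv_inv, hz]
    · obtain ⟨z, hz⟩ := hlast _ hmne
      have hd : D.src d = p := he
      refine .tail (D.reflTransGen_turn_map hstep (e' := D.inv z) ?_) (hin _ ?_)
      · rw [hd, OneComplex.src_inv, tgt_eq_of_getLast? hpath hz]
      · rw [D.inv_inv, hz]
  · cases b
    · obtain ⟨z, hz⟩ := hhead _ hmne
      have hd : q = D.src d' := he
      refine .head (hnext z hz) (D.reflTransGen_turn_map hstep ?_)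
      rw [← hd, src_eq_of_head? hpath hz]
    · obtain ⟨z, hz⟩ := hhead l hlne
      have hd : p = D.src d' := he
      refine .head (hnext' z hz) (D.reflTransGen_turn_map hstep ?_)
      rw [← hd, src_eq_of_head? hl hz]
  · cases b <;> cases b'
    · exact .refl
    · exact absurd he.symm hpq
    · exact absurd he hpq
    · exact .refl

/-- Addition to a van Kampen diagram of an edge labeled `a` across the outer face, cutting off a
new 2-cell. -/
def addChord (hpq : p ≠ q) (hout : D.outer = l₁ ++ (l ++ l₂)) (hp : D.IsPath D.base l₁ p)
    (a : A) (hR : l.map D.label ++ [a⁻¹] ∈ R)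
    (hx : x' = l₁.map D.label ++ a :: l₂.map D.label) : VanKampenDiagram R x' where
  toTwoComplex := D.toTwoComplex.addChord hl
  finite_V := D.finite_V
  finite_E := have := D.finite_E; inferInstanceAs (Finite (D.E ⊕ Bool))
  finite_F := have := D.finite_F; inferInstanceAs (Finite (Option D.F))
  label := Sum.elim D.label fun b => bif b then a else a⁻¹
  label_inv := by
    rintro (e | _ | _)
    · exact D.label_inv e
    · exact (inv_inv a).symm
    · rfl
  label_bdry := by
    rintro (_ | f)
    · simpa [Function.comp_def] using hR
    · simpa [Function.comp_def] using D.label_bdry f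
  base := D.base
  outer := chordOuter l₁ l₂
  outer_closed := by
    refine (OneComplex.isPath_addEdge p q hp).append ⟨rfl, OneComplex.isPath_addEdge p q ?_⟩
    have h := D.isPath_of_outer_eq hout hp
    rw [OneComplex.isPath_append] at h
    obtain ⟨r, h1, h2⟩ := h
    rwa [h1.unique hl] at h2
  label_outer := by
    simp [chordOuter, hx]
  connected r := by
    obtain ⟨m, hm⟩ := D.connected r
    exact ⟨_, OneComplex.isPath_addEdge p q hm⟩
  face_unique := D.chord_face_unique hl hout
  link_connected e e' he :=
    Relation.ReflTransGen.mono (fun _ _ ⟨o, h⟩ => ⟨o, List.cycNext_iff_exists_fin.2 h⟩) _ _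
      (D.chord_reflTransGen hl hpq hout hp e e' he)
  euler := by
    have := D.finite_E
    have := D.finite_F
    have h := D.euler
    simp only [Finite.card_option, Nat.card_sum, Nat.card_eq_fintype_card (α := Bool),
      Fintype.card_bool]
    omega

end Chord

/-- The one-point diagram. -/
def point (R : Set (List A)) : VanKampenDiagram R ([] : List A) where
  V := PUnit
  E := PEmpty
  src := PEmpty.elim
  inv := PEmpty.elim
  inv_inv e := e.elim
  inv_ne e := e.elim
  F := PEmpty
  bdry := PEmpty.elim
  bdry_ne_nil f := f.elim
  bdry_closed f := f.elim
  finite_V := inferInstanceAs (Finite PUnit)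
  finite_E := inferInstanceAs (Finite PEmpty)
  finite_F := inferInstanceAs (Finite PEmpty)
  label := PEmpty.elim
  label_inv e := e.elim
  label_bdry f := f.elim
  base := PUnit.unit
  outer := []
  outer_closed := rfl
  label_outer := rfl
  connected _ := ⟨[], rfl⟩
  face_unique := by
    refine ⟨?_, fun e => e.elim⟩
    rintro ⟨_ | f, i⟩
    · exact i.elim0
    · exact f.elim
  link_connected e := e.elim
  euler := by simp

end VanKampenDiagram

/-! ### Extension of cellular maps, and bounds along contractions -/

namespace TwoComplex

variable {Y : TwoComplex.{u, v, w}} {Y' : TwoComplex.{u', v', w'}}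

namespace Hom

variable (π : Hom Y Y')

/-- Extension of a combinatorial map over a pendant edge. -/
def extendPendant {p : Y.V} (ε : Y'.E) (hε : Y'.src ε = π.vmap p) : Hom (Y.addPendant p) Y' where
  vmap q := q.elim (Y'.tgt ε) π.vmap
  emap := Sum.elim π.emap fun b => bif b then ε else Y'.inv ε
  fmap := π.fmap
  src_emap := by
    rintro (e | _ | _)
    · exact π.src_emap e
    · rfl
    · exact hε
  inv_emap := by
    rintro (e | _ | _)
    · exact π.inv_emap e
    · exact Y'.inv_inv ε
    · rfl
  bdry_fmap f := by simp [π.bdry_fmap]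

theorem extendPendant_map {p : Y.V} (ε : Y'.E) (hε : Y'.src ε = π.vmap p) (x : Y.Realization) :
    (π.extendPendant ε hε).map ((Y.pendantHom p).map x) = π.map x := by
  revert x
  exact realization_ind (fun _ => rfl) (fun _ _ => rfl) (fun _ _ => rfl)

/-- Extension of a combinatorial map over a chord. -/
def extendChord {p q : Y.V} {l : List Y.E} (h : Y.IsPath p l q) (ε : Y'.E) (φ : Y'.F)
    (hε : Y'.src ε = π.vmap p) (hε' : Y'.tgt ε = π.vmap q)
    (hφ : Y'.bdry φ = l.map π.emap ++ [Y'.inv ε]) : Hom (Y.addChord h) Y' where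
  vmap := π.vmap
  emap := Sum.elim π.emap fun b => bif b then ε else Y'.inv ε
  fmap f := f.elim φ π.fmap
  src_emap := by
    rintro (e | _ | _)
    · exact π.src_emap e
    · exact hε'
    · exact hε
  inv_emap := by
    rintro (e | _ | _)
    · exact π.inv_emap e
    · exact Y'.inv_inv ε
    · rfl
  bdry_fmap := by
    rintro (_ | f)
    · simp [hφ]
    · simp [π.bdry_fmap]

theorem extendChord_map {p q : Y.V} {l : List Y.E} (h : Y.IsPath p l q) (ε : Y'.E) (φ : Y'.F)
    (hε : Y'.src ε = π.vmap p) (hε' : Y'.tgt ε = π.vmap q)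
    (hφ : Y'.bdry φ = l.map π.emap ++ [Y'.inv ε]) (x : Y.Realization) :
    (π.extendChord h ε φ hε hε' hφ).map ((chordHom h).map x) = π.map x := by
  revert x
  exact realization_ind (fun _ => rfl) (fun _ _ => rfl) (fun _ _ => rfl)

end Hom

namespace Expansion

variable {j : Hom Y Y'} (X : Expansion j) {y : Y.V} (Ψ : Y.Contraction y)

/-- A track consists of the included old track of `r q`, where inclusion does not increase coarse
distance, and the track of `q` under `H`. -/
theorem coarse_contraction_le (hy : ∀ p, ∃ l, Y.IsPath y l p) {q : Y'.Realization} {b : ℕ}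
    (h1 : ∀ s, Y.coarseDist4 y (Ψ (s, X.r q)) ≤ b)
    (h2 : ∀ s, Y'.coarseDist4 (j.vmap y) (X.H (s, q)) ≤ b) (s : I) :
    Y'.coarseDist4 (j.vmap y) (X.contraction Ψ (s, q)) ≤ b := by
  obtain ⟨s', hs⟩ | ⟨s', hs⟩ := X.contraction_track Ψ q s
  · rw [hs]
    exact (Hom.coarseDist4_map_le hy _).trans (h1 s')
  · rw [hs]
    exact h2 s'

theorem coarse_contraction_map_le (hy : ∀ p, ∃ l, Y.IsPath y l p) {x : Y.Realization} {b : ℕ}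
    (h : ∀ s, Y.coarseDist4 y (Ψ (s, x)) ≤ b) (s : I) :
    Y'.coarseDist4 (j.vmap y) (X.contraction Ψ (s, j.map x)) ≤ b := by
  obtain ⟨s', hs⟩ := X.contraction_map Ψ x s
  rw [hs]
  exact (Hom.coarseDist4_map_le hy _).trans (h s')

/-- Tameness is preserved by an expansion if all the tracks that end in new cells are bounded
by `b`, and `f` is at least `b` on all new cells. -/
theorem tame_contraction (hy : ∀ p, ∃ l, Y.IsPath y l p) {c : Y.Realization → ℕ}
    {c' : Y'.Realization → ℕ} (hc : ∀ x, c' (j.map x) = c x) {f : ℕ → ℕ}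
    (htame : ∀ p s t, s ≤ t → Y.coarseDist4 y (Ψ (s, p)) ≤ f (c (Ψ (t, p)))) {b : ℕ}
    (hb : ∀ q, (∃ x, q = j.map x) ∨
      ∀ s, Y'.coarseDist4 (j.vmap y) (X.contraction Ψ (s, q)) ≤ b)
    (hnew : ∀ q ∈ X.new, b ≤ f (c' q)) (q : Y'.Realization) (s t : I) (hst : s ≤ t) :
    Y'.coarseDist4 (j.vmap y) (X.contraction Ψ (s, q)) ≤ f (c' (X.contraction Ψ (t, q))) := by
  obtain ⟨s', t', hst', hs, ht⟩ | ht := X.contraction_cases Ψ q hst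
  · rw [hs, ht, hc]
    exact (Hom.coarseDist4_map_le hy _).trans (htame _ _ _ hst')
  · rcases hb q with ⟨x, rfl⟩ | hq
    -- The track of an old point stays in the old complex and never meets `new`.
    · obtain ⟨t', ht'⟩ := X.contraction_map Ψ x t
      rw [ht'] at ht
      exact absurd ht (X.map_not_new _)
    · exact (hq s).trans (hnew _ ht)

theorem contraction_vertex_mem (h : ∀ p t, Ψ (t, Y.vertexPt p) ∈ Y.oneSkeleton)
    (hr : ∀ p, ∃ p', X.r (Y'.vertexPt p) = Y.vertexPt p') (p : Y'.V) (t : I) :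
    X.contraction Ψ (t, Y'.vertexPt p) ∈ Y'.oneSkeleton := by
  obtain ⟨s, hs⟩ | ⟨s, hs⟩ := X.contraction_track Ψ (Y'.vertexPt p) t
  · obtain ⟨p', hp'⟩ := hr p
    rw [hs, hp']
    rcases h p' s with ⟨z, hz⟩ | ⟨e, x, hx⟩
    · rw [← hz]
      exact vertexPt_mem_oneSkeleton _
    · rw [hx]
      exact edgePt_mem_oneSkeleton _ _
  · rw [hs]
    exact X.vertex_mem p s

theorem contraction_base (h : ∀ t, Ψ (t, Y.vertexPt y) = Y.vertexPt y) (t : I) :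
    X.contraction Ψ (t, Y'.vertexPt (j.vmap y)) = Y'.vertexPt (j.vmap y) := by
  obtain ⟨s, hs⟩ := X.contraction_map Ψ (Y.vertexPt y) t
  rw [h] at hs
  exact hs

end Expansion

section

variable {y : Y.V} (Ψ : Y.Contraction y) (hy : ∀ p, ∃ l, Y.IsPath y l p)
include hy

/-- The constant 4 is one edge length in quarter units: the free end is at most one edge further
away than `p`. -/
theorem pendant_coarse_le {p : Y.V} {b : ℕ}
    (hb : ∀ s, Y.coarseDist4 y (Ψ (s, Y.vertexPt p)) + 4 ≤ b) {q : (Y.addPendant p).Realization}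
    (hr : (Y.pendantExpansion p).r q = Y.vertexPt p)
    (hH : ∀ s, ∃ t, (Y.pendantExpansion p).H (s, q) = (Y.addPendant p).edgePt (Sum.inr true) t)
    (s : I) :
    (Y.addPendant p).coarseDist4 (some y) ((Y.pendantExpansion p).contraction Ψ (s, q)) ≤ b := by
  refine (Y.pendantExpansion p).coarse_contraction_le Ψ hy (fun s => ?_) (fun s => ?_) s
  · rw [hr]
    exact (Nat.le_add_right _ 4).trans (hb s)
  · obtain ⟨t, ht⟩ := hH s
    rw [ht]
    have h1 := hb 1
    have h2 : Ψ (1, Y.vertexPt p) = Y.vertexPt p := by simp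
    rw [h2, coarseDist4_vertexPt] at h1
    have h3 : (Y.addPendant p).vdist (some y) (some p) ≤ Y.vdist y p :=
      Hom.vdist_vmap_le (j := Y.pendantHom p) hy p
    have h4 : (Y.addPendant p).vdist (some y) none ≤
        (Y.addPendant p).vdist (some y) (some p) + 1 := by
      refine OneComplex.vdist_tgt_le (Y := (Y.addPendant p).toOneComplex) (e := Sum.inr true) ?_
      obtain ⟨l, hl⟩ := hy p
      exact ⟨_, (Y.pendantHom p).isPath_map hl⟩
    refine coarseDist4_edgePt_le ?_ ?_ ?_ t
    · change 4 * (Y.addPendant p).vdist (some y) (some p) ≤ b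
      omega
    · change 4 * (Y.addPendant p).vdist (some y) none ≤ b
      omega
    · change 4 * min ((Y.addPendant p).vdist (some y) (some p))
        ((Y.addPendant p).vdist (some y) none) + 2 ≤ b
      omega

theorem pendant_coarse_vertexPt_le {p : Y.V} {b : ℕ}
    (hb : ∀ s, Y.coarseDist4 y (Ψ (s, Y.vertexPt p)) + 4 ≤ b) (s : I) :
    (Y.addPendant p).coarseDist4 (some y)
      ((Y.pendantExpansion p).contraction Ψ (s, (Y.addPendant p).vertexPt none)) ≤ b :=
  pendant_coarse_le Ψ hy hb rfl (fun t => ⟨t, rfl⟩) s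

theorem pendant_coarse_edgePt_le {p : Y.V} {b : ℕ}
    (hb : ∀ s, Y.coarseDist4 y (Ψ (s, Y.vertexPt p)) + 4 ≤ b) (i : Bool) (x s : I) :
    (Y.addPendant p).coarseDist4 (some y)
      ((Y.pendantExpansion p).contraction Ψ (s, (Y.addPendant p).edgePt (Sum.inr i) x)) ≤ b := by
  refine pendant_coarse_le Ψ hy hb rfl (fun t => ?_) s
  cases i
  · exact ⟨_, rfl⟩
  · exact ⟨_, rfl⟩

/-- The constant 2 is half an edge length. All vertices of the new closed 2-cell already lie on `l`,
and an edge has coarse distance at most half a unit more than its nearer end. -/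
theorem chord_coarse_le {p q : Y.V} {l : List Y.E} (h : Y.IsPath p l q) (hl : 0 < l.length)
    {b : ℕ} (hb : ∀ d ∈ l, ∀ x s, Y.coarseDist4 y (Ψ (s, Y.edgePt d x)) + 2 ≤ b)
    {z : (Y.addChord h).Realization}
    (hr : ∃ x : ℝ, 0 ≤ x ∧ x ≤ l.length ∧ (chordExpansion h hl).r z = pathMap p l x)
    (hH : ∀ s, ∃ x, (chordExpansion h hl).H (s, z) = (Y.addChord h).facePt none x) (s : I) :
    (Y.addChord h).coarseDist4 y ((chordExpansion h hl).contraction Ψ (s, z)) ≤ b := by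
  refine (chordExpansion h hl).coarse_contraction_le Ψ hy (fun s => ?_) (fun s => ?_) s
  · obtain ⟨x, h0, h1, hx⟩ := hr
    obtain ⟨d, hd, t, ht⟩ := exists_pathMap_eq h hl h0 h1
    rw [hx, ht]
    exact (Nat.le_add_right _ 2).trans (hb d hd t s)
  · obtain ⟨x, hx⟩ := hH s
    rw [hx]
    change (Y.addChord h).coarseDist4 y ((Y.addChord h).facePt none x) ≤ b
    have hv : ∀ v, (Y.addChord h).vdist y v ≤ Y.vdist y v :=
      Hom.vdist_vmap_le (j := chordHom h) hy
    have hone : ∀ x, Ψ (1, x) = x := fun x => by simp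
    have hs : ∀ d ∈ l, 4 * (Y.addChord h).vdist y (Y.src d) + 2 ≤ b := by
      intro d hd
      have h1 := hb d hd 0 1
      rw [hone, edgePt_zero, coarseDist4_vertexPt] at h1
      have := hv (Y.src d)
      omega
    have ht : ∀ d ∈ l, 4 * (Y.addChord h).vdist y (Y.tgt d) + 2 ≤ b := by
      intro d hd
      have h1 := hb d hd 1 1
      rw [hone, edgePt_one, coarseDist4_vertexPt] at h1
      have := hv (Y.tgt d)
      omega
    refine coarseDist4_facePt_le ?_ x
    intro e he
    have key : 4 * (Y.addChord h).vdist y ((Y.addChord h).src e) + 2 ≤ b ∧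
        4 * (Y.addChord h).vdist y ((Y.addChord h).tgt e) + 2 ≤ b := by
      rcases List.mem_append.1 he with he | he
      · obtain ⟨d, hd, rfl⟩ := List.mem_map.1 he
        exact ⟨hs d hd, ht d hd⟩
      · obtain rfl := List.mem_singleton.1 he
        -- The side of the 2-cell not in `l` runs from `q`, the end of the last edge of `l`, to `p`,
        -- the start of the first.
        constructor
        · have := ht _ (List.getElem_mem (Nat.sub_lt hl one_pos))
          rwa [Y.tgt_last_of_isPath h (Nat.sub_lt hl one_pos)] at this
        · have := hs _ (List.getElem_mem hl)
          rwa [Y.src_head_of_isPath h hl] at this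
    refine ⟨by omega, by omega, ?_⟩
    rw [edgeDist4]
    omega

theorem chord_coarse_edgePt_le {p q : Y.V} {l : List Y.E} (h : Y.IsPath p l q)
    (hl : 0 < l.length) {b : ℕ}
    (hb : ∀ d ∈ l, ∀ x s, Y.coarseDist4 y (Ψ (s, Y.edgePt d x)) + 2 ≤ b) (i : Bool) (x s : I) :
    (Y.addChord h).coarseDist4 y ((chordExpansion h hl).contraction Ψ
      (s, (Y.addChord h).edgePt (Sum.inr i) x)) ≤ b :=
  chord_coarse_le Ψ hy h hl hb ⟨_, arcCoord_nonneg hl _, arcCoord_le hl _, rfl⟩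
    (fun _ => ⟨_, rfl⟩) s

theorem chord_coarse_facePt_le {p q : Y.V} {l : List Y.E} (h : Y.IsPath p l q)
    (hl : 0 < l.length) {b : ℕ}
    (hb : ∀ d ∈ l, ∀ x s, Y.coarseDist4 y (Ψ (s, Y.edgePt d x)) + 2 ≤ b) (x : Disk) (s : I) :
    (Y.addChord h).coarseDist4 y ((chordExpansion h hl).contraction Ψ
      (s, (Y.addChord h).facePt none x)) ≤ b :=
  chord_coarse_le Ψ hy h hl hb ⟨_, arcCoord_nonneg hl _, arcCoord_le hl _, rfl⟩
    (fun _ => ⟨_, rfl⟩) s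

end

end TwoComplex

/-! ### Diagrams with a tame contraction -/

namespace TwoComplex

variable {X : TwoComplex.{u, v, w}} {A : Type u'} [InvolutiveInv A]

theorem coarseDist4_self (p : X.V) : X.coarseDist4 p (X.vertexPt p) = 0 := by
  simp [OneComplex.vdist]

/-- A van Kampen diagram with a combinatorial map to the labeled complex `X` that maps its
boundary to the closed path `l`, and with a contraction that is tame with respect to `f`; the
functions `depth` and `M` bound the tracks that end at vertices and at boundary edges. -/
structure TameDiagram (X : TwoComplex.{u, v, w}) (x₀ : X.V) (lab : X.E → A) (R : Set (List A))
    (depth : X.V → ℕ) (M : X.E → ℕ) (f : ℕ → ℕ) (l : List X.E) where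
  D : VanKampenDiagram R (l.map lab)
  π : Hom D.toTwoComplex X
  π_base : π.vmap D.base = x₀
  lab_emap : ∀ e, lab (π.emap e) = D.label e
  outer_map : D.outer.map π.emap = l
  outer_nil : D.outer = [] → IsEmpty D.E
  Ψ : D.Contraction D.base
  vertex_mem : ∀ p t, Ψ (t, D.vertexPt p) ∈ D.oneSkeleton
  base_fixed : ∀ t, Ψ (t, D.vertexPt D.base) = D.vertexPt D.base
  tame : ∀ p s t, s ≤ t → D.coarseDist4 D.base (Ψ (s, p)) ≤
    f (X.coarseDist4 x₀ (π.map (Ψ (t, p))))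
  outer_bound : ∀ d ∈ D.outer, ∀ x s,
    D.coarseDist4 D.base (Ψ (s, D.edgePt d x)) ≤ M (π.emap d)
  vertex_bound : ∀ p s, D.coarseDist4 D.base (Ψ (s, D.vertexPt p)) ≤ 4 * depth (π.vmap p)

namespace TameDiagram

variable {x₀ : X.V} {lab : X.E → A} {R : Set (List A)} {depth : X.V → ℕ} {M : X.E → ℕ}
  {f : ℕ → ℕ} {l l₁ l₂ : List X.E}

theorem point_eq (x : (VanKampenDiagram.point R).Realization) :
    x = (VanKampenDiagram.point R).vertexPt (VanKampenDiagram.point R).base := by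
  revert x
  exact realization_ind (fun _ => rfl) (fun e => PEmpty.elim e) (fun e => PEmpty.elim e)

theorem coarseDist4_point (x : (VanKampenDiagram.point R).Realization) :
    (VanKampenDiagram.point R).coarseDist4 (VanKampenDiagram.point R).base x = 0 := by
  rw [point_eq x, coarseDist4_self]

/-- The one-point diagram. -/
def point (x₀ : X.V) (lab : X.E → A) (R : Set (List A)) (depth : X.V → ℕ) (M : X.E → ℕ)
    (f : ℕ → ℕ) : TameDiagram X x₀ lab R depth M f [] where
  D := VanKampenDiagram.point R
  π :=
    { vmap := fun _ => x₀
      emap := PEmpty.elim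
      fmap := PEmpty.elim
      src_emap := fun e => PEmpty.elim e
      inv_emap := fun e => PEmpty.elim e
      bdry_fmap := fun f => PEmpty.elim f }
  π_base := rfl
  lab_emap e := PEmpty.elim e
  outer_map := rfl
  outer_nil _ := inferInstanceAs (IsEmpty PEmpty)
  Ψ :=
    { toFun := fun z => z.2
      map_zero_left := fun x => point_eq x
      map_one_left := fun x => rfl }
  vertex_mem p t := vertexPt_mem_oneSkeleton p
  base_fixed t := rfl
  tame p s t _ := (coarseDist4_point _).trans_le (Nat.zero_le _)
  outer_bound d := PEmpty.elim d
  vertex_bound p s := (coarseDist4_point _).trans_le (Nat.zero_le _)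

theorem isPath_split (Z : TameDiagram X x₀ lab R depth M f l) {o₁ o₂ : List Z.D.E}
    (ho : Z.D.outer = o₁ ++ o₂) {g : X.V}
    (hg : X.IsPath x₀ (o₁.map Z.π.emap) g) :
    ∃ p, Z.D.IsPath Z.D.base o₁ p ∧ Z.D.IsPath p o₂ Z.D.base ∧ Z.π.vmap p = g := by
  have h := Z.D.outer_closed
  rw [ho, OneComplex.isPath_append] at h
  obtain ⟨p, h1, h2⟩ := h
  refine ⟨p, h1, h2, ?_⟩
  have h3 := Z.π.isPath_map h1
  rw [Z.π_base] at h3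
  exact h3.unique hg

theorem label_map (Z : TameDiagram X x₀ lab R depth M f l) (o : List Z.D.E) :
    o.map Z.D.label = (o.map Z.π.emap).map lab := by
  rw [List.map_map]
  exact List.map_congr_left fun e _ => (Z.lab_emap e).symm

/-- Since `e` leads away from the root, the track bound `4 * depth` at its start leaves room for the
4 lost along the pendant edge, and the new end again satisfies the depth bound. The images of the
new cells have coarse distance at least that of the nearer end of `e`, which is where `hMf` applies.
-/
theorem nonempty_pendant (hlab : ∀ e, lab (X.inv e) = (lab e)⁻¹) {e : X.E}
    (hM4 : 4 * depth (X.tgt e) ≤ M e)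
    (hM4' : 4 * depth (X.tgt e) ≤ M (X.inv e))
    (hMf : ∀ n, 4 * min (X.vdist x₀ (X.src e))
      (X.vdist x₀ (X.tgt e)) ≤ n → M e ≤ f n)
    (hdepth : depth (X.src e) + 1 ≤ depth (X.tgt e))
    (hg : X.IsPath x₀ l₁ (X.src e)) (Z : TameDiagram X x₀ lab R depth M f (l₁ ++ l₂)) :
    Nonempty (TameDiagram X x₀ lab R depth M f (l₁ ++ e :: X.inv e :: l₂)) := by
  obtain ⟨o₁, o₂, ho, hl₁, hl₂⟩ := List.map_eq_append_iff.1 Z.outer_map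
  obtain ⟨p, h1, h2, hp⟩ := Z.isPath_split ho (by rwa [hl₁])
  have hy : ∀ q, ∃ l, Z.D.IsPath Z.D.base l q := Z.D.connected
  have hb : ∀ s, Z.D.coarseDist4 Z.D.base (Z.Ψ (s, Z.D.vertexPt p)) + 4 ≤
      4 * depth (X.tgt e) := by
    intro s
    have := Z.vertex_bound p s
    rw [hp] at this
    omega
  let Y := Z.D.toTwoComplex
  let E := Y.pendantExpansion p
  let π' := Z.π.extendPendant (p := p) e hp.symm
  have hbd : ∀ q : (Y.addPendant p).Realization, (∃ x, q = (Y.pendantHom p).map x) ∨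
      ∀ s, (Y.addPendant p).coarseDist4 (some Z.D.base) (E.contraction Z.Ψ (s, q)) ≤ M e := by
    refine realization_ind ?_ ?_ ?_
    · rintro (_ | q)
      · exact Or.inr fun s => (pendant_coarse_vertexPt_le Z.Ψ hy hb s).trans hM4
      · exact Or.inl ⟨Y.vertexPt q, rfl⟩
    · rintro (d | i) x
      · exact Or.inl ⟨Y.edgePt d x, rfl⟩
      · exact Or.inr fun s => (pendant_coarse_edgePt_le Z.Ψ hy hb i x s).trans hM4
    · exact fun F z => Or.inl ⟨Y.facePt F z, rfl⟩
  have hnew : ∀ q ∈ E.new, M e ≤ f (X.coarseDist4 x₀ (π'.map q)) := by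
    intro q hq
    refine hMf _ ?_
    obtain ⟨v, rfl⟩ | ⟨d, t, h0, h1, rfl⟩ | ⟨F, z, hz, rfl⟩ := realization_cases q
    · rcases v with _ | v
      · change _ ≤ 4 * X.vdist x₀ (X.tgt e)
        omega
      · exact absurd hq (E.map_not_new (Y.vertexPt v))
    · rcases d with d | _ | _
      · exact absurd hq (E.map_not_new (Y.edgePt d t))
      · rw [Hom.map_edgePt, coarseDist4_edgePt _ _ h0 h1]
        change _ ≤ X.edgeDist4 x₀ (X.inv e)
        rw [edgeDist4_inv]
        exact Nat.le_add_right _ 2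
      · rw [Hom.map_edgePt, coarseDist4_edgePt _ _ h0 h1]
        exact Nat.le_add_right _ 2
    · exact absurd hq (E.map_not_new (Y.facePt F z))
  refine ⟨
    { D := VanKampenDiagram.addPendant Z.D ho h1 Z.outer_nil (lab e) (by
        rw [Z.label_map, Z.label_map, hl₁, hl₂, List.map_append, List.map_cons, List.map_cons,
          hlab])
      π := π'
      π_base := Z.π_base
      lab_emap := ?_
      outer_map := ?_
      outer_nil := fun h => absurd h (by simp [VanKampenDiagram.addPendant,
        VanKampenDiagram.pendantOuter])
      Ψ := E.contraction Z.Ψ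
      vertex_mem := ?_
      base_fixed := E.contraction_base Z.Ψ Z.base_fixed
      tame := E.tame_contraction (c := fun x => X.coarseDist4 x₀ (Z.π.map x))
        (c' := fun x => X.coarseDist4 x₀ (π'.map x)) Z.Ψ hy
        (fun x => congrArg (X.coarseDist4 x₀) (Z.π.extendPendant_map (p := p) e hp.symm x))
        Z.tame hbd hnew
      outer_bound := ?_
      vertex_bound := ?_ }⟩
  · rintro (d | _ | _)
    · exact Z.lab_emap d
    · exact hlab e
    · rfl
  · have h : List.map π'.emap (VanKampenDiagram.pendantOuter o₁ o₂) =
        o₁.map Z.π.emap ++ e :: X.inv e :: o₂.map Z.π.emap := by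
      simp only [VanKampenDiagram.pendantOuter, List.map_append, List.map_cons, List.map_map]
      rfl
    exact h.trans (by rw [hl₁, hl₂])
  · refine E.contraction_vertex_mem Z.Ψ Z.vertex_mem ?_
    rintro (_ | q)
    · exact ⟨p, rfl⟩
    · exact ⟨q, rfl⟩
  · rintro (d | _ | _) hd x s
    · have hd' : d ∈ Z.D.outer := by
        rw [ho]
        exact VanKampenDiagram.inl_mem_pendantOuter.1 hd
      exact E.coarse_contraction_map_le Z.Ψ hy (Z.outer_bound d hd' x) s
    · exact (pendant_coarse_edgePt_le Z.Ψ hy hb false x s).trans hM4'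
    · exact (pendant_coarse_edgePt_le Z.Ψ hy hb true x s).trans hM4
  · rintro (_ | q) s
    · exact pendant_coarse_vertexPt_le Z.Ψ hy hb s
    · exact E.coarse_contraction_map_le Z.Ψ hy (Z.vertex_bound q) s

/-- Here `l` plays the role of Φ(e). Points of the new cells are combed through old tracks ending on
`l`, bounded by some `M e'`, and then across the new 2-cell; this adds at most 2, which `hM`
absorbs. -/
theorem nonempty_chord (hlab : ∀ e, lab (X.inv e) = (lab e)⁻¹) {e : X.E} {φ : X.F}
    (hφ : X.bdry φ = l ++ [X.inv e])
    (hne' : X.src e ≠ X.tgt e) (hM : ∀ e' ∈ l, M e' + 2 ≤ M e)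
    (hMf : ∀ n, 4 * min (X.vdist x₀ (X.src e))
      (X.vdist x₀ (X.tgt e)) ≤ n → M e ≤ f n)
    (hR : l.map lab ++ [(lab e)⁻¹] ∈ R)
    (hl : X.IsPath (X.src e) l (X.tgt e))
    (hg : X.IsPath x₀ l₁ (X.src e)) (Z : TameDiagram X x₀ lab R depth M f (l₁ ++ (l ++ l₂))) :
    Nonempty (TameDiagram X x₀ lab R depth M f (l₁ ++ e :: l₂)) := by
  obtain ⟨o₁, o', ho, hl₁, ho'⟩ := List.map_eq_append_iff.1 Z.outer_map
  obtain ⟨o, o₂, rfl, hlo, hl₂⟩ := List.map_eq_append_iff.1 ho'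
  obtain ⟨p, h1, h2, hp⟩ := Z.isPath_split ho (by rwa [hl₁])
  obtain ⟨q, h3, h4, hq⟩ := Z.isPath_split (o₁ := o₁ ++ o) (o₂ := o₂)
    (by rw [ho, List.append_assoc]) (by rw [List.map_append, hl₁, hlo]; exact hg.append hl)
  rw [OneComplex.isPath_append] at h3
  obtain ⟨p', h5, h6⟩ := h3
  obtain rfl := h5.unique h1
  have hne : p' ≠ q := by
    rintro rfl
    rw [hp] at hq
    exact hne' hq
  have hlen : 0 < o.length := by
    rw [List.length_pos_iff]
    rintro rfl
    exact hne h6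
  have hy : ∀ q, ∃ l, Z.D.IsPath Z.D.base l q := Z.D.connected
  have hmem : ∀ d ∈ o, d ∈ Z.D.outer := by
    intro d hd
    rw [ho]
    simp [hd]
  have hb : ∀ d ∈ o, ∀ x s,
      Z.D.coarseDist4 Z.D.base (Z.Ψ (s, Z.D.edgePt d x)) + 2 ≤ M e := by
    intro d hd x s
    exact (Nat.add_le_add_right (Z.outer_bound d (hmem d hd) x s) 2).trans
      (hM _ (hlo.subst (motive := fun m => Z.π.emap d ∈ m) (List.mem_map_of_mem hd)))
  let Y := Z.D.toTwoComplex
  let E := chordExpansion h6 hlen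
  have hφ' : X.bdry φ = o.map Z.π.emap ++ [X.inv e] := by
    rw [hlo]
    exact hφ
  let π' := Z.π.extendChord h6 e φ hp.symm hq.symm hφ'
  have hbd : ∀ q : (Y.addChord h6).Realization, (∃ x, q = (chordHom h6).map x) ∨
      ∀ s, (Y.addChord h6).coarseDist4 Z.D.base (E.contraction Z.Ψ (s, q)) ≤ M e := by
    refine realization_ind ?_ ?_ ?_
    · exact fun q => Or.inl ⟨Y.vertexPt q, rfl⟩
    · rintro (d | i) x
      · exact Or.inl ⟨Y.edgePt d x, rfl⟩
      · exact Or.inr fun s => chord_coarse_edgePt_le Z.Ψ hy h6 hlen hb i x s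
    · rintro (_ | F) z
      · exact Or.inr fun s => chord_coarse_facePt_le Z.Ψ hy h6 hlen hb z s
      · exact Or.inl ⟨Y.facePt F z, rfl⟩
  have hnew : ∀ q ∈ E.new, M e ≤ f (X.coarseDist4 x₀ (π'.map q)) := by
    intro q hq
    refine hMf _ ?_
    obtain ⟨v, rfl⟩ | ⟨d, t, h0, h1, rfl⟩ | ⟨F, z, hz, rfl⟩ := realization_cases q
    · exact absurd hq (E.map_not_new (Y.vertexPt v))
    · rcases d with d | _ | _
      · exact absurd hq (E.map_not_new (Y.edgePt d t))
      · rw [Hom.map_edgePt, coarseDist4_edgePt _ _ h0 h1]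
        change _ ≤ X.edgeDist4 x₀ (X.inv e)
        rw [edgeDist4_inv]
        exact Nat.le_add_right _ 2
      · rw [Hom.map_edgePt, coarseDist4_edgePt _ _ h0 h1]
        exact Nat.le_add_right _ 2
    · rcases F with _ | F
      · rw [Hom.map_facePt, coarseDist4_facePt _ _ hz]
        change _ ≤ X.faceDist4 x₀ φ
        have hmem : X.edgeDist4 x₀ (X.inv e) ∈
            (X.bdry φ).map (X.edgeDist4 x₀) := by
          rw [hφ]
          simp
        have h := List.le_foldr_max hmem
        rw [edgeDist4_inv] at h
        -- The `+ 2` in the edge term outweighs the `- 1` in `faceDist4`, so the open 2-cell is also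
        -- at least as far as the nearer end of `e`.
        have h' : 4 * min (X.vdist x₀ (X.src e))
          (X.vdist x₀ (X.tgt e)) + 2 ≤ _ := h
        rw [faceDist4]
        omega
      · exact absurd hq (E.map_not_new (Y.facePt F z))
  refine ⟨
    { D := VanKampenDiagram.addChord Z.D h6 hne ho h1 (lab e) (by rwa [Z.label_map, hlo]) (by
        rw [Z.label_map, Z.label_map, hl₁, hl₂, List.map_append, List.map_cons])
      π := π'
      π_base := Z.π_base
      lab_emap := ?_
      outer_map := ?_
      outer_nil := fun h => absurd h (by simp [VanKampenDiagram.addChord,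
        VanKampenDiagram.chordOuter])
      Ψ := E.contraction Z.Ψ
      vertex_mem := ?_
      base_fixed := E.contraction_base Z.Ψ Z.base_fixed
      tame := E.tame_contraction (c := fun x => X.coarseDist4 x₀ (Z.π.map x))
        (c' := fun x => X.coarseDist4 x₀ (π'.map x)) Z.Ψ hy
        (fun x => congrArg (X.coarseDist4 x₀) (Z.π.extendChord_map h6 e φ hp.symm hq.symm hφ' x))
        Z.tame hbd hnew
      outer_bound := ?_
      vertex_bound := fun q s => E.coarse_contraction_map_le Z.Ψ hy (Z.vertex_bound q) s }⟩
  · rintro (d | _ | _)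
    · exact Z.lab_emap d
    · exact hlab e
    · rfl
  · have h : List.map π'.emap (VanKampenDiagram.chordOuter o₁ o₂) =
        o₁.map Z.π.emap ++ e :: o₂.map Z.π.emap := by
      simp only [VanKampenDiagram.chordOuter, List.map_append, List.map_cons, List.map_map]
      rfl
    exact h.trans (by rw [hl₁, hl₂])
  · exact E.contraction_vertex_mem Z.Ψ Z.vertex_mem fun q => ⟨q, rfl⟩
  · rintro (d | i) hd x s
    · have hd' : d ∈ Z.D.outer := by
        rw [ho]
        have := VanKampenDiagram.inl_mem_chordOuter.1 hd
        simp only [List.mem_append] at this ⊢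
        tauto
      exact E.coarse_contraction_map_le Z.Ψ hy (Z.outer_bound d hd' x) s
    · obtain rfl : i = true := VanKampenDiagram.inr_mem_chordOuter.1 hd
      exact chord_coarse_edgePt_le Z.Ψ hy h6 hlen hb true x s

end TameDiagram

end TwoComplex

/-! ### Maximal trees and induction over closed paths -/

namespace OneComplex

variable {Y : OneComplex.{u, v}} {T : Set Y.E}

namespace IsMaximalTree

variable (hT : Y.IsMaximalTree T) (x₀ : Y.V)

/-- The path without backtracking in the tree from the root to a vertex. -/
def treePath (p : Y.V) : List Y.E := (hT.existsUnique_path x₀ p).choose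

theorem treePath_isPath (p : Y.V) : Y.IsPath x₀ (hT.treePath x₀ p) p :=
  (hT.existsUnique_path x₀ p).choose_spec.1.1

theorem mem_of_mem_treePath (p : Y.V) : ∀ e ∈ hT.treePath x₀ p, e ∈ T :=
  (hT.existsUnique_path x₀ p).choose_spec.1.2.1

theorem treePath_isChain (p : Y.V) :
    (hT.treePath x₀ p).IsChain (fun e e' => e' ≠ Y.inv e) :=
  (hT.existsUnique_path x₀ p).choose_spec.1.2.2

theorem treePath_eq {p : Y.V} {l : List Y.E} (h1 : Y.IsPath x₀ l p) (h2 : ∀ e ∈ l, e ∈ T)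
    (h3 : l.IsChain (fun e e' => e' ≠ Y.inv e)) : hT.treePath x₀ p = l :=
  ((hT.existsUnique_path x₀ p).choose_spec.2 l ⟨h1, h2, h3⟩).symm

/-- The distance of a vertex from the root in the tree. -/
def depth (p : Y.V) : ℕ := (hT.treePath x₀ p).length

theorem depth_root : hT.depth x₀ x₀ = 0 := by
  rw [depth, hT.treePath_eq x₀ (l := []) rfl (by simp) .nil]
  rfl

/-- Appending `e` to a reduced path gives a reduced path unless the last edge is `inv e`; in that
case deleting the last edge does. -/
theorem treePath_tgt {e : Y.E} (he : e ∈ T) :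
    hT.treePath x₀ (Y.tgt e) = hT.treePath x₀ (Y.src e) ++ [e] ∨
      hT.treePath x₀ (Y.src e) = hT.treePath x₀ (Y.tgt e) ++ [Y.inv e] := by
  have h1 := hT.treePath_isPath x₀ (Y.src e)
  have h2 := hT.mem_of_mem_treePath x₀ (Y.src e)
  have h3 := hT.treePath_isChain x₀ (Y.src e)
  generalize hT.treePath x₀ (Y.src e) = t at h1 h2 h3 ⊢
  by_cases h : t.getLast? = some (Y.inv e)
  · right
    obtain ⟨t, rfl⟩ := List.getLast?_eq_some_iff.1 h
    congr 1
    obtain ⟨r, hr, hr', -⟩ := isPath_append.1 h1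
    obtain rfl : r = Y.tgt e := hr'.symm
    exact (hT.treePath_eq x₀ hr (fun e he => h2 e (by simp [he])) h3.left_of_append).symm
  · left
    refine hT.treePath_eq x₀ (h1.append (l' := [e]) ⟨rfl, rfl⟩) ?_ ?_
    · intro d hd
      rcases List.mem_append.1 hd with hd | hd
      · exact h2 d hd
      · rwa [List.mem_singleton.1 hd]
    · refine List.isChain_append.2 ⟨h3, .singleton e, ?_⟩
      intro x hx y hy hxy
      obtain rfl : e = y := by simpa using hy
      rw [hxy, Y.inv_inv] at h
      exact h hx

theorem depth_tgt {e : Y.E} (he : e ∈ T) :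
    hT.depth x₀ (Y.tgt e) = hT.depth x₀ (Y.src e) + 1 ∨
      hT.depth x₀ (Y.src e) = hT.depth x₀ (Y.tgt e) + 1 := by
  rcases hT.treePath_tgt x₀ he with h | h
  · exact Or.inl (by simp [depth, h])
  · exact Or.inr (by simp [depth, h])

theorem depth_le_add_length {p q : Y.V} {l : List Y.E} (h : Y.IsPath p l q)
    (hl : ∀ e ∈ l, e ∈ T) : hT.depth x₀ q ≤ hT.depth x₀ p + l.length := by
  induction l generalizing p with
  | nil => rw [show p = q from h]; simp
  | cons e l ih =>
    obtain ⟨rfl, h⟩ := h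
    have h1 := ih h fun e he => hl e (by simp [he])
    have h2 := hT.depth_tgt x₀ (hl e (by simp))
    simp only [List.length_cons]
    omega

/-- A vertex has only one tree edge toward the root: the reverse of the last edge of its tree path.
-/
theorem eq_inv_of_depth {e e' : Y.E} (he : e ∈ T) (he' : e' ∈ T) (h : Y.src e' = Y.tgt e)
    (h1 : hT.depth x₀ (Y.tgt e) = hT.depth x₀ (Y.src e) + 1)
    (h2 : hT.depth x₀ (Y.src e') = hT.depth x₀ (Y.tgt e') + 1) : e' = Y.inv e := by
  rcases hT.treePath_tgt x₀ he with h3 | h3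
  · rcases hT.treePath_tgt x₀ he' with h4 | h4
    · simp [depth, h4] at h2
      omega
    · rw [h, h3] at h4
      have := (List.append_inj' h4 rfl).2
      rw [List.singleton_inj.1 this, Y.inv_inv]
  · simp [depth, h3] at h1
    omega

/-- A path that starts by going up and does not end higher than it began must descend. The first
descent directly follows an ascent, and the edge toward the root is unique, so the two are inverse.
-/
theorem exists_backtrack_cons {p q : Y.V} {e : Y.E} {l : List Y.E} (h : Y.IsPath p (e :: l) q)
    (hl : ∀ d ∈ e :: l, d ∈ T) (he : hT.depth x₀ (Y.tgt e) = hT.depth x₀ (Y.src e) + 1)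
    (hq : hT.depth x₀ q ≤ hT.depth x₀ p) :
    ∃ l₁ d l₂, e :: l = l₁ ++ d :: Y.inv d :: l₂ ∧
      hT.depth x₀ (Y.tgt d) = hT.depth x₀ (Y.src d) + 1 := by
  induction l generalizing p e with
  | nil =>
    obtain ⟨rfl, h⟩ := h
    rw [← show Y.tgt e = q from h] at hq
    omega
  | cons e' l ih =>
    obtain ⟨rfl, h⟩ := h
    have he' : Y.src e' = Y.tgt e := h.1
    rcases hT.depth_tgt x₀ (hl e' (by simp)) with h1 | h1
    · obtain ⟨l₁, d, l₂, h2, h3⟩ :=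
        ih h (fun d hd => hl d (List.mem_cons_of_mem _ hd)) h1 (by omega)
      exact ⟨e :: l₁, d, l₂, by simp [h2], h3⟩
    · have := hT.eq_inv_of_depth x₀ (hl e (by simp)) (hl e' (by simp)) he' he h1
      exact ⟨[], e, l, by simp [this], he⟩

theorem exists_backtrack {l : List Y.E} (h : Y.IsPath x₀ l x₀) (hl : ∀ d ∈ l, d ∈ T)
    (hne : l ≠ []) :
    ∃ l₁ d l₂, l = l₁ ++ d :: Y.inv d :: l₂ ∧
      hT.depth x₀ (Y.tgt d) = hT.depth x₀ (Y.src d) + 1 := by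
  cases l with
  | nil => exact absurd rfl hne
  | cons e l =>
    refine hT.exists_backtrack_cons x₀ h hl ?_ le_rfl
    have h1 := hT.depth_tgt x₀ (hl e (by simp))
    have h2 := hT.depth_root x₀
    rw [h.1, h2] at h1
    rw [h.1, h2]
    omega

/-- Induction over closed paths at the root: every closed path is obtained from the empty one by
inserting backtracks along tree edges that lead away from the root, and by replacing
subpaths `Φ e` by `e`. -/
theorem closed_path_induction {Φ : Y.E → List Y.E}
    (hΦ : ∀ e, Y.IsPath (Y.src e) (Φ e) (Y.tgt e))
    (hwf : WellFounded fun e' e => e' ∈ Φ e ∧ e ∉ T ∧ e' ∉ T) {C : List Y.E → Prop}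
    (nil : C [])
    (pendant : ∀ l₁ l₂ e, e ∈ T → hT.depth x₀ (Y.tgt e) = hT.depth x₀ (Y.src e) + 1 →
      Y.IsPath x₀ l₁ (Y.src e) → C (l₁ ++ l₂) → C (l₁ ++ e :: Y.inv e :: l₂))
    (chord : ∀ l₁ l₂ e, e ∉ T → Y.IsPath x₀ l₁ (Y.src e) →
      C (l₁ ++ (Φ e ++ l₂)) → C (l₁ ++ e :: l₂))
    (l : List Y.E) (hl : Y.IsPath x₀ l x₀) : C l := by
  classical
  -- In the tree, removing a backtrack shortens the path.
  have tree : ∀ n (l : List Y.E), l.length = n → Y.IsPath x₀ l x₀ → (∀ e ∈ l, e ∈ T) → C l := by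
    intro n
    induction n using Nat.strong_induction_on with
    | _ n ih =>
      intro l hn hl hlT
      by_cases hne : l = []
      · exact hne ▸ nil
      obtain ⟨l₁, e, l₂, rfl, he⟩ := hT.exists_backtrack x₀ hl hlT hne
      obtain ⟨r, h1, h2, h3, h4⟩ := isPath_append.1 hl
      have h2 : Y.src e = r := h2
      subst h2
      rw [tgt_inv] at h4
      refine pendant l₁ l₂ e (hlT e (by simp)) he h1
        (ih (l₁ ++ l₂).length ?_ _ rfl (h1.append h4) fun d hd => hlT d ?_)
      · rw [← hn]
        simp
      · simp only [List.mem_append, List.mem_cons] at hd ⊢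
        tauto
  -- In general the induction runs over the multiset of non-tree edges of the path. Replacing one
  -- element by finitely many smaller ones is well-founded (`Relation.CutExpand`).
  have key : ∀ (m : Multiset Y.E) (l : List Y.E), ((l.filter (· ∉ T) : List Y.E) : Multiset Y.E)
      = m → Y.IsPath x₀ l x₀ → C l := by
    intro m
    induction m using hwf.cutExpand.induction with
    | _ m ih =>
      rintro l rfl hl
      by_cases hlT : ∀ e ∈ l, e ∈ T
      · exact tree _ l rfl hl hlT
      push Not at hlT
      obtain ⟨e, hel, heT⟩ := hlT
      obtain ⟨l₁, l₂, rfl⟩ := List.append_of_mem hel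
      obtain ⟨r, h1, h2, h3⟩ := isPath_append.1 hl
      have h2 : Y.src e = r := h2
      subst h2
      refine chord l₁ l₂ e heT h1 (ih _ ?_ _ rfl (h1.append ((hΦ e).append h3)))
      -- The non-tree edges of `Φ e` replace `e`; they are all below `e` in the flow order.
      refine ⟨((Φ e).filter (· ∉ T) : List Y.E), e, ?_, ?_⟩
      · intro d hd
        have hd := List.mem_filter.1 (Multiset.mem_coe.1 hd)
        exact ⟨hd.1, heT, by simpa using hd.2⟩
      · simp only [List.filter_append, List.filter_cons, heT, not_false_eq_true, decide_true,
          if_true, ← Multiset.coe_add, ← Multiset.cons_coe, ← Multiset.singleton_add]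
        abel
  exact key _ l rfl hl

end IsMaximalTree

end OneComplex

/-! ### Words, paths, and the presentation by bounded relators -/

namespace GenSystem

variable {G : Type u} {A : Type v} [Group G] [InvolutiveInv A] (S : GenSystem G A)

theorem eval_append (x y : List A) : S.eval (x ++ y) = S.eval x * S.eval y := by
  simp [eval]

theorem eval_cons (a : A) (x : List A) : S.eval (a :: x) = S.ρ a * S.eval x := by
  simp [eval]

theorem eval_wordInv (x : List A) : S.eval (wordInv x) = (S.eval x)⁻¹ := by
  simp [eval, wordInv, List.prod_inv_reverse, Function.comp_def, S.map_inv]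

theorem eval_rotate {x : List A} (h : S.eval x = 1) (n : ℕ) : S.eval (x.rotate n) = 1 := by
  have h1 : S.eval (x.take (n % x.length)) * S.eval (x.drop (n % x.length)) = 1 := by
    rw [← eval_append, List.take_append_drop, h]
  rw [List.rotate_eq_drop_append_take_mod, eval_append]
  exact mul_eq_one_comm.1 h1

theorem map_snd_pathFrom (g : G) (x : List A) : (S.pathFrom g x).map Prod.snd = x := by
  induction x generalizing g with
  | nil => rfl
  | cons a x ih => simp [pathFrom, ih]

theorem pathFrom_append (g : G) (x y : List A) :
    S.pathFrom g (x ++ y) = S.pathFrom g x ++ S.pathFrom (g * S.eval x) y := by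
  induction x generalizing g with
  | nil => simp [pathFrom, eval]
  | cons a x ih => simp [pathFrom, ih, eval_cons, mul_assoc]

theorem pathFrom_map_snd {g g' : G} {l : List (G × A)} (h : S.cayleyGraph.IsPath g l g') :
    S.pathFrom g (l.map Prod.snd) = l := by
  induction l generalizing g with
  | nil => rfl
  | cons d l ih =>
    obtain ⟨h1, h2⟩ := h
    have h1 : d.1 = g := h1
    rw [List.map_cons, pathFrom, ← h1]
    exact congrArg (d :: ·) (ih h2)

theorem eval_map_snd {g g' : G} {l : List (G × A)} (h : S.cayleyGraph.IsPath g l g') :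
    g * S.eval (l.map Prod.snd) = g' := by
  have h1 := S.isPath_pathFrom g (l.map Prod.snd)
  rw [S.pathFrom_map_snd h] at h1
  exact h1.unique h

theorem lift_wordToFree (x : List A) : FreeGroup.lift S.ρ (wordToFree x) = S.eval x := by
  simp [wordToFree, eval, map_list_prod, Function.comp_def]

theorem _root_.wordToFree_append {A : Type v} (x y : List A) :
    wordToFree (x ++ y) = wordToFree x * wordToFree y := by
  simp [wordToFree]

/-- Used to see that `relators N` is closed under passing to nonempty freely reduced forms. -/
theorem length_le_and_eval_of_freeStep {x y : List A} (h : Relation.ReflTransGen FreeStep x y) :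
    y.length ≤ x.length ∧ S.eval y = S.eval x := by
  induction h with
  | refl => exact ⟨le_rfl, rfl⟩
  | tail _ h ih =>
    obtain ⟨x', y', a⟩ := h
    rw [← ih.2]
    refine ⟨le_trans ?_ ih.1, ?_⟩
    · simp only [List.length_append, List.length_cons]
      omega
    · simp [eval_append, eval_cons, S.map_inv]

/-- The nonempty words of length at most `N` that represent the identity. -/
def relators (N : ℕ) : Set (List A) := {r | r ≠ [] ∧ r.length ≤ N ∧ S.eval r = 1}

variable {S}

theorem IsBoundedFlow.wellFounded_flowRel {T : Set (G × A)} {Φ : G × A → List (G × A)}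
    (h : S.IsBoundedFlow T Φ) : WellFounded fun e' e => e' ∈ Φ e ∧ e ∉ T ∧ e' ∉ T :=
  Subrelation.wf (fun h => Relation.TransGen.single (r := S.flowRel T Φ) h) h.wellFounded

/-- The flow path and the edge have the same ends, so the label closes up. The closing letter is the
reason for the `+ 1` in `hN`. -/
theorem IsBoundedFlow.append_inv_mem_relators {T : Set (G × A)} {Φ : G × A → List (G × A)}
    (h : S.IsBoundedFlow T Φ) {N : ℕ} (hN : ∀ e, (Φ e).length + 1 ≤ N) (e : G × A) :
    (Φ e).map Prod.snd ++ [e.2⁻¹] ∈ S.relators N := by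
  refine ⟨by simp, by simpa using hN e, ?_⟩
  have h1 : e.1 * S.eval ((Φ e).map Prod.snd) = e.1 * S.ρ e.2 :=
    S.eval_map_snd (h.endpoints e)
  rw [eval_append, mul_left_cancel h1]
  simp [eval, S.map_inv]

/-- An element of the kernel is represented modulo `K` by a word that labels a closed path, and
`closed_path_induction` makes that word trivial: backtracks vanish by the relations for formal
inverses, and replacing Φ(e) by e is an application of the relator Φ(e)e⁻¹. -/
theorem IsBoundedFlow.normalClosure_relators {T : Set (G × A)} {Φ : G × A → List (G × A)}
    (h : S.IsBoundedFlow T Φ) {N : ℕ} (hN : ∀ e, (Φ e).length + 1 ≤ N) :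
    Subgroup.normalClosure (wordToFree '' S.relators N ∪
      Set.range fun a : A => FreeGroup.of a * FreeGroup.of a⁻¹) = (FreeGroup.lift S.ρ).ker := by
  set K := Subgroup.normalClosure (wordToFree '' S.relators N ∪
      Set.range fun a : A => FreeGroup.of a * FreeGroup.of a⁻¹) with hK
  have hle : K ≤ (FreeGroup.lift S.ρ).ker := by
    refine Subgroup.normalClosure_le_normal ?_
    rintro _ (⟨r, hr, rfl⟩ | ⟨a, rfl⟩)
    · exact (S.lift_wordToFree r).trans hr.2.2
    · simp [MonoidHom.mem_ker, S.map_inv]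
  have hinv : ∀ a, (FreeGroup.of a : FreeGroup A ⧸ K) * (FreeGroup.of a⁻¹ : FreeGroup A) = 1 := by
    intro a
    exact (QuotientGroup.eq_one_iff _).2 (Subgroup.subset_normalClosure (Or.inr ⟨a, rfl⟩))
  have hrel : ∀ r ∈ S.relators N, ((wordToFree r : FreeGroup A) : FreeGroup A ⧸ K) = 1 :=
    fun r hr => (QuotientGroup.eq_one_iff _).2
      (Subgroup.subset_normalClosure (Or.inl ⟨r, hr, rfl⟩))
  refine le_antisymm hle fun x hx => ?_
  -- Modulo `K` the letter `a⁻¹` is the inverse of `a`, so products of generators without inverses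
  -- suffice.
  obtain ⟨w, hw⟩ : ∃ w : List A, (x : FreeGroup A ⧸ K) = (wordToFree w : FreeGroup A) := by
    clear hx
    induction x using FreeGroup.induction_on with
    | C1 => exact ⟨[], rfl⟩
    | of a => exact ⟨[a], by simp [wordToFree]⟩
    | inv_of a _ =>
      refine ⟨[a⁻¹], ?_⟩
      rw [QuotientGroup.mk_inv, inv_eq_iff_mul_eq_one]
      simpa [wordToFree] using hinv a
    | mul x y hx hy =>
      obtain ⟨w, hw⟩ := hx
      obtain ⟨w', hw'⟩ := hy
      exact ⟨w ++ w', by rw [QuotientGroup.mk_mul, hw, hw', wordToFree_append]; rfl⟩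
  have hw1 : S.eval w = 1 := by
    have h1 : x⁻¹ * wordToFree w ∈ K := QuotientGroup.eq.1 hw
    have h2 := MonoidHom.mem_ker.1 (hle h1)
    rw [map_mul, _root_.map_inv, MonoidHom.mem_ker.1 hx, lift_wordToFree] at h2
    simpa using h2
  rw [← QuotientGroup.eq_one_iff, hw]
  have hpath : S.cayleyGraph.IsPath (1 : G) (S.pathFrom 1 w) (1 : G) := by
    simpa [hw1] using S.isPath_pathFrom 1 w
  have key := h.tree.closed_path_induction (1 : G) (Φ := Φ) h.endpoints h.wellFounded_flowRel
    (C := fun l : List (G × A) =>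
      ((wordToFree (l.map Prod.snd) : FreeGroup A) : FreeGroup A ⧸ K) = 1)
    rfl ?_ ?_ _ hpath
  · rwa [S.map_snd_pathFrom] at key
  · intro (l₁ : List (G × A)) (l₂ : List (G × A)) (e : G × A) _ _ _ hC
    change ((wordToFree (List.map Prod.snd (l₁ ++ e :: (e.1 * S.ρ e.2, e.2⁻¹) :: l₂)) :
      FreeGroup A) : FreeGroup A ⧸ K) = 1
    change ((wordToFree (List.map Prod.snd (l₁ ++ l₂)) : FreeGroup A) : FreeGroup A ⧸ K) = 1 at hC
    simp only [wordToFree, List.map_append, List.map_cons, List.prod_append, List.prod_cons,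
      QuotientGroup.mk_mul] at hC ⊢
    rw [← mul_assoc (FreeGroup.of e.2 : FreeGroup A ⧸ K), hinv, one_mul]
    exact hC
  · intro (l₁ : List (G × A)) (l₂ : List (G × A)) (e : G × A) _ _ hC
    have h1 := hrel _ (h.append_inv_mem_relators hN e)
    rw [wordToFree_append, QuotientGroup.mk_mul] at h1
    have h2 : ((wordToFree ((Φ e).map Prod.snd) : FreeGroup A) : FreeGroup A ⧸ K) =
        (FreeGroup.of e.2 : FreeGroup A) := by
      have h3 := hinv e.2
      have h4 : wordToFree [e.2⁻¹] = FreeGroup.of e.2⁻¹ := by simp [wordToFree]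
      rw [h4] at h1
      exact mul_right_cancel (h1.trans h3.symm)
    change ((wordToFree (List.map Prod.snd (l₁ ++ (Φ e ++ l₂))) : FreeGroup A) :
      FreeGroup A ⧸ K) = 1 at hC
    change ((wordToFree (List.map Prod.snd (l₁ ++ ([e] ++ l₂))) : FreeGroup A) :
      FreeGroup A ⧸ K) = 1
    rw [List.map_append, List.map_append, wordToFree_append, wordToFree_append,
      QuotientGroup.mk_mul, QuotientGroup.mk_mul] at hC ⊢
    rw [h2] at hC
    rw [← hC]
    simp [wordToFree]

/-- The presentation of a stackable group whose relators are all the words of bounded length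
that represent the identity. -/
def IsBoundedFlow.presentation [Finite A] {T : Set (G × A)} {Φ : G × A → List (G × A)}
    (h : S.IsBoundedFlow T Φ) {N : ℕ} (hN : ∀ e, (Φ e).length + 1 ≤ N) :
    S.SymmPresentation where
  R := S.relators N
  finite := (List.finite_length_le A N).subset fun _ hr => hr.2.1
  ne_nil _ hr := hr.1
  inv_mem r hr := ⟨by simpa [wordInv] using hr.1, by simpa [wordInv] using hr.2.1,
    by rw [eval_wordInv, hr.2.2, inv_one]⟩
  rotate_mem r hr n := ⟨by simpa using hr.1, by simpa using hr.2.1, S.eval_rotate hr.2.2 n⟩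
  reduced_mem r hr r' hstep _ hne := by
    obtain ⟨h1, h2⟩ := S.length_le_and_eval_of_freeStep hstep
    exact ⟨hne, h1.trans hr.2.1, h2.trans hr.2.2⟩
  presents := h.normalClosure_relators hN

end GenSystem

/-! ### Computable folds, iterates and functions with recursive graph -/

section Computability

variable {α β γ : Type*} [Primcodable α] [Primcodable β] [Primcodable γ]

/-- Primitive recursion on the number of entries read so far, each looked up by index. The fallback
for a failed lookup is never reached, as the recursion stops at the length of the list. -/
theorem Computable.list_foldl {f : α → List β} {g : α → γ} {h : α → γ × β → γ}
    (hf : Computable f) (hg : Computable g) (hh : Computable₂ h) :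
    Computable fun a => (f a).foldl (fun s b => h a (s, b)) (g a) := by
  have key : Computable fun a => Nat.rec (motive := fun _ => γ) (g a)
      (fun n s => Option.casesOn (motive := fun _ => γ) ((f a)[n]?) s fun b => h a (s, b))
      (f a).length := by
    refine Computable.nat_rec (h := fun a (p : ℕ × γ) =>
      Option.casesOn (motive := fun _ => γ) ((f a)[p.1]?) p.2 fun b => h a (p.2, b))
      (Computable.list_length.comp hf) hg ?_
    exact Computable.option_casesOn
      (Computable.list_getElem?.comp (hf.comp .fst) (Computable.fst.comp .snd))
      (Computable.snd.comp .snd)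
      (hh.comp (Computable.fst.comp .fst)
        (.pair (Computable.snd.comp (Computable.snd.comp .fst)) .snd))
  refine key.of_eq fun a => ?_
  have h1 : ∀ n ≤ (f a).length, Nat.rec (motive := fun _ => γ) (g a)
      (fun n s => Option.casesOn (motive := fun _ => γ) ((f a)[n]?) s fun b => h a (s, b)) n =
      ((f a).take n).foldl (fun s b => h a (s, b)) (g a) := by
    intro n hn
    induction n with
    | zero => rfl
    | succ n ih =>
      simp only [ih (by omega)]
      rw [List.take_add_one, List.foldl_append, List.getElem?_eq_getElem (by omega)]
      rfl
  rw [h1 _ le_rfl, List.take_length]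

theorem Computable.iterate {f : β → β} (hf : Computable f) :
    Computable₂ fun (n : ℕ) (b : β) => f^[n] b := by
  have key : Computable fun p : ℕ × β => Nat.rec (motive := fun _ => β) p.2
      (fun _ s => f s) p.1 :=
    Computable.nat_rec (h := fun _ (q : ℕ × β) => f q.2) .fst .snd
      (hf.comp (Computable.snd.comp .snd))
  refine key.of_eq fun p => ?_
  generalize p.1 = n
  induction n with
  | zero => rfl
  | succ n ih => simp only [ih, Function.iterate_succ_apply']

/-- A function with a recursive graph is computable. -/
theorem ComputablePred.computable_of_graph {f : α → β}
    (h : ComputablePred fun p : α × β => p.2 = f p.1) : Computable f := by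
  obtain ⟨c, hc, hc'⟩ := ComputablePred.computable_iff.1 h
  have hc' : ∀ a b, c (a, b) = true ↔ b = f a := fun a b => by
    rw [← congrFun hc' (a, b)]
  -- Unbounded search through the codes of elements of `β` for one that passes the test; it stops
  -- because `f a` does, and nothing else passes.
  have h1 : Computable₂ fun (a : α) (n : ℕ) =>
      (Encodable.decode (α := β) n).bind fun b => bif c (a, b) then some b else none :=
    Computable.option_bind (Computable.decode.comp .snd)
      (Computable.cond (hc.comp (.pair (Computable.fst.comp .fst) .snd))
        (Computable.option_some.comp .snd) (.const none))
  refine (Partrec.rfindOpt h1).of_eq_tot fun a => ?_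
  have h2 : (Nat.rfindOpt fun n => (Encodable.decode (α := β) n).bind
      fun b => bif c (a, b) then some b else none).Dom :=
    Nat.rfindOpt_dom.2 ⟨Encodable.encode (f a), f a, by simp [(hc' a (f a)).2 rfl]⟩
  obtain ⟨n, hn⟩ := Nat.rfindOpt_spec (Part.get_mem h2)
  obtain ⟨b, -, hb⟩ := Option.bind_eq_some_iff.1 hn
  cases hcb : c (a, b) with
  | false => simp [hcb] at hb
  | true =>
    have h3 : f a = (Nat.rfindOpt _).get h2 := by
      rw [← (hc' a b).1 hcb]
      simpa [hcb] using hb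
    rw [h3]
    exact Part.get_mem h2

end Computability

/-! ### Maxima over words of bounded length -/

section Words

variable (A : Type*) [Finite A]

open Classical in
/-- The words of length at most `n`. -/
def wordsOfLengthLE : ℕ → List (List A)
  | 0 => [[]]
  | n + 1 => [] :: (wordsOfLengthLE n).flatMap fun x =>
      (Set.finite_univ (α := A)).toFinset.toList.map fun a => a :: x

variable {A}

theorem mem_wordsOfLengthLE {n : ℕ} {x : List A} :
    x ∈ wordsOfLengthLE A n ↔ x.length ≤ n := by
  induction n generalizing x with
  | zero => simp [wordsOfLengthLE]
  | succ n ih => cases x <;> simp [wordsOfLengthLE, ih]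

theorem primrec_wordsOfLengthLE [Primcodable A] : Primrec (wordsOfLengthLE A) := by
  have key : Primrec fun n : ℕ => Nat.rec (motive := fun _ => List (List A)) [[]]
      (fun _ s => [] :: s.flatMap fun x =>
        (Set.finite_univ (α := A)).toFinset.toList.map fun a => a :: x) n := by
    refine Primrec.nat_rec₁ (f := fun (_ : ℕ) s => [] :: s.flatMap fun x =>
        (Set.finite_univ (α := A)).toFinset.toList.map fun a => a :: x) _ ?_
    refine Primrec.list_cons.comp (.const []) (Primrec.list_flatMap .snd ?_)
    exact Primrec.list_map (.const _) (Primrec.list_cons.comp .snd (Primrec.snd.comp .fst))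
  refine key.of_eq fun n => ?_
  induction n with
  | zero => rfl
  | succ n ih => simp only [ih, wordsOfLengthLE]

/-- The maximum of a function on the words of length at most `n`. -/
def maxOnWords (g : List A → ℕ) (n : ℕ) : ℕ :=
  (wordsOfLengthLE A n).foldl (fun m x => max m (g x)) 0

theorem List.foldl_max_le_iff {α : Type*} {g : α → ℕ} {l : List α} {m b : ℕ} :
    l.foldl (fun m x => max m (g x)) m ≤ b ↔ m ≤ b ∧ ∀ x ∈ l, g x ≤ b := by
  induction l generalizing m with
  | nil => simp
  | cons x l ih => simp [ih, and_assoc]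

theorem maxOnWords_le_iff {g : List A → ℕ} {n b : ℕ} :
    maxOnWords g n ≤ b ↔ ∀ x : List A, x.length ≤ n → g x ≤ b := by
  simp [maxOnWords, List.foldl_max_le_iff, mem_wordsOfLengthLE]

theorem monotone_maxOnWords (g : List A → ℕ) : Monotone (maxOnWords g) := fun _ _ h =>
  maxOnWords_le_iff.2 fun x hx => maxOnWords_le_iff.1 le_rfl x (hx.trans h)

theorem Computable.maxOnWords [Primcodable A] {g : List A → ℕ} (hg : Computable g) :
    Computable (maxOnWords g) :=
  Computable.list_foldl (h := fun _ (p : ℕ × List A) => max p.1 (g p.2))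
    primrec_wordsOfLengthLE.to_comp (.const 0)
    (Primrec.nat_max.to_comp.comp (Computable.fst.comp .snd)
      (hg.comp (Computable.snd.comp .snd)))

end Words

/-! ### Iterating the flow on paths -/

namespace OneComplex

variable {Y : OneComplex.{u, v}} {T : Set Y.E} (Φ : Y.E → List Y.E)

/-- Replacement of every edge of a path by its flow path. -/
def flowStep (l : List Y.E) : List Y.E := l.flatMap Φ

variable {Φ}

theorem isPath_flowStep (hΦ : ∀ e, Y.IsPath (Y.src e) (Φ e) (Y.tgt e)) {p q : Y.V}
    {l : List Y.E} (h : Y.IsPath p l q) : Y.IsPath p (flowStep Φ l) q := by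
  induction l generalizing p with
  | nil => exact h
  | cons e l ih =>
    obtain ⟨rfl, h⟩ := h
    exact (hΦ e).append (ih h)

theorem isPath_iterate_flowStep (hΦ : ∀ e, Y.IsPath (Y.src e) (Φ e) (Y.tgt e)) {p q : Y.V}
    {l : List Y.E} (h : Y.IsPath p l q) (n : ℕ) : Y.IsPath p ((flowStep Φ)^[n] l) q := by
  induction n with
  | zero => exact h
  | succ n ih =>
    rw [Function.iterate_succ_apply']
    exact isPath_flowStep hΦ ih

theorem flowStep_eq_self (hT : ∀ e ∈ T, Φ e = [e]) {l : List Y.E} (hl : ∀ e ∈ l, e ∈ T) :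
    flowStep Φ l = l := by
  induction l with
  | nil => rfl
  | cons e l ih =>
    have h1 : flowStep Φ l = l := ih fun d hd => hl d (by simp [hd])
    rw [flowStep, List.flatMap_cons, hT e (hl e (by simp))]
    exact congrArg (e :: ·) h1

theorem length_le_length_flowStep (hpos : ∀ e, Φ e ≠ []) (l : List Y.E) :
    l.length ≤ (flowStep Φ l).length := by
  induction l with
  | nil => simp
  | cons e l ih =>
    have h1 := List.length_pos_iff.2 (hpos e)
    rw [flowStep] at ih ⊢
    simp only [List.flatMap_cons, List.length_append, List.length_cons]
    omega

/-- Flow paths are nonempty, so equality of lengths forces `Φ e = [e]` for every edge of a fixed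
path, which outside `T` contradicts well-foundedness. Arrival in the tree thus becomes visible
without deciding membership in `T`. -/
theorem mem_of_flowStep_eq_self (hpos : ∀ e, Φ e ≠ [])
    (hwf : WellFounded fun e' e => e' ∈ Φ e ∧ e ∉ T ∧ e' ∉ T) {l : List Y.E}
    (h : flowStep Φ l = l) : ∀ e ∈ l, e ∈ T := by
  induction l with
  | nil => simp
  | cons e l ih =>
    have h1 : Φ e ++ flowStep Φ l = [e] ++ l := h
    have h2 := length_le_length_flowStep hpos l
    have h3 := List.length_pos_iff.2 (hpos e)
    have h4 := congrArg List.length h1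
    simp only [List.length_append, List.length_singleton] at h4
    obtain ⟨h5, h6⟩ := List.append_inj h1 (by simp; omega)
    rintro d hd
    rcases List.mem_cons.1 hd with rfl | hd
    · by_contra hdT
      exact hwf.irrefl.irrefl d ⟨by simp [h5], hdT, hdT⟩
    · exact ih h6 d hd

theorem iterate_flowStep_append (l l' : List Y.E) (n : ℕ) :
    (flowStep Φ)^[n] (l ++ l') = (flowStep Φ)^[n] l ++ (flowStep Φ)^[n] l' := by
  induction n generalizing l l' with
  | zero => rfl
  | succ n ih =>
    rw [Function.iterate_succ_apply, Function.iterate_succ_apply, Function.iterate_succ_apply, ← ih]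
    simp [flowStep]

theorem iterate_flowStep_subset {l : List Y.E} {e : Y.E} (he : e ∈ l) (n : ℕ) :
    (flowStep Φ)^[n] [e] ⊆ (flowStep Φ)^[n] l := by
  obtain ⟨l₁, l₂, rfl⟩ := List.append_of_mem he
  rw [show l₁ ++ e :: l₂ = l₁ ++ ([e] ++ l₂) from rfl, iterate_flowStep_append,
    iterate_flowStep_append]
  exact fun d hd => List.mem_append_right _ (List.mem_append_left _ hd)

theorem iterate_flowStep_eq (hT : ∀ e ∈ T, Φ e = [e]) {l : List Y.E} {n m : ℕ}
    (hl : ∀ e ∈ (flowStep Φ)^[n] l, e ∈ T) (h : n ≤ m) :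
    (flowStep Φ)^[m] l = (flowStep Φ)^[n] l := by
  obtain ⟨k, rfl⟩ := Nat.exists_eq_add_of_le' h
  rw [Function.iterate_add_apply, Function.iterate_fixed (flowStep_eq_self hT hl)]

/-- Iterating the flow brings every path into the tree. -/
theorem exists_iterate_flowStep (hT : ∀ e ∈ T, Φ e = [e])
    (hwf : WellFounded fun e' e => e' ∈ Φ e ∧ e ∉ T ∧ e' ∉ T) (l : List Y.E) :
    ∃ n, ∀ e ∈ (flowStep Φ)^[n] l, e ∈ T := by
  have of_single : ∀ l : List Y.E, (∀ e ∈ l, ∃ n, ∀ d ∈ (flowStep Φ)^[n] [e], d ∈ T) →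
      ∃ n, ∀ e ∈ (flowStep Φ)^[n] l, e ∈ T := by
    intro l
    induction l with
    | nil =>
      intro _
      exact ⟨0, by simp⟩
    | cons e l ih =>
      intro h
      obtain ⟨n, hn⟩ := h e (by simp)
      obtain ⟨m, hm⟩ := ih fun d hd => h d (by simp [hd])
      refine ⟨max n m, ?_⟩
      rw [← List.singleton_append, iterate_flowStep_append,
        iterate_flowStep_eq hT hn (le_max_left _ _), iterate_flowStep_eq hT hm (le_max_right _ _)]
      intro d hd
      rcases List.mem_append.1 hd with hd | hd
      exacts [hn d hd, hm d hd]
  -- A path needs no longer than its slowest edge; a single edge is treated by well-founded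
  -- induction along the flow.
  refine of_single l fun e he => ?_
  clear he
  induction e using hwf.induction with
  | _ e ih =>
    by_cases he : e ∈ T
    · exact ⟨0, by simpa using he⟩
    · obtain ⟨n, hn⟩ := of_single (Φ e) fun d hd => by
        by_cases hd' : d ∈ T
        · exact ⟨0, by simpa using hd'⟩
        · exact ih d ⟨hd, he, hd'⟩
      refine ⟨n + 1, ?_⟩
      rw [Function.iterate_succ_apply]
      simpa [flowStep] using hn

variable (T Φ) in
/-- The number of iterations of the flow that bring a path into the tree. -/
def flowTime (l : List Y.E) : ℕ := sInf {n | ∀ e ∈ (flowStep Φ)^[n] l, e ∈ T}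

variable (T Φ) in
/-- The path in the tree that results from iterating the flow. -/
def flowLimit (l : List Y.E) : List Y.E := (flowStep Φ)^[flowTime T Φ l] l

theorem flowTime_le {l : List Y.E} {n : ℕ} (h : ∀ e ∈ (flowStep Φ)^[n] l, e ∈ T) :
    flowTime T Φ l ≤ n := Nat.sInf_le h

theorem flowLimit_of_mem {e : Y.E} (he : e ∈ T) : flowLimit T Φ [e] = [e] := by
  have h := flowTime_le (Φ := Φ) (l := [e]) (n := 0) (by simpa using he)
  rw [flowLimit, Nat.le_zero.1 h]
  rfl

section

variable (hT : ∀ e ∈ T, Φ e = [e])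
  (hwf : WellFounded fun e' e => e' ∈ Φ e ∧ e ∉ T ∧ e' ∉ T)

include hT hwf

theorem mem_of_mem_flowLimit (l : List Y.E) : ∀ e ∈ flowLimit T Φ l, e ∈ T :=
  Nat.sInf_mem (s := {n | ∀ e ∈ (flowStep Φ)^[n] l, e ∈ T}) (exists_iterate_flowStep hT hwf l)

theorem iterate_flowStep_eq_flowLimit {l : List Y.E} {n : ℕ} (h : flowTime T Φ l ≤ n) :
    (flowStep Φ)^[n] l = flowLimit T Φ l :=
  iterate_flowStep_eq hT (mem_of_mem_flowLimit hT hwf l) h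

/-- Iterates of a path are concatenations of the iterates of its edges. -/
theorem flowTime_singleton_le {l : List Y.E} {e : Y.E} (he : e ∈ l) :
    flowTime T Φ [e] ≤ flowTime T Φ l :=
  flowTime_le fun d hd =>
    mem_of_mem_flowLimit hT hwf l d (iterate_flowStep_subset he _ hd)

theorem flowLimit_singleton_subset {l : List Y.E} {e : Y.E} (he : e ∈ l) :
    flowLimit T Φ [e] ⊆ flowLimit T Φ l := by
  rw [← iterate_flowStep_eq_flowLimit hT hwf (flowTime_singleton_le hT hwf he)]
  exact iterate_flowStep_subset he _

/-- A non-tree edge spends exactly one round on becoming `Φ e`. This strict decrease is what drives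
`flowBound` down along the flow. -/
theorem flowTime_of_notMem {e : Y.E} (he : e ∉ T) :
    flowTime T Φ [e] = flowTime T Φ (Φ e) + 1 := by
  refine le_antisymm (flowTime_le fun d hd => ?_) ?_
  · rw [Function.iterate_succ_apply] at hd
    refine mem_of_mem_flowLimit hT hwf (Φ e) d ?_
    simpa [flowLimit, flowStep] using hd
  · have h := mem_of_mem_flowLimit hT hwf [e]
    rw [flowLimit] at h
    cases hn : flowTime T Φ [e] with
    | zero => exact absurd (by simpa [hn] using h) he
    | succ n =>
      refine Nat.succ_le_succ (flowTime_le fun d hd => h d ?_)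
      rw [hn, Function.iterate_succ_apply]
      simpa [flowStep] using hd

theorem flowLimit_of_notMem {e : Y.E} (he : e ∉ T) :
    flowLimit T Φ [e] = flowLimit T Φ (Φ e) := by
  rw [flowLimit, flowTime_of_notMem hT hwf he, Function.iterate_succ_apply]
  simp [flowLimit, flowStep]

/-- Makes `flowTime` the first moment at which the iteration is stationary, a condition that can be
tested on labels. -/
theorem flowStep_iterate_eq_iff (hpos : ∀ e, Φ e ≠ []) {l : List Y.E} {n : ℕ} :
    (flowStep Φ)^[n + 1] l = (flowStep Φ)^[n] l ↔ flowTime T Φ l ≤ n := by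
  constructor
  · intro h
    rw [Function.iterate_succ_apply'] at h
    exact flowTime_le (mem_of_flowStep_eq_self hpos hwf h)
  · intro h
    rw [iterate_flowStep_eq_flowLimit hT hwf h,
      iterate_flowStep_eq_flowLimit hT hwf (h.trans n.le_succ)]

end

namespace IsMaximalTree

variable (h : Y.IsMaximalTree T) (x₀ : Y.V)

variable (Φ) in
/-- A bound for an edge that decreases along the flow. -/
def flowBound (e : Y.E) : ℕ :=
  2 * flowTime T Φ [e] + ((flowLimit T Φ [e]).map fun d =>
    4 * max (h.depth x₀ (Y.src d)) (h.depth x₀ (Y.tgt d))).foldr max 0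

theorem depth_le_flowBound {e : Y.E} (he : e ∈ T) :
    4 * h.depth x₀ (Y.src e) ≤ h.flowBound Φ x₀ e ∧
      4 * h.depth x₀ (Y.tgt e) ≤ h.flowBound Φ x₀ e := by
  rw [flowBound, flowLimit_of_mem he]
  simp only [List.map_cons, List.map_nil, List.foldr_cons, List.foldr_nil]
  omega

variable (hT : ∀ e ∈ T, Φ e = [e])
  (hwf : WellFounded fun e' e => e' ∈ Φ e ∧ e ∉ T ∧ e' ∉ T)

include hT hwf

/-- The time of `e` exceeds that of `Φ e`, hence that of `e'`, by at least one, and time is counted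
twice. The depth term does not grow, since the limit of `e'` is part of the limit of `e`. -/
theorem flowBound_add_two_le {e e' : Y.E} (he : e ∉ T) (he' : e' ∈ Φ e) :
    h.flowBound Φ x₀ e' + 2 ≤ h.flowBound Φ x₀ e := by
  have h1 := flowTime_of_notMem hT hwf he
  have h2 := flowTime_singleton_le hT hwf he'
  have h3 : ((flowLimit T Φ [e']).map fun d =>
      4 * max (h.depth x₀ (Y.src d)) (h.depth x₀ (Y.tgt d))).foldr max 0 ≤
      ((flowLimit T Φ [e]).map fun d =>
      4 * max (h.depth x₀ (Y.src d)) (h.depth x₀ (Y.tgt d))).foldr max 0 := by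
    rw [flowLimit_of_notMem hT hwf he, List.foldr_max_le_iff]
    intro m hm
    exact List.le_foldr_max (List.map_subset _ (flowLimit_singleton_subset hT hwf he') hm)
  rw [flowBound, flowBound]
  omega

/-- The limit of a path from the root is a tree path from the root, so its vertices have depth at
most its length. The resulting bound can be computed from the label of `l`, without knowing depths.
-/
theorem flowBound_le (hΦ : ∀ e, Y.IsPath (Y.src e) (Φ e) (Y.tgt e)) {q : Y.V} {l : List Y.E}
    (hl : Y.IsPath x₀ l q) {e : Y.E} (he : e ∈ l) :
    h.flowBound Φ x₀ e ≤ 2 * flowTime T Φ l + 4 * (flowLimit T Φ l).length := by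
  have h1 := flowTime_singleton_le hT hwf he
  have h2 : ((flowLimit T Φ [e]).map fun d =>
      4 * max (h.depth x₀ (Y.src d)) (h.depth x₀ (Y.tgt d))).foldr max 0 ≤
      4 * (flowLimit T Φ l).length := by
    rw [List.foldr_max_le_iff]
    intro m hm
    obtain ⟨d, hd, rfl⟩ := List.mem_map.1 hm
    have hd := flowLimit_singleton_subset hT hwf he hd
    have hp : Y.IsPath x₀ (flowLimit T Φ l) q := isPath_iterate_flowStep hΦ hl _
    have hmem := mem_of_mem_flowLimit hT hwf l
    generalize flowLimit T Φ l = z at hd hp hmem ⊢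
    obtain ⟨z₁, z₂, rfl⟩ := List.append_of_mem hd
    obtain ⟨r, h3, h4, -⟩ := isPath_append.1 hp
    have h5 := h.depth_le_add_length x₀ h3 fun b hb => hmem b (by simp [hb])
    have h6 := h.depth_tgt x₀ (hmem d (by simp))
    have h7 := h.depth_root x₀
    have h4 : Y.src d = r := h4
    rw [h4] at h6 ⊢
    simp only [List.length_append, List.length_cons]
    omega
  rw [flowBound]
  omega

end IsMaximalTree

end OneComplex

/-! ### Computability of the flow on words -/

namespace GenSystem

variable {G : Type u} {A : Type v} [Group G] [InvolutiveInv A] (S : GenSystem G A)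
  {T : Set S.cayleyGraph.E} (Φ : S.cayleyGraph.E → List S.cayleyGraph.E)

/-- The path from the identity with the given label, as a path of the Cayley graph. -/
def pathOne (x : List A) : List S.cayleyGraph.E := S.pathFrom 1 x

/-- The letter that labels an edge of the Cayley graph. -/
def letter (e : S.cayleyGraph.E) : A := Prod.snd (α := G) e

/-- The word that labels a path of the Cayley graph. -/
def word (l : List S.cayleyGraph.E) : List A := l.map S.letter

theorem length_word (l : List S.cayleyGraph.E) : (S.word l).length = l.length := List.length_map _

theorem word_pathOne (x : List A) : S.word (S.pathOne x) = x := S.map_snd_pathFrom 1 x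

theorem isPath_pathOne (x : List A) : S.cayleyGraph.IsPath (1 : G) (S.pathOne x) (S.eval x) := by
  have h := S.isPath_pathFrom 1 x
  rwa [one_mul] at h

theorem pathOne_word {g : G} {l : List S.cayleyGraph.E}
    (h : S.cayleyGraph.IsPath (1 : G) l g) : S.pathOne (S.word l) = l := S.pathFrom_map_snd h

/-- The label of the path obtained by applying the flow to the edges of the path from the
identity with the given label. -/
def flowWord (x : List A) : List A := S.word (OneComplex.flowStep Φ (S.pathOne x))

variable {S Φ}

/-- The flow preserves endpoints, so every iterate is again a path from the identity and can be
recovered from its label. -/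
theorem iterate_flowWord
    (hΦ : ∀ e, S.cayleyGraph.IsPath (S.cayleyGraph.src e) (Φ e) (S.cayleyGraph.tgt e))
    (x : List A) (n : ℕ) :
    (S.flowWord Φ)^[n] x = S.word ((OneComplex.flowStep Φ)^[n] (S.pathOne x)) := by
  induction n with
  | zero => exact (S.word_pathOne x).symm
  | succ n ih =>
    rw [Function.iterate_succ_apply', Function.iterate_succ_apply', ih, flowWord,
      S.pathOne_word (OneComplex.isPath_iterate_flowStep hΦ (S.isPath_pathOne x) n)]

theorem iterate_flowWord_eq_iff
    (hΦ : ∀ e, S.cayleyGraph.IsPath (S.cayleyGraph.src e) (Φ e) (S.cayleyGraph.tgt e))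
    (hT : ∀ e ∈ T, Φ e = [e])
    (hwf : WellFounded fun e' e => e' ∈ Φ e ∧ e ∉ T ∧ e' ∉ T) (x : List A) (n : ℕ) :
    (S.flowWord Φ)^[n + 1] x = (S.flowWord Φ)^[n] x ↔
      OneComplex.flowTime T Φ (S.pathOne x) ≤ n := by
  -- An empty flow path would make `e` a loop, which `ne_one` excludes.
  have hpos : ∀ e, Φ e ≠ [] := by
    intro (e : G × A) he
    have h1 := hΦ e
    rw [he] at h1
    have h1 : e.1 = e.1 * S.ρ e.2 := h1
    exact S.ne_one e.2 (by simpa using h1.symm)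
  rw [← OneComplex.flowStep_iterate_eq_iff hT hwf hpos, iterate_flowWord hΦ, iterate_flowWord hΦ]
  refine ⟨fun h => ?_, fun h => by rw [h]⟩
  have h := congrArg S.pathOne h
  rwa [S.pathOne_word (OneComplex.isPath_iterate_flowStep hΦ (S.isPath_pathOne x) _),
    S.pathOne_word (OneComplex.isPath_iterate_flowStep hΦ (S.isPath_pathOne x) _)] at h

theorem flowWord_concat (x : List A) (a : A) :
    S.flowWord Φ (x ++ [a]) = S.flowWord Φ x ++ S.word (Φ (S.eval x, a)) := by
  have h : S.pathFrom 1 (x ++ [a]) = S.pathFrom 1 x ++ [(S.eval x, a)] := by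
    simp [pathFrom_append, pathFrom]
  let e : S.cayleyGraph.E := (S.eval x, a)
  have h : S.pathOne (x ++ [a]) = S.pathOne x ++ [e] := h
  rw [flowWord, h, OneComplex.flowStep, List.flatMap_append, word, List.map_append,
    List.flatMap_singleton]
  rfl

theorem computable_flowWord [Primcodable A]
    (hc : Computable fun q : List A × A => S.word (Φ (S.eval q.1, q.2))) :
    Computable (S.flowWord Φ) := by
  -- The state of the fold is the prefix read so far, which names the current vertex, together with
  -- the output.
  have key := Computable.list_foldl (α := List A) (f := id)
    (g := fun _ => (([] : List A), ([] : List A)))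
    (h := fun _ (p : (List A × List A) × A) =>
      (p.1.1 ++ [p.2], p.1.2 ++ S.word (Φ (S.eval p.1.1, p.2))))
    .id (.const _)
    (.pair (Computable.list_concat.comp (Computable.fst.comp (Computable.fst.comp .snd))
        (Computable.snd.comp .snd))
      (Computable.list_append.comp (Computable.snd.comp (Computable.fst.comp .snd))
        (hc.comp (.pair (Computable.fst.comp (Computable.fst.comp .snd))
          (Computable.snd.comp .snd)))))
  refine (Computable.snd.comp key).of_eq fun x => ?_
  suffices h : (id x).foldl (fun (s : List A × List A) a =>
      (s.1 ++ [a], s.2 ++ S.word (Φ (S.eval s.1, a)))) ([], []) = (x, S.flowWord Φ x) from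
    congrArg Prod.snd h
  induction x using List.reverseRecOn with
  | nil => rfl
  | append_singleton x a ih =>
    rw [id, List.foldl_append, show x.foldl _ _ = _ from ih, flowWord_concat]
    rfl

/-- A recursive bound for the `flowBound` of the edges on a path, in terms of its label. -/
theorem computable_flowTime_add_flowLimit [Primcodable A]
    (hΦ : ∀ e, S.cayleyGraph.IsPath (S.cayleyGraph.src e) (Φ e) (S.cayleyGraph.tgt e))
    (hT : ∀ e ∈ T, Φ e = [e])
    (hwf : WellFounded fun e' e => e' ∈ Φ e ∧ e ∉ T ∧ e' ∉ T)
    (hc : Computable fun q : List A × A => S.word (Φ (S.eval q.1, q.2))) :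
    Computable fun x : List A => 2 * OneComplex.flowTime T Φ (S.pathOne x) +
      4 * (OneComplex.flowLimit T Φ (S.pathOne x)).length := by
  classical
  have hit := Computable.iterate (computable_flowWord hc)
  have hdec : ComputablePred fun p : List A × ℕ =>
      (S.flowWord Φ)^[p.2 + 1] p.1 = (S.flowWord Φ)^[p.2] p.1 := by
    refine ComputablePred.computable_iff.2 ⟨fun p =>
      decide ((S.flowWord Φ)^[p.2 + 1] p.1 = (S.flowWord Φ)^[p.2] p.1), ?_,
      funext fun p => decide_eq_true_eq.symm⟩
    exact (Primrec.eq (α := List A)).decide.to_comp.comp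
      (hit.comp (Computable.succ.comp .snd) .fst) (hit.comp .snd .fst)
  have hex : ∀ x : List A, ∃ n, (S.flowWord Φ)^[n + 1] x = (S.flowWord Φ)^[n] x :=
    fun x => ⟨_, (iterate_flowWord_eq_iff hΦ hT hwf x _).2 le_rfl⟩
  -- The flow time is found by searching for the first stationary iterate.
  have htime : Computable fun x : List A => OneComplex.flowTime T Φ (S.pathOne x) := by
    refine (Computable.find (P := fun x n =>
      (S.flowWord Φ)^[n + 1] x = (S.flowWord Φ)^[n] x) hdec hex).of_eq fun x => ?_
    refine le_antisymm (Nat.find_min' _ ((iterate_flowWord_eq_iff hΦ hT hwf x _).2 le_rfl)) ?_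
    exact (iterate_flowWord_eq_iff hΦ hT hwf x _).1 (Nat.find_spec (hex x))
  have hlim : Computable fun x : List A => (OneComplex.flowLimit T Φ (S.pathOne x)).length := by
    refine (Computable.list_length.comp (hit.comp htime .id)).of_eq fun x => ?_
    rw [id, iterate_flowWord hΦ, length_word]
    rfl
  exact Primrec.nat_add.to_comp.comp (Primrec.nat_mul.to_comp.comp (.const 2) htime)
    (Primrec.nat_mul.to_comp.comp (.const 4) hlim)

/-- In an algorithmically stackable group the `flowBound` of an edge is bounded by a
recursive function of its distance from the identity. -/
theorem IsBoundedFlow.exists_computable_flowBound_le [Primcodable A] [Finite A]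
    (h : S.IsBoundedFlow T Φ)
    (hc : Computable fun q : List A × A => S.word (Φ (S.eval q.1, q.2))) :
    ∃ f : ℕ → ℕ, Computable f ∧ Monotone f ∧ ∀ (e : S.cayleyGraph.E) (n : ℕ),
      4 * min (S.cayleyGraph.vdist (1 : G) (S.cayleyGraph.src e))
        (S.cayleyGraph.vdist (1 : G) (S.cayleyGraph.tgt e)) ≤ n →
      h.tree.flowBound Φ (1 : G) e ≤ f n := by
  refine ⟨fun n => maxOnWords (fun x => 2 * OneComplex.flowTime T Φ (S.pathOne x) +
      4 * (OneComplex.flowLimit T Φ (S.pathOne x)).length) (n + 2),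
    (Computable.maxOnWords (computable_flowTime_add_flowLimit h.endpoints h.degenerate
      h.wellFounded_flowRel hc)).comp (Computable.succ.comp .succ),
    fun _ _ hnm => monotone_maxOnWords _ (by omega), fun e n hn => ?_⟩
  have hconn : ∀ g, ∃ l, S.cayleyGraph.IsPath (1 : G) l g :=
    fun g => ⟨_, h.tree.treePath_isPath (1 : G) g⟩
  -- If the target of `e` is the nearer end, the source is at most one step further, and `e` itself
  -- adds another: this accounts for the `n + 2`.
  have h1 := OneComplex.vdist_tgt_le (e := S.cayleyGraph.inv e) (hconn _)
  rw [OneComplex.tgt_inv, OneComplex.src_inv] at h1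
  obtain ⟨l, hl, hlen⟩ := OneComplex.exists_isPath_length_eq_vdist
    (hconn (S.cayleyGraph.src e))
  have hle := hl.append (l' := [e]) ⟨rfl, rfl⟩
  refine (h.tree.flowBound_le (1 : G) h.degenerate h.wellFounded_flowRel h.endpoints hle
    (e := e) (by simp)).trans ?_
  have h2 := maxOnWords_le_iff.1 (le_refl (maxOnWords (fun x =>
    2 * OneComplex.flowTime T Φ (S.pathOne x) +
      4 * (OneComplex.flowLimit T Φ (S.pathOne x)).length) (n + 2))) (S.word (l ++ [e])) (by
        rw [length_word, List.length_append, List.length_singleton]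
        omega)
  rwa [S.pathOne_word hle] at h2

end GenSystem

/-! ### From tame contractions to tame 1-combings -/

namespace TwoComplex.TameDiagram

variable {X : TwoComplex.{u, v, w}} {A : Type u'} [InvolutiveInv A]
  {x₀ : X.V} {lab : X.E → A} {R : Set (List A)} {depth : X.V → ℕ} {M : X.E → ℕ}
  {f : ℕ → ℕ} {l : List X.E} (Z : TameDiagram X x₀ lab R depth M f l)

/-- The restriction of the contraction to the boundary. -/
def combing (q : Z.D.boundary × I) : Z.D.Realization := Z.Ψ (q.2, q.1)

theorem isOneCombing : Z.D.IsOneCombing Z.D.boundary Z.D.base Z.combing where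
  continuous := Z.Ψ.continuous.comp (by fun_prop)
  start p := Z.Ψ.apply_zero p
  finish p := Z.Ψ.apply_one p
  base _ t := Z.base_fixed t
  vertex q _ t := Z.vertex_mem q t

theorem coarseDist4_map_le (x : Z.D.Realization) :
    X.coarseDist4 x₀ (Z.π.map x) ≤ Z.D.coarseDist4 Z.D.base x := by
  have h := Z.π.coarseDist4_map_le Z.D.connected x
  rwa [Z.π_base] at h

/-- The right-hand side of `tame` is weakened: the distance in the diagram dominates that of the
image, and `f` is monotone. -/
theorem isTame_combing (hf : Monotone f) : Z.D.IsTame Z.D.base f Z.combing :=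
  fun p s t hst => (Z.tame p s t hst.le).trans (hf (Z.coarseDist4_map_le _))

/-- Here the left-hand side of `tame` is weakened instead. -/
theorem isTame_map_combing : X.IsTame x₀ f (Z.π.map ∘ Z.combing) :=
  fun p s t hst => (Z.coarseDist4_map_le _).trans (Z.tame p s t hst.le)

end TwoComplex.TameDiagram

/-! ### Tame diagrams in stackable groups -/

namespace GenSystem

variable {G : Type u} {A : Type v} [Group G] [InvolutiveInv A] {S : GenSystem G A}
  {T : Set S.cayleyGraph.E} {Φ : S.cayleyGraph.E → List S.cayleyGraph.E}

/-- In a stackable group every closed path at the identity bounds a tame diagram. -/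
theorem IsBoundedFlow.nonempty_tameDiagram [Finite A] (h : S.IsBoundedFlow T Φ) {N : ℕ}
    (hN : ∀ e, (Φ e).length + 1 ≤ N) {f : ℕ → ℕ}
    (hf : ∀ (e : S.cayleyGraph.E) (n : ℕ),
      4 * min (S.cayleyGraph.vdist (1 : G) (S.cayleyGraph.src e))
        (S.cayleyGraph.vdist (1 : G) (S.cayleyGraph.tgt e)) ≤ n →
      h.tree.flowBound Φ (1 : G) e ≤ f n)
    (l : List S.cayleyGraph.E) (hl : S.cayleyGraph.IsPath (1 : G) l (1 : G)) :
    Nonempty (TwoComplex.TameDiagram (h.presentation hN).cayleyComplex (1 : G) S.letter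
      (h.presentation hN).R (h.tree.depth (1 : G)) (h.tree.flowBound Φ (1 : G)) f l) := by
  have hlab : ∀ e, S.letter (S.cayleyGraph.inv e) = (S.letter e)⁻¹ := fun _ => rfl
  refine h.tree.closed_path_induction (1 : G) h.endpoints h.wellFounded_flowRel
    (C := fun l => Nonempty (TwoComplex.TameDiagram (h.presentation hN).cayleyComplex (1 : G)
      S.letter (h.presentation hN).R (h.tree.depth (1 : G)) (h.tree.flowBound Φ (1 : G)) f l))
    ?_ ?_ ?_ l hl
  · exact ⟨TwoComplex.TameDiagram.point _ _ _ _ _ _⟩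
  · rintro l₁ l₂ e he hd hl₁ ⟨Z⟩
    exact TwoComplex.TameDiagram.nonempty_pendant hlab
      (h.tree.depth_le_flowBound (1 : G) he).2
      (h.tree.depth_le_flowBound (1 : G) (h.tree.inv_mem e he)).1
      (hf e) hd.ge hl₁ Z
  · rintro l₁ l₂ e he hl₁ ⟨Z⟩
    have hrel : S.word (Φ e) ++ [(S.letter e)⁻¹] ∈ S.relators N :=
      h.append_inv_mem_relators hN e
    -- The 2-cell at the start of `e` with relator Φ(e)e⁻¹ is attached along exactly the path
    -- required for a chord, since a path is recovered from its start and its label.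
    have hbdry : S.pathFrom (S.cayleyGraph.src e) (S.word (Φ e) ++ [(S.letter e)⁻¹]) =
        Φ e ++ [S.cayleyGraph.inv e] :=
      (congrArg (S.pathFrom _)
        (List.map_append (f := S.letter) (l₂ := [S.cayleyGraph.inv e])).symm).trans
        (S.pathFrom_map_snd ((h.endpoints e).append (l' := [S.cayleyGraph.inv e])
          ⟨rfl, OneComplex.tgt_inv e⟩))
    refine TwoComplex.TameDiagram.nonempty_chord (X := (h.presentation hN).cayleyComplex)
      (φ := (S.cayleyGraph.src e, ⟨_, hrel⟩)) hlab hbdry ?_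
      (fun e' he' => h.tree.flowBound_add_two_le (1 : G) h.degenerate h.wellFounded_flowRel he he')
      (hf e) hrel (h.endpoints e) hl₁ Z
    intro (heq : Prod.fst (α := G) e = Prod.fst (α := G) e * S.ρ (S.letter e))
    exact S.ne_one _ (by simpa using heq.symm)

end GenSystem

end

theorem mainTheorem4 {G : Type*} {A : Type*} [Group G] [Finite A] [Primcodable A]
    [InvolutiveInv A] (S : GenSystem G A) (hS : S.IsAlgorithmicallyStackable) :
    ∃ P : S.SymmPresentation,
      (∃ f : ℕ → ℕ, Computable f ∧ P.IsIntrinsicTameFilling f) ∧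
      (∃ f : ℕ → ℕ, Computable f ∧ P.IsExtrinsicTameFilling f) := by
  obtain ⟨T, Φ, h, hgraph⟩ := hS
  obtain ⟨k, hk⟩ := h.bounded
  have hN : ∀ e, (Φ e).length + 1 ≤ k + 1 := fun e => Nat.succ_le_succ (hk e)
  -- The recursive set of triples in the definition of stackability is the graph of this function.
  have hc : Computable fun q : List A × A => S.word (Φ (S.eval q.1, q.2)) := by
    refine ComputablePred.computable_of_graph ?_
    refine ComputablePred.computable_iff.2 ?_
    obtain ⟨c, hc, hc'⟩ := ComputablePred.computable_iff.1 hgraph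
    refine ⟨fun p => c (p.1.1, p.1.2, p.2), hc.comp (.pair (Computable.fst.comp .fst)
      (.pair (Computable.snd.comp .fst) .snd)), funext fun p => ?_⟩
    exact congrFun hc' (p.1.1, p.1.2, p.2)
  obtain ⟨f, hfc, hfm, hf⟩ := h.exists_computable_flowBound_le hc
  have key : ∀ x : List A, S.eval x = 1 → ∃ l : List S.cayleyGraph.E,
      l.map S.letter = x ∧ Nonempty (TwoComplex.TameDiagram (h.presentation hN).cayleyComplex
        (1 : G) S.letter (h.presentation hN).R (h.tree.depth (1 : G))
        (h.tree.flowBound Φ (1 : G)) f l) := fun x hx =>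
    ⟨S.pathOne x, S.word_pathOne x, h.nonempty_tameDiagram hN hf _ (by
      simpa [hx] using S.isPath_pathOne x)⟩
  refine ⟨h.presentation hN, ⟨f, hfc, hfm, fun x hx => ?_⟩, ⟨f, hfc, hfm, fun x hx => ?_⟩⟩
  · obtain ⟨l, rfl, ⟨Z⟩⟩ := key x hx
    exact ⟨Z.D, Z.combing, Z.isOneCombing, Z.isTame_combing hfm⟩
  · obtain ⟨l, rfl, ⟨Z⟩⟩ := key x hx
    exact ⟨Z.D, Z.combing, Z.π, Z.isOneCombing, ⟨Z.π_base, Z.lab_emap⟩, Z.isTame_map_combing⟩
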